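/- Let $(M,\mathbf g)$ be a smooth $4$-dimensional (Hausdorff) Lorentzian manifold of signature $(1,3)$, and let $\nabla$ be its Levi-Civita connection (smooth, $\nabla\mathbf g=0$, torsion zero). Let $\{\mathbf e_\alpha\}$ be an arbitrary smooth frame over an open set $U\subset M$, $\{\theta^\alpha\}$ its dual frame, $g_{\alpha\beta}=\mathbf g(\mathbf e_\alpha,\mathbf e_\beta)$, $(g^{\alpha\beta})$ the inverse matrix, $\theta_\sigma=g_{\sigma\nu}\theta^\nu$, and $\nabla_{\mathbf e_\alpha}\mathbf e_\beta=\gamma^\mu_{\alpha\beta}\mathbf e_\mu$. Multiform fields are regarded as sections of the Clifford bundle $\mathcal{C\ell}(T^*M)$ (Clifford product written by juxtaposition, $\theta^\alpha\theta^\beta+\theta^\beta\theta^\alpha=2g^{\alpha\beta}$), with exterior product $\wedge$ and left contraction $\lrcorner$ taken with the metric. On these fields put $$\partial=\theta^\alpha\nabla_{\mathbf e_\alpha},\qquad \partial\wedge\partial=(\theta^\alpha\wedge\theta^\beta)\bigl(\nabla_{\mathbf e_\alpha}\nabla_{\mathbf e_\beta}-\gamma^\rho_{\alpha\beta}\nabla_{\mathbf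 e_\rho}\bigr),$$ where the $2$-form $\theta^\alpha\wedge\theta^\beta$ acts by the Clifford product. With $R(X,Y)=\nabla_X\nabla_Y-\nabla_Y\nabla_X-\nabla_{[X,Y]}$ define $$R(\mathbf e_\alpha,\mathbf e_\beta)\mathbf e_\rho=R_\rho{}^\mu{}_{\alpha\beta}\,\mathbf e_\mu,\quad \mathcal R_\rho^\mu=\tfrac12R_\rho{}^\mu{}_{\alpha\beta}\,\theta^\alpha\wedge\theta^\beta,\quad \mathcal R^{\rho\sigma}=g^{\rho\mu}\mathcal R_\mu^\sigma,$$ $$R^\mu_\beta=g^{\rho\alpha}R_\rho{}^\mu{}_{\alpha\beta},\quad \mathcal R^\mu=R^\mu_\beta\theta^\beta,\quad R=R^\mu_\mu .$$ Then the following hold on $U$. 1. For every smooth multiform field $\omega$ on $U$, $$(\partial\wedge\partial)\,\omega=\mathcal R^\sigma\wedge(\theta_\sigma\lrcorner\,\omega)+\mathcal R^{\rho\sigma}\wedge\bigl(\theta_\rho\lrcorner(\theta_\sigma\lrcorner\,\omega)\bigr).$$ 2. For every smooth $r$-form field $\omega=\frac1{r!}\omega_{\alpha_1\ldots\alpha_r}\theta^{\alpha_1}\wedge\cdots\wedge\theta^{\alpha_r}$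 on $U$, the field $\partial^2\omega$ is an $r$-form field with components $$(\partial^2\omega)_{\alpha_1\ldots\alpha_r}=g^{\alpha\beta}\nabla_\alpha\nabla_\beta\,\omega_{\alpha_1\ldots\alpha_r}-\sum_p(-1)^pR^\sigma_{\alpha_p}\,\omega_{\sigma\alpha_1\ldots\check\alpha_p\ldots\alpha_r}-2\sum_{p<q}(-1)^{p+q}R^\rho{}_{\alpha_q}{}^\sigma{}_{\alpha_p}\,\omega_{\rho\sigma\alpha_1\ldots\check\alpha_p\ldots\check\alpha_q\ldots\alpha_r},$$ where $1\le p,q\le r$, a checked index is omitted, $\nabla_\alpha\nabla_\beta\,\omega_{\alpha_1\ldots\alpha_r}$ are the components of the second covariant derivative of $\omega$, and $R^\rho{}_\kappa{}^\sigma{}_\lambda=g^{\rho\alpha}g^{\sigma\beta}g_{\kappa\nu}R_\alpha{}^\nu{}_{\beta\lambda}$. 3. If $M$ is oriented with metric volume form $\tau$, let $\star$ be the Hodge star ($A\wedge\star B=(A\cdot B)\tau$ for forms $A,B$ of equal degree, i.e. $\star A=\tilde A\,\tau$ with $\tilde A$ the reverse of $A$), and let $\blacktriangledown=\frac12\star^{-1}\bigl(\mathcal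 R^{\rho\sigma}\wedge\theta_\rho\lrcorner\theta_\sigma\lrcorner\bigr)\star$ be the Einstein operator. Then $$\blacktriangledown\theta^\mu=\mathcal R^\mu-\tfrac12R\,\theta^\mu .$$ -/

import Mathlib

open scoped Manifold ContDiff

noncomputable section

/-- The model space `ℝ⁴`. -/
abbrev R4 : Type := EuclideanSpace ℝ (Fin 4)

/-- The matrix `diag(1, -1, -1, -1)`. -/
def minkowski (a b : Fin 4) : ℝ := if a = b then (if a = 0 then 1 else -1) else 0

/-- A smooth Lorentzian metric of signature `(1, 3)` on a smooth manifold of dimension `4`. -/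
structure LorentzMetric (M : Type*) [TopologicalSpace M] [ChartedSpace R4 M]
    [IsManifold (𝓡 4) ∞ M] where
  toFun (x : M) : TangentSpace (𝓡 4) x →L[ℝ] TangentSpace (𝓡 4) x →L[ℝ] ℝ
  symm (x : M) (v w : TangentSpace (𝓡 4) x) : toFun x v w = toFun x w v
  signature (x : M) : ∃ b : Module.Basis (Fin 4) ℝ (TangentSpace (𝓡 4) x),
    ∀ i j, toFun x (b i) (b j) = minkowski i j
  contMDiff : ContMDiff (𝓡 4) ((𝓡 4).prod 𝓘(ℝ, R4 →L[ℝ] R4 →L[ℝ] ℝ)) ∞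
    (fun x ↦ Bundle.TotalSpace.mk' (R4 →L[ℝ] R4 →L[ℝ] ℝ)
      (E := fun x : M ↦ TangentSpace (𝓡 4) x →L[ℝ] TangentSpace (𝓡 4) x →L[ℝ] ℝ) x (toFun x))

instance tangentSpace_finiteDimensional {M : Type*} [TopologicalSpace M] [ChartedSpace R4 M]
    (x : M) : FiniteDimensional ℝ (TangentSpace (𝓡 4) x) :=
  inferInstanceAs (FiniteDimensional ℝ R4)

/-! ### Exterior product and contraction in a Clifford algebra -/

section CliffordFibre

variable {V : Type*} [AddCommGroup V] [Module ℝ V]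

/-- The exterior product on a Clifford algebra, transported from the exterior algebra along the
canonical linear isomorphism. -/
def wedge {Q : QuadraticForm ℝ V} (A B : CliffordAlgebra Q) : CliffordAlgebra Q :=
  (CliffordAlgebra.equivExterior Q).symm
    (CliffordAlgebra.equivExterior Q A * CliffordAlgebra.equivExterior Q B)

/-- The exterior product `a₁ ∧ ⋯ ∧ aᵣ` of a list of vectors. -/
def wedgeList (Q : QuadraticForm ℝ V) (l : List V) : CliffordAlgebra Q :=
  (CliffordAlgebra.equivExterior Q).symm ((l.map (ExteriorAlgebra.ι ℝ)).prod)

/-- The part of degree `0` of a multivector. -/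
def scalarPart {Q : QuadraticForm ℝ V} (A : CliffordAlgebra Q) : ℝ :=
  ExteriorAlgebra.algebraMapInv (CliffordAlgebra.equivExterior Q A)

/-- `A` is homogeneous of degree `r`. -/
def IsHomogeneousOfDegree {Q : QuadraticForm ℝ V} (r : ℕ) (A : CliffordAlgebra Q) : Prop :=
  CliffordAlgebra.equivExterior Q A ∈ ⋀[ℝ]^r V

/-! ### Helper facts on the exterior product in a Clifford algebra -/

open CliffordAlgebra

section
variable {Q : QuadraticForm ℝ V}

theorem equivExterior_ι (a : V) : equivExterior Q (ι Q a) = ExteriorAlgebra.ι ℝ a :=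
  changeForm_ι changeForm.associated_neg_proof a

theorem equivExterior_wedge (x y : CliffordAlgebra Q) :
    equivExterior Q (wedge x y) = equivExterior Q x * equivExterior Q y :=
  LinearEquiv.apply_symm_apply _ _

theorem wedge_assoc (x y z : CliffordAlgebra Q) : wedge (wedge x y) z = wedge x (wedge y z) := by
  apply (equivExterior Q).injective
  simp only [equivExterior_wedge, mul_assoc]

theorem wedgeList_nil : wedgeList Q ([] : List V) = 1 := by
  apply (equivExterior Q).injective
  refine (LinearEquiv.apply_symm_apply _ _).trans ?_
  exact (changeForm_one changeForm.associated_neg_proof).symm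

theorem one_wedge (x : CliffordAlgebra Q) : wedge 1 x = x := by
  apply (equivExterior Q).injective
  have h : equivExterior Q (1 : CliffordAlgebra Q) = 1 :=
    changeForm_one changeForm.associated_neg_proof
  rw [equivExterior_wedge, h, one_mul]

theorem wedgeList_cons (a : V) (l : List V) :
    wedgeList Q (a :: l) = wedge (ι Q a) (wedgeList Q l) := by
  apply (equivExterior Q).injective
  rw [equivExterior_wedge, equivExterior_ι]
  unfold wedgeList
  rw [LinearEquiv.apply_symm_apply, LinearEquiv.apply_symm_apply, List.map_cons, List.prod_cons]

theorem wedge_add (x y z : CliffordAlgebra Q) : wedge x (y + z) = wedge x y + wedge x z := by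
  simp only [wedge, map_add, mul_add]

theorem wedge_smul (c : ℝ) (x y : CliffordAlgebra Q) : wedge x (c • y) = c • wedge x y := by
  simp only [wedge, map_smul, mul_smul_comm]

theorem wedge_sum {J : Type*} (s : Finset J) (x : CliffordAlgebra Q) (f : J → CliffordAlgebra Q) :
    wedge x (∑ j ∈ s, f j) = ∑ j ∈ s, wedge x (f j) := by
  simp only [wedge, map_sum, Finset.mul_sum]

theorem contractLeft_wedge (d : Module.Dual ℝ V) (b : V) (Y : CliffordAlgebra Q) :
    contractLeft d (wedge (ι Q b) Y) = d b • Y - wedge (ι Q b) (contractLeft d Y) := by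
  have h : ∀ X : CliffordAlgebra Q,
      equivExterior Q (contractLeft d X) = contractLeft d (equivExterior Q X) :=
    fun X ↦ changeForm_contractLeft changeForm.associated_neg_proof d X
  apply (equivExterior Q).injective
  rw [h, map_sub, equivExterior_wedge, equivExterior_wedge, equivExterior_ι, h, map_smul]
  exact contractLeft_ι_mul d b _

theorem contractLeft_wedgeList (d : Module.Dual ℝ V) {n : ℕ} (b : Fin (n + 1) → V) :
    contractLeft d (wedgeList Q (List.ofFn b)) =
      ∑ j : Fin (n + 1), ((-1 : ℝ) ^ (j : ℕ) * d (b j)) •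
        wedgeList Q (List.ofFn fun i ↦ b (j.succAbove i)) := by
  induction n with
  | zero =>
    rw [List.ofFn_succ, wedgeList_cons, contractLeft_wedge, List.ofFn_zero, wedgeList_nil,
      contractLeft_one]
    simp [wedge, wedgeList_nil]
  | succ n ih =>
    rw [List.ofFn_succ, wedgeList_cons, contractLeft_wedge, ih, wedge_sum, sub_eq_add_neg,
      ← Finset.sum_neg_distrib]
    conv_rhs => rw [Fin.sum_univ_succ]
    congr 1
    · simp
    · refine Finset.sum_congr rfl fun j _ ↦ ?_
      rw [wedge_smul, List.ofFn_succ, wedgeList_cons, ← neg_smul]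
      simp [pow_succ]

theorem wedge_swap (a : V) (l : List V) (Z : CliffordAlgebra Q) :
    wedge (wedge (ι Q a) (wedgeList Q l)) Z
      = (-1 : ℝ) ^ l.length • wedge (wedgeList Q l) (wedge (ι Q a) Z) := by
  induction l with
  | nil =>
    rw [wedgeList_nil, wedge_assoc, one_wedge, one_wedge]; simp
  | cons b l ih =>
    have hab : ∀ Y : CliffordAlgebra Q, wedge (ι Q a) (wedge (ι Q b) Y) =
        (-1 : ℝ) • wedge (ι Q b) (wedge (ι Q a) Y) := by
      intro Y
      apply (equivExterior Q).injective
      simp only [map_smul, equivExterior_wedge, equivExterior_ι, ← mul_assoc]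
      rw [eq_neg_of_add_eq_zero_left (ExteriorAlgebra.ι_add_mul_swap (R := ℝ) a b)]
      simp
    rw [wedgeList_cons, wedge_assoc, wedge_assoc, hab, ← wedge_assoc (ι Q a), ih, wedge_smul,
      wedge_assoc, smul_smul, List.length_cons, pow_succ, mul_comm]

end

variable {B : LinearMap.BilinForm ℝ V}

theorem ι_mul_eq (hB : ∀ a b, B a b = B b a) (a : V) (X : CliffordAlgebra B.toQuadraticMap) :
    ι B.toQuadraticMap a * X = wedge (ι B.toQuadraticMap a) X + contractLeft (B a) X := by
  apply (equivExterior B.toQuadraticMap).injective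
  rw [map_add, equivExterior_wedge, equivExterior_ι]
  have h3 := changeForm_ι_mul (changeForm.associated_neg_proof (Q := B.toQuadraticMap)) a X
  have h4 : QuadraticMap.associated (R := ℝ) (-B.toQuadraticMap) a = -(B a) := by
    ext b
    simp [QuadraticMap.associated_apply, hB b a]
    ring
  have h5 := changeForm_contractLeft
    (changeForm.associated_neg_proof (Q := B.toQuadraticMap)) (B a) X
  have h6 : ∀ Y : CliffordAlgebra (0 : QuadraticForm ℝ V), contractLeft
      (QuadraticMap.associated (R := ℝ) (-B.toQuadraticMap) a) Y = - contractLeft (B a) Y := by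
    intro Y
    rw [h4, map_neg, LinearMap.neg_apply]
  rw [h6, sub_neg_eq_add, ← h5] at h3
  exact h3

theorem two_smul_contractLeft (hB : ∀ a b, B a b = B b a) (a : V)
    (X : CliffordAlgebra B.toQuadraticMap) :
    (2 : ℝ) • contractLeft (B a) X
      = ι B.toQuadraticMap a * X - involute X * ι B.toQuadraticMap a := by
  induction X using CliffordAlgebra.left_induction with
  | algebraMap r =>
    rw [contractLeft_algebraMap, AlgHom.commutes, Algebra.commutes]; simp
  | add x y hx hy => rw [map_add, smul_add, hx, hy, map_add]; noncomm_ring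
  | ι_mul X v h =>
    have hav : ι B.toQuadraticMap a * ι B.toQuadraticMap v
        = algebraMap ℝ _ (2 * B a v) - ι B.toQuadraticMap v * ι B.toQuadraticMap a := by
      have := ι_mul_ι_add_swap (Q := B.toQuadraticMap) a v
      rw [eq_sub_iff_add_eq, this]
      congr 1
      simp [QuadraticMap.polar, hB v a]; ring
    rw [contractLeft_ι_mul, smul_sub, ← mul_smul_comm, h, map_mul, involute_ι, ← mul_assoc, hav,
      sub_mul, ← Algebra.smul_def, mul_sub, mul_smul]
    noncomm_ring

theorem two_smul_wedge (hB : ∀ a b, B a b = B b a) (a : V)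
    (X : CliffordAlgebra B.toQuadraticMap) :
    (2 : ℝ) • wedge (ι B.toQuadraticMap a) X
      = ι B.toQuadraticMap a * X + involute X * ι B.toQuadraticMap a := by
  have h := two_smul_contractLeft hB a X
  have h' := ι_mul_eq hB a X
  rw [← sub_eq_iff_eq_add] at h'
  rw [← h', smul_sub, h, two_smul]
  abel

theorem contractLeft_reverse (hB : ∀ a b, B a b = B b a) (a : V)
    (X : CliffordAlgebra B.toQuadraticMap) :
    contractLeft (B a) (reverse X) = reverse (involute (contractLeft (B a) X)) := by
  apply smul_right_injective _ (two_ne_zero : (2 : ℝ) ≠ 0)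
  simp only
  rw [two_smul_contractLeft hB, ← map_smul, ← map_smul, two_smul_contractLeft hB]
  simp only [map_sub, map_mul, reverse.map_mul, involute_ι, involute_involute, reverse_ι,
    map_neg, reverse_involute]
  noncomm_ring

theorem involute_wedgeList (hB : ∀ a b, B a b = B b a) (l : List V) :
    involute (wedgeList B.toQuadraticMap l)
      = (-1 : ℝ) ^ l.length • wedgeList B.toQuadraticMap l := by
  induction l with
  | nil => simp [wedgeList_nil]
  | cons a l ih =>
    apply smul_right_injective _ (two_ne_zero : (2 : ℝ) ≠ 0)
    simp only
    rw [wedgeList_cons, ← map_smul, smul_comm, two_smul_wedge hB]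
    simp only [map_add, map_mul, involute_ι, ih, List.length_cons, pow_succ,
      map_smul, mul_smul_comm, smul_mul_assoc, neg_mul, mul_neg]
    module

/-- The defining property of the Hodge star on decomposable elements, for `⋆A = Ã τ`:
`(a₁ ∧ ⋯ ∧ aₚ) ∧ ⋆(b₁ ∧ ⋯ ∧ bₚ) = det (aᵢ · bⱼ) τ`. -/
theorem wedge_reverse_mul (hB : ∀ a b, B a b = B b a) {τ : CliffordAlgebra B.toQuadraticMap}
    (hτ : involute τ = τ)
    (hτ' : ∀ a, ι B.toQuadraticMap a * τ = - (τ * ι B.toQuadraticMap a)) {p : ℕ}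
    (a b : Fin p → V) :
    wedge (wedgeList B.toQuadraticMap (List.ofFn a))
      (reverse (wedgeList B.toQuadraticMap (List.ofFn b)) * τ)
      = (Matrix.of fun i j ↦ B (a i) (b j)).det • τ := by
  have key : ∀ (a : V) (Y : CliffordAlgebra B.toQuadraticMap),
      wedge (ι B.toQuadraticMap a) (Y * τ) = contractLeft (B a) Y * τ := by
    intro a Y
    apply smul_right_injective _ (two_ne_zero : (2 : ℝ) ≠ 0)
    simp only
    rw [two_smul_wedge hB, ← smul_mul_assoc, two_smul_contractLeft hB, map_mul, hτ, mul_assoc _ τ,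
      ← neg_neg (τ * _), ← hτ', sub_mul]
    noncomm_ring
  induction p with
  | zero => simp [wedgeList_nil, one_wedge]
  | succ p ih =>
    rw [List.ofFn_succ, wedgeList_cons, wedge_swap, key, contractLeft_reverse hB,
      contractLeft_wedgeList]
    simp only [map_sum, map_smul, involute_wedgeList hB, Finset.sum_mul, smul_mul_assoc,
      wedge_sum, wedge_smul, ih, List.length_ofFn, Matrix.det_succ_row_zero]
    simp only [Finset.smul_sum, smul_smul, Finset.sum_smul]
    refine Finset.sum_congr rfl fun j _ ↦ ?_
    congr 1
    have : ((-1 : ℝ) ^ p) * (-1) ^ p = 1 := by rw [← mul_pow]; simp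
    have e : (Matrix.of fun i j ↦ (B (a i)) (b j)).submatrix Fin.succ j.succAbove
      = Matrix.of fun i k ↦ B (a i.succ) (b (j.succAbove k)) := rfl
    rw [e, Matrix.of_apply]
    linear_combination ((-1 : ℝ) ^ (j : ℕ) * B (a 0) (b j) *
      (Matrix.of fun i k ↦ B (a i.succ) (b (j.succAbove k))).det) * this

end CliffordFibre

namespace LorentzMetric

section

variable {M : Type*} [TopologicalSpace M] [ChartedSpace R4 M] [IsManifold (𝓡 4) ∞ M]

/-- The metric on `T_x M` as a bilinear form. -/
def bilin (g : LorentzMetric M) (x : M) : LinearMap.BilinForm ℝ (TangentSpace (𝓡 4) x) :=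
  LinearMap.mk₂ ℝ (fun v w ↦ g.toFun x v w) (by simp) (by simp) (by simp) (by simp)

theorem bilin_nondegenerate (g : LorentzMetric M) (x : M) : (g.bilin x).Nondegenerate := by
  obtain ⟨b, hb⟩ := g.signature x
  have key : ∀ v, (∀ w, g.toFun x v w = 0) → v = 0 := by
    intro v hv
    refine b.ext_elem fun j ↦ ?_
    have h := hv (b j)
    rw [← b.sum_repr v] at h
    simp only [map_sum, map_smul, _root_.sum_apply, _root_.smul_apply,
      hb, minkowski, smul_eq_mul, mul_ite, mul_zero, Finset.sum_ite_eq', Finset.mem_univ,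
      if_true] at h
    by_cases hj : j = 0 <;> simpa [hj] using h
  exact ⟨fun v hv ↦ key v hv, fun v hv ↦ key v fun w ↦ (g.symm x v w).trans (hv w)⟩

/-- The metric induced on `T*_x M`. -/
def cometric (g : LorentzMetric M) (x : M) :
    LinearMap.BilinForm ℝ (Module.Dual ℝ (TangentSpace (𝓡 4) x)) :=
  (g.bilin x).compl₁₂
    ((g.bilin x).toDual (g.bilin_nondegenerate x)).symm.toLinearMap
    ((g.bilin x).toDual (g.bilin_nondegenerate x)).symm.toLinearMap

theorem cometric_symm (g : LorentzMetric M) (x : M)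
    (a b : Module.Dual ℝ (TangentSpace (𝓡 4) x)) : g.cometric x a b = g.cometric x b a :=
  g.symm x _ _

/-- The fibre at `x` of the Clifford bundle of differential forms. -/
abbrev Cl (g : LorentzMetric M) (x : M) : Type :=
  CliffordAlgebra (g.cometric x).toQuadraticMap

/-- The embedding of covectors into the Clifford algebra. -/
abbrev oneForm (g : LorentzMetric M) (x : M) (a : Module.Dual ℝ (TangentSpace (𝓡 4) x)) :
    g.Cl x :=
  CliffordAlgebra.ι (g.cometric x).toQuadraticMap a

/-- The left contraction `a ⌟ A` of a multiform with a covector, taken with the metric. -/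
def contract (g : LorentzMetric M) {x : M} (a : Module.Dual ℝ (TangentSpace (𝓡 4) x))
    (A : g.Cl x) : g.Cl x :=
  CliffordAlgebra.contractLeft (g.cometric x a) A

/-- `∇ g = 0`. -/
def IsCompatible (g : LorentzMetric M)
    (cov : CovariantDerivative (𝓡 4) R4 (TangentSpace (𝓡 4) : M → Type _)) : Prop :=
  ∀ (x : M) (v : TangentSpace (𝓡 4) x) (Y Z : ∀ y : M, TangentSpace (𝓡 4) y),
    MDifferentiableAt (𝓡 4) ((𝓡 4).prod 𝓘(ℝ, R4))
      (fun y ↦ (⟨y, Y y⟩ : TangentBundle (𝓡 4) M)) x →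
    MDifferentiableAt (𝓡 4) ((𝓡 4).prod 𝓘(ℝ, R4))
      (fun y ↦ (⟨y, Z y⟩ : TangentBundle (𝓡 4) M)) x →
    mvfderiv (𝓡 4) (fun y ↦ g.toFun y (Y y) (Z y)) x v =
      g.toFun x (cov Y x v) (Z x) + g.toFun x (Y x) (cov Z x v)

end

end LorentzMetric

section Frame

variable {M : Type*} [TopologicalSpace M] [ChartedSpace R4 M] [IsManifold (𝓡 4) ∞ M]

/-- The curvature `R(X, Y) Z = ∇_X ∇_Y Z - ∇_Y ∇_X Z - ∇_{[X, Y]} Z`. -/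
def curvature (cov : CovariantDerivative (𝓡 4) R4 (TangentSpace (𝓡 4) : M → Type _))
    (X Y Z : ∀ x : M, TangentSpace (𝓡 4) x) (x : M) : TangentSpace (𝓡 4) x :=
  cov (fun y ↦ cov Z y (Y y)) x (X x) - cov (fun y ↦ cov Z y (X y)) x (Y x)
    - cov Z x (VectorField.mlieBracket (𝓡 4) X Y x)

variable (g : LorentzMetric M)
  (cov : CovariantDerivative (𝓡 4) R4 (TangentSpace (𝓡 4) : M → Type _))
  {U : Set M} {e : Fin 4 → ∀ x : M, TangentSpace (𝓡 4) x}
  (he : IsLocalFrameOn (𝓡 4) R4 ∞ e U)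

/-- The dual frame `θ^μ`. -/
def coframe (μ : Fin 4) (x : M) : Module.Dual ℝ (TangentSpace (𝓡 4) x) := he.coeff μ x

/-- `g_{αβ} = g(e_α, e_β)`. -/
def gLower (e : Fin 4 → ∀ x : M, TangentSpace (𝓡 4) x) (α β : Fin 4) (x : M) : ℝ :=
  g.toFun x (e α x) (e β x)

/-- `g^{αβ} = g(θ^α, θ^β)`. -/
def gUpper (α β : Fin 4) (x : M) : ℝ :=
  g.cometric x (coframe he α x) (coframe he β x)

/-- `θ_σ = g_{σν} θ^ν`. -/
def coframeLower (σ : Fin 4) (x : M) : Module.Dual ℝ (TangentSpace (𝓡 4) x) :=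
  ∑ ν, gLower g e σ ν x • coframe he ν x

/-- The connection coefficients: `∇_{e_α} e_β = γ^μ_{αβ} e_μ`. -/
def connCoeff (μ α β : Fin 4) (x : M) : ℝ :=
  coframe he μ x (cov (e β) x (e α x))

/-- The components `R_ρ{}^μ{}_{αβ}` of the curvature: `R(e_α, e_β) e_ρ = R_ρ{}^μ{}_{αβ} e_μ`. -/
def riemann (ρ μ α β : Fin 4) (x : M) : ℝ :=
  coframe he μ x (curvature cov (e α) (e β) (e ρ) x)

/-- `R^ρ{}_κ{}^σ{}_λ`, obtained from `R_α{}^ν{}_{βλ}` by lowering the second index and raising the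
first and third ones. -/
def riemannUpDownUpDown (ρ κ σ l : Fin 4) (x : M) : ℝ :=
  ∑ α, ∑ β, ∑ ν, gUpper g he ρ α x * gUpper g he σ β x * gLower g e κ ν x *
    riemann cov he α ν β l x

/-- The components of the Ricci tensor `R^μ_β = g^{ρα} R_ρ{}^μ{}_{αβ}`. -/
def ricciTensor (μ β : Fin 4) (x : M) : ℝ :=
  ∑ ρ, ∑ α, gUpper g he ρ α x * riemann cov he ρ μ α β x

/-- The scalar curvature `R = R^μ_μ`. -/
def scalarCurvature (x : M) : ℝ := ∑ μ, ricciTensor g cov he μ μ x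

/-- The Ricci `1`-forms `ℛ^μ = R^μ_β θ^β`. -/
def ricciForm (μ : Fin 4) (x : M) : g.Cl x :=
  ∑ β, ricciTensor g cov he μ β x • g.oneForm x (coframe he β x)

/-- The `2`-form `θ^α ∧ θ^β`. -/
def coframeWedge (α β : Fin 4) (x : M) : g.Cl x :=
  wedge (g.oneForm x (coframe he α x)) (g.oneForm x (coframe he β x))

/-- The curvature `2`-forms `ℛ_ρ^μ = ½ R_ρ{}^μ{}_{αβ} θ^α ∧ θ^β`. -/
def curvatureForm (ρ μ : Fin 4) (x : M) : g.Cl x :=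
  (1 / 2 : ℝ) • ∑ α, ∑ β, riemann cov he ρ μ α β x • coframeWedge g he α β x

/-- The curvature `2`-forms `ℛ^{ρσ} = g^{ρμ} ℛ_μ^σ`. -/
def curvatureFormUpper (ρ σ : Fin 4) (x : M) : g.Cl x :=
  ∑ μ, gUpper g he ρ μ x • curvatureForm g cov he μ σ x

/-! ### Components and covariant derivatives of multiform fields -/

/-- The component `ω_{α₁…αᵣ} = ω(e_{α₁}, …, e_{αᵣ})` of the part of degree `r` of a multiform field,
namely the scalar part of `e_{αᵣ} ⌟ (⋯ ⌟ (e_{α₁} ⌟ ω))`, where `l = [α₁, …, αᵣ]`. -/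
def component (e : Fin 4 → ∀ x : M, TangentSpace (𝓡 4) x) (A : ∀ x, g.Cl x) (l : List (Fin 4))
    (x : M) : ℝ :=
  scalarPart (l.foldl
    (fun B α ↦ CliffordAlgebra.contractLeft (Module.Dual.eval ℝ _ (e α x)) B) (A x))

/-- `A` is a smooth multiform field on `U`: its components in the smooth frame `e` are smooth. -/
def IsSmoothMultiform (e : Fin 4 → ∀ x : M, TangentSpace (𝓡 4) x) (U : Set M)
    (A : ∀ x, g.Cl x) : Prop :=
  ∀ l, ContMDiffOn (𝓡 4) 𝓘(ℝ, ℝ) ∞ (component g e A l) U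

/-- The components of the covariant derivative of a covariant tensor field with components `T`:
`∇_β T_{α₁…αᵣ} = e_β(T_{α₁…αᵣ}) - γ^σ_{βα₁} T_{σα₂…αᵣ} - ⋯ - γ^σ_{βαᵣ} T_{α₁…αᵣ₋₁σ}`. -/
def covComponent (T : List (Fin 4) → M → ℝ) (β : Fin 4) (l : List (Fin 4)) (x : M) : ℝ :=
  mvfderiv (𝓡 4) (T l) x (e β x)
    - ∑ i : Fin l.length, ∑ σ, connCoeff cov he σ β (l.get i) x * T (l.set i σ) x

/-- The components of `∇T`, as a tensor field with one more index: `(∇T)_{βα₁…αᵣ} = ∇_β T_{α₁…αᵣ}`.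
The value at the empty list of indices is irrelevant. -/
def covTensor (T : List (Fin 4) → M → ℝ) : List (Fin 4) → M → ℝ
  | [] => 0
  | β :: l => covComponent cov he T β l

/-- The components `∇_α ∇_β T_{α₁…αᵣ}` of the second covariant derivative. -/
def secondCovComponent (T : List (Fin 4) → M → ℝ) (α β : Fin 4) (l : List (Fin 4)) (x : M) : ℝ :=
  covComponent cov he (covTensor cov he T) α (β :: l) x

/-- The covariant derivative of a multiform field,
`∇_{e_β} ω = ∑_r 1/r! (∇_β ω_{α₁…αᵣ}) θ^{α₁} ∧ ⋯ ∧ θ^{αᵣ}`. -/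
def covMultiform (β : Fin 4) (A : ∀ x, g.Cl x) (x : M) : g.Cl x :=
  ∑ r ∈ Finset.range 5, (r.factorial : ℝ)⁻¹ • ∑ a : Fin r → Fin 4,
    covComponent cov he (component g e A) β (List.ofFn a) x •
      wedgeList (g.cometric x).toQuadraticMap ((List.ofFn a).map fun α ↦ coframe he α x)

/-- The Dirac operator `∂ = θ^α ∇_{e_α}` (Clifford product). -/
def dirac (A : ∀ x, g.Cl x) (x : M) : g.Cl x :=
  ∑ α, g.oneForm x (coframe he α x) * covMultiform g cov he α A x

/-- The Hodge Laplacian `∂²`. -/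
def hodgeLaplacian (A : ∀ x, g.Cl x) : ∀ x, g.Cl x := dirac g cov he (dirac g cov he A)

/-- The Ricci operator `∂ ∧ ∂ = θ^α ∧ θ^β (∇_{e_α} ∇_{e_β} - γ^ρ_{αβ} ∇_{e_ρ})`; the `2`-form
`θ^α ∧ θ^β` acts by the Clifford product. -/
def ricciOperator (A : ∀ x, g.Cl x) (x : M) : g.Cl x :=
  ∑ α, ∑ β, coframeWedge g he α β x *
    (covMultiform g cov he α (covMultiform g cov he β A) x
      - ∑ ρ, connCoeff cov he ρ α β x • covMultiform g cov he ρ A x)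

/-- The operator `ℛ^{ρσ} ∧ θ_ρ ⌟ θ_σ ⌟`. -/
def curvatureOperator (x : M) (A : g.Cl x) : g.Cl x :=
  ∑ ρ, ∑ σ, wedge (curvatureFormUpper g cov he ρ σ x)
    (g.contract (coframeLower g he ρ x) (g.contract (coframeLower g he σ x) A))

end Frame

/-! ### Hodge star and Einstein operator -/

/-- The volume form `τ` of an orientation of a Lorentzian manifold: a smooth `4`-form which at each
point equals `θ⁰θ¹θ²θ³` for an orthonormal basis of the cotangent space. -/
structure LorentzMetric.VolumeForm {M : Type*} [TopologicalSpace M] [ChartedSpace R4 M]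
    [IsManifold (𝓡 4) ∞ M] (g : LorentzMetric M) where
  toFun (x : M) : g.Cl x
  normalized (x : M) : ∃ b : Module.Basis (Fin 4) ℝ (Module.Dual ℝ (TangentSpace (𝓡 4) x)),
    (∀ i j, g.cometric x (b i) (b j) = minkowski i j) ∧
      toFun x = g.oneForm x (b 0) * g.oneForm x (b 1) * g.oneForm x (b 2) * g.oneForm x (b 3)
  smooth (U : Set M) (e : Fin 4 → ∀ x : M, TangentSpace (𝓡 4) x) :
    IsOpen U → IsLocalFrameOn (𝓡 4) R4 ∞ e U → IsSmoothMultiform g e U toFun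

section Einstein

variable {M : Type*} [TopologicalSpace M] [ChartedSpace R4 M] [IsManifold (𝓡 4) ∞ M]
  (g : LorentzMetric M)
  (cov : CovariantDerivative (𝓡 4) R4 (TangentSpace (𝓡 4) : M → Type _))
  {U : Set M} {e : Fin 4 → ∀ x : M, TangentSpace (𝓡 4) x}
  (he : IsLocalFrameOn (𝓡 4) R4 ∞ e U)

/-- The Hodge star `⋆A = Ã τ`, with `Ã` the reverse of `A`. -/
def hodgeStar (τ : g.VolumeForm) (x : M) (A : g.Cl x) : g.Cl x :=
  CliffordAlgebra.reverse A * τ.toFun x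

/-- The defining property of the Hodge star:
`(a₁ ∧ ⋯ ∧ aₚ) ∧ ⋆(b₁ ∧ ⋯ ∧ bₚ) = (a₁ ∧ ⋯ ∧ aₚ) · (b₁ ∧ ⋯ ∧ bₚ) τ`, where the scalar product of
decomposable forms is `det (aᵢ · bⱼ)`. -/
theorem wedge_hodgeStar (τ : g.VolumeForm) (x : M) {p : ℕ}
    (a b : Fin p → Module.Dual ℝ (TangentSpace (𝓡 4) x)) :
    wedge (wedgeList (g.cometric x).toQuadraticMap (List.ofFn a))
        (hodgeStar g τ x (wedgeList (g.cometric x).toQuadraticMap (List.ofFn b)))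
      = (Matrix.of fun i j ↦ g.cometric x (a i) (b j)).det • τ.toFun x := by
  obtain ⟨c, hc, hτ⟩ := τ.normalized x
  refine wedge_reverse_mul (g.cometric_symm x) ?_ ?_ a b
  · rw [hτ]
    simp only [map_mul, CliffordAlgebra.involute_ι]
    noncomm_ring
  · intro v
    have anti : ∀ i j, i ≠ j → g.oneForm x (c i) * g.oneForm x (c j)
        = -(g.oneForm x (c j) * g.oneForm x (c i)) := by
      intro i j hij
      refine CliffordAlgebra.ι_mul_ι_comm_of_isOrtho ?_
      rw [QuadraticMap.isOrtho_def]
      have h1 := hc i j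
      have h2 := hc j i
      simp only [minkowski, if_neg hij, if_neg hij.symm] at h1 h2
      simp [h1, h2]
    have anti' : ∀ i j, i ≠ j → ∀ z, g.oneForm x (c i) * (g.oneForm x (c j) * z)
        = -(g.oneForm x (c j) * (g.oneForm x (c i) * z)) := by
      intro i j hij z
      rw [← mul_assoc, anti i j hij, neg_mul, mul_assoc]
    have key : LinearMap.mulRight ℝ (τ.toFun x) ∘ₗ CliffordAlgebra.ι (g.cometric x).toQuadraticMap
        = -(LinearMap.mulLeft ℝ (τ.toFun x) ∘ₗ
          CliffordAlgebra.ι (g.cometric x).toQuadraticMap) := by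
      refine c.ext fun i ↦ ?_
      have a30 := anti 3 0 (by decide)
      have a31 := anti 3 1 (by decide)
      have a32 := anti 3 2 (by decide)
      have b10 := anti' 1 0 (by decide)
      have b20 := anti' 2 0 (by decide)
      have b30 := anti' 3 0 (by decide)
      have b21 := anti' 2 1 (by decide)
      have b31 := anti' 3 1 (by decide)
      have b32 := anti' 3 2 (by decide)
      simp only [LinearMap.coe_comp, Function.comp_apply, LinearMap.mulRight_apply,
        LinearMap.neg_apply, LinearMap.mulLeft_apply, hτ]
      fin_cases i <;>
        simp only [Fin.zero_eta, Fin.mk_one, Fin.reduceFinMk, mul_assoc, a30, a31,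
          a32, b10, b20, b30, b21, b31, b32, mul_neg, neg_neg]
    exact LinearMap.congr_fun key v

/-- The Einstein operator `½ ⋆⁻¹ (ℛ^{ρσ} ∧ θ_ρ ⌟ θ_σ ⌟) ⋆`. -/
def einsteinOperator (τ : g.VolumeForm) (x : M) (A : g.Cl x) : g.Cl x :=
  (1 / 2 : ℝ) • Function.invFun (hodgeStar g τ x)
    (curvatureOperator g cov he x (hodgeStar g τ x A))

end Einstein

end

/-! In a frame, every operator in the statement is built from exterior multiplications θ^α∧ and
contractions e_α⌟, which satisfy the canonical anticommutation relations
(`contractLeft_mul_extMul`). Clifford multiplication by θ^α is θ^α∧ + θ^α⌟. A multiform is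
determined by its components (`eq_of_fibreComponent_eq`), and the covariant derivative splits as ∇_β
= ∂_β - Γ_β (`covMultiform_eq`): ∂_β differentiates components and commutes with every θ^ρ∧ and
e_α⌟, while Γ_β = γ^σ_{βρ} θ^ρ∧ e_σ⌟ is algebraic.

Ricci operator. Since θ^α∧θ^β is antisymmetric, only commutators of the ∇'s matter. With torsion
zero, the commutator corrected by the γ terms is the algebraic operator -R_ρ^μ_{αβ} θ^ρ∧ e_μ⌟
(`covMultiform_commutator`). Apply the Clifford action of ½ θ^α∧θ^β and move contractions to the
right. The first Bianchi identity kills the terms with three exterior factors or three contractions;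
symmetry of the Ricci tensor kills the terms with two bare contractions. What survives is a Ricci
term and a term with two exterior factors and two contractions (`curvatureSum_ricci_identity`). The
symmetries of the curvature come from the Jacobi identity (Bianchi) and from applying [X, Y] = XY -
YX to the function g(e_ρ, e_μ).

Square of the Dirac operator. The Leibniz rule for θ^β and θ^αθ^β = θ^α∧θ^β + g^{αβ} give ∂² = ∂∧∂
plus the trace of the second covariant derivative (`hodgeLaplacian_eq`). The formula follows by
reading off components; a further use of Bianchi turns R^{ρσ}_{λκ} into R^ρ_κ^σ_λ
(`sum_riemannUpDownUpDown`).

Einstein operator. In dimension 4, τ is even and anticommutes with covectors, so right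
multiplication by τ exchanges θ∧ and θ⌟ (`extMul_mul_volume`, `contractLeft_mul_volume`).
Conjugation by the star therefore gives two contractions acting on θ^ρ∧θ^μ∧θ^κ, and anticommuting
them down to 1 leaves only the Ricci form and the scalar curvature
(`curvatureSum_einstein_identity`). -/

set_option linter.unusedSectionVars false

noncomputable section

/-! ### Multilinear algebra of a fibre: homogeneity, components, expansion -/

section Fibre

open CliffordAlgebra

variable {V : Type*} [AddCommGroup V] [Module ℝ V] {Q : QuadraticForm ℝ V}

/-- Exterior multiplication on the left, as a bilinear map. -/
def wedgeBilin (Q : QuadraticForm ℝ V) :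
    CliffordAlgebra Q →ₗ[ℝ] CliffordAlgebra Q →ₗ[ℝ] CliffordAlgebra Q :=
  LinearMap.mk₂ ℝ wedge (by simp [wedge, add_mul]) (by simp [wedge]) (by simp [wedge, mul_add])
    (by simp [wedge])

theorem wedgeBilin_apply (A B : CliffordAlgebra Q) : wedgeBilin Q A B = wedge A B := rfl

/-- Exterior multiplication by a vector. -/
def extMul (Q : QuadraticForm ℝ V) : V →ₗ[ℝ] Module.End ℝ (CliffordAlgebra Q) :=
  wedgeBilin Q ∘ₗ ι Q

theorem extMul_apply (v : V) (A : CliffordAlgebra Q) : extMul Q v A = wedge (ι Q v) A := rfl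

theorem extMul_mul_extMul (u v : V) : extMul Q u * extMul Q v = -(extMul Q v * extMul Q u) := by
  refine LinearMap.ext fun X ↦ ?_
  apply (equivExterior Q).injective
  simp only [Module.End.mul_apply, LinearMap.neg_apply, extMul_apply, map_neg, equivExterior_wedge,
    equivExterior_ι, ← mul_assoc]
  rw [eq_neg_of_add_eq_zero_left (ExteriorAlgebra.ι_add_mul_swap (R := ℝ) u v), neg_mul]

theorem contractLeft_mul_contractLeft (c d : Module.Dual ℝ V) :
    (contractLeft c * contractLeft d : Module.End ℝ (CliffordAlgebra Q)) =
      -(contractLeft d * contractLeft c : Module.End ℝ (CliffordAlgebra Q)) :=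
  LinearMap.ext fun X ↦ contractLeft_comm (d := c) (d' := d) X

/-- The canonical anticommutation relation. With the anticommutativity of exterior multiplications
and of contractions, it is all that the operator identities for the curvature use about the Clifford
algebra. -/
theorem contractLeft_mul_extMul (d : Module.Dual ℝ V) (v : V) :
    (contractLeft d * extMul Q v : Module.End ℝ (CliffordAlgebra Q)) =
      d v • (1 : Module.End ℝ (CliffordAlgebra Q)) - extMul Q v * contractLeft d :=
  LinearMap.ext fun X ↦ contractLeft_wedge d v X

theorem contractLeft_extMul (d : Module.Dual ℝ V) (v : V) (X : CliffordAlgebra Q) :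
    contractLeft d (extMul Q v X) = d v • X - extMul Q v (contractLeft d X) :=
  contractLeft_wedge d v X

theorem wedgeList_ofFn {r : ℕ} (v : Fin r → V) :
    wedgeList Q (List.ofFn v) = (equivExterior Q).symm (ExteriorAlgebra.ιMulti ℝ r v) := by
  rw [wedgeList, ExteriorAlgebra.ιMulti_apply, List.map_ofFn]
  rfl

theorem isHomogeneousOfDegree_wedgeList (l : List V) :
    IsHomogeneousOfDegree l.length (wedgeList Q l) := by
  obtain ⟨r, v, rfl⟩ : ∃ r, ∃ v : Fin r → V, l = List.ofFn v := ⟨_, l.get, by simp⟩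
  rw [wedgeList_ofFn, IsHomogeneousOfDegree, LinearEquiv.apply_symm_apply, List.length_ofFn]
  exact ExteriorAlgebra.ιMulti_range ℝ r ⟨v, rfl⟩

/-- The degree `r` part is spanned by decomposable elements, so a property stable under linear
combinations need only be checked on `r`-fold exterior products. -/
theorem IsHomogeneousOfDegree.induction {r : ℕ} {p : CliffordAlgebra Q → Prop} (h0 : p 0)
    (hadd : ∀ A B, p A → p B → p (A + B)) (hsmul : ∀ (c : ℝ) A, p A → p (c • A))
    (h : ∀ v : Fin r → V, p (wedgeList Q (List.ofFn v))) {A : CliffordAlgebra Q}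
    (hA : IsHomogeneousOfDegree r A) : p A := by
  rw [IsHomogeneousOfDegree, ← ExteriorAlgebra.ιMulti_span_fixedDegree] at hA
  suffices ∀ Y, Y ∈ Submodule.span ℝ (Set.range (ExteriorAlgebra.ιMulti ℝ (M := V) r)) →
      p ((equivExterior Q).symm Y) by
    have h := this _ hA
    rwa [LinearEquiv.symm_apply_apply] at h
  intro Y hY
  induction hY using Submodule.span_induction with
  | mem x hx => obtain ⟨v, rfl⟩ := hx; rw [← wedgeList_ofFn]; exact h v
  | zero => simpa using h0
  | add x y _ _ hx hy => rw [map_add]; exact hadd _ _ hx hy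
  | smul c x _ hx => rw [map_smul]; exact hsmul _ _ hx

theorem IsHomogeneousOfDegree.zero (r : ℕ) : IsHomogeneousOfDegree r (0 : CliffordAlgebra Q) := by
  simp [IsHomogeneousOfDegree]

theorem IsHomogeneousOfDegree.add {r : ℕ} {A B : CliffordAlgebra Q}
    (hA : IsHomogeneousOfDegree r A) (hB : IsHomogeneousOfDegree r B) :
    IsHomogeneousOfDegree r (A + B) := by
  rw [IsHomogeneousOfDegree, map_add]; exact add_mem hA hB

theorem IsHomogeneousOfDegree.smul {r : ℕ} {A : CliffordAlgebra Q}
    (hA : IsHomogeneousOfDegree r A) (c : ℝ) : IsHomogeneousOfDegree r (c • A) := by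
  rw [IsHomogeneousOfDegree, map_smul]; exact Submodule.smul_mem _ _ hA

theorem IsHomogeneousOfDegree.sum {r : ℕ} {J : Type*} {s : Finset J} {A : J → CliffordAlgebra Q}
    (hA : ∀ j ∈ s, IsHomogeneousOfDegree r (A j)) : IsHomogeneousOfDegree r (∑ j ∈ s, A j) := by
  rw [IsHomogeneousOfDegree, map_sum]; exact sum_mem hA

theorem contractLeft_of_isHomogeneousOfDegree_zero {A : CliffordAlgebra Q}
    (hA : IsHomogeneousOfDegree 0 A) (d : Module.Dual ℝ V) : contractLeft d A = 0 := by
  refine hA.induction (p := fun A ↦ CliffordAlgebra.contractLeft d A = 0) ?_ (fun A B hA hB ↦ ?_)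
    (fun c A hA ↦ ?_) fun v ↦ ?_
  · simp
  · simp [hA, hB]
  · simp [hA]
  · rw [List.ofFn_zero, wedgeList_nil, contractLeft_one]

theorem IsHomogeneousOfDegree.contractLeft {r : ℕ} {A : CliffordAlgebra Q}
    (hA : IsHomogeneousOfDegree (r + 1) A) (d : Module.Dual ℝ V) :
    IsHomogeneousOfDegree r (CliffordAlgebra.contractLeft d A) := by
  refine hA.induction (p := fun A ↦ IsHomogeneousOfDegree r (CliffordAlgebra.contractLeft d A)) ?_
    (fun A B hA hB ↦ ?_) (fun c A hA ↦ ?_) fun v ↦ ?_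
  · simpa using .zero r
  · rw [map_add]; exact hA.add hB
  · rw [map_smul]; exact hA.smul c
  · rw [contractLeft_wedgeList]
    refine .sum fun j _ ↦ .smul ?_ _
    simpa using isHomogeneousOfDegree_wedgeList (Q := Q) (List.ofFn fun i ↦ v (j.succAbove i))

theorem scalarPart_add (A B : CliffordAlgebra Q) :
    scalarPart (A + B) = scalarPart A + scalarPart B := by simp [scalarPart]

theorem scalarPart_smul (c : ℝ) (A : CliffordAlgebra Q) :
    scalarPart (c • A) = c * scalarPart A := by simp [scalarPart]

theorem scalarPart_one : scalarPart (1 : CliffordAlgebra Q) = 1 := by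
  simp [scalarPart]

theorem scalarPart_extMul (v : V) (A : CliffordAlgebra Q) : scalarPart (extMul Q v A) = 0 := by
  rw [extMul_apply, scalarPart, equivExterior_wedge, map_mul, equivExterior_ι]
  have : ExteriorAlgebra.algebraMapInv (ExteriorAlgebra.ι ℝ v) = (0 : ℝ) := by
    simp [ExteriorAlgebra.algebraMapInv]
  rw [this, zero_mul]

theorem scalarPart_of_isHomogeneousOfDegree_succ {r : ℕ} {A : CliffordAlgebra Q}
    (hA : IsHomogeneousOfDegree (r + 1) A) : scalarPart A = 0 := by
  refine hA.induction (p := fun A ↦ scalarPart A = 0) ?_ (fun A B hA hB ↦ ?_)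
    (fun c A hA ↦ ?_) fun v ↦ ?_
  · simp [scalarPart]
  · rw [scalarPart_add, hA, hB, add_zero]
  · rw [scalarPart_smul, hA, mul_zero]
  · rw [List.ofFn_succ, wedgeList_cons]; exact scalarPart_extMul _ _

theorem eq_scalarPart_smul_one {A : CliffordAlgebra Q} (hA : IsHomogeneousOfDegree 0 A) :
    A = scalarPart A • (1 : CliffordAlgebra Q) := by
  refine hA.induction (p := fun A ↦ A = scalarPart A • (1 : CliffordAlgebra Q)) ?_
    (fun A B hA hB ↦ ?_) (fun c A hA ↦ ?_) fun v ↦ ?_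
  · simp [scalarPart]
  · rw [scalarPart_add, add_smul, ← hA, ← hB]
  · rw [scalarPart_smul, mul_smul, ← hA]
  · rw [List.ofFn_zero, wedgeList_nil, scalarPart_one, one_smul]

/-! ### Components of a multivector -/

variable {ι' : Type*}

/-- The components of a multivector with respect to a family of covectors. -/
def fibreComponent (d : ι' → Module.Dual ℝ V) (A : CliffordAlgebra Q) (l : List ι') : ℝ :=
  scalarPart (l.foldl (fun B α ↦ contractLeft (d α) B) A)

variable (d : ι' → Module.Dual ℝ V)

theorem fibreComponent_nil (A : CliffordAlgebra Q) : fibreComponent d A [] = scalarPart A := rfl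

theorem fibreComponent_cons (A : CliffordAlgebra Q) (α : ι') (l : List ι') :
    fibreComponent d A (α :: l) = fibreComponent d (contractLeft (d α) A) l := rfl

theorem fibreComponent_add (A B : CliffordAlgebra Q) (l : List ι') :
    fibreComponent d (A + B) l = fibreComponent d A l + fibreComponent d B l := by
  induction l generalizing A B with
  | nil => exact scalarPart_add A B
  | cons α l ih => simp only [fibreComponent_cons, map_add, ih]

theorem fibreComponent_smul (c : ℝ) (A : CliffordAlgebra Q) (l : List ι') :
    fibreComponent d (c • A) l = c * fibreComponent d A l := by
  induction l generalizing A with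
  | nil => exact scalarPart_smul c A
  | cons α l ih => simp only [fibreComponent_cons, map_smul, ih]

/-- The component at a list of indices, as a linear form. -/
def fibreComponentₗ (Q : QuadraticForm ℝ V) (l : List ι') : CliffordAlgebra Q →ₗ[ℝ] ℝ where
  toFun A := fibreComponent d A l
  map_add' A B := fibreComponent_add d A B l
  map_smul' c A := fibreComponent_smul d c A l

theorem fibreComponent_zero (l : List ι') : fibreComponent d (0 : CliffordAlgebra Q) l = 0 :=
  map_zero (fibreComponentₗ d Q l)

theorem fibreComponent_neg (A : CliffordAlgebra Q) (l : List ι') :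
    fibreComponent d (-A) l = -fibreComponent d A l :=
  map_neg (fibreComponentₗ d Q l) A

theorem fibreComponent_sub (A B : CliffordAlgebra Q) (l : List ι') :
    fibreComponent d (A - B) l = fibreComponent d A l - fibreComponent d B l :=
  map_sub (fibreComponentₗ d Q l) A B

theorem fibreComponent_sum {J : Type*} (s : Finset J) (A : J → CliffordAlgebra Q) (l : List ι') :
    fibreComponent d (∑ j ∈ s, A j) l = ∑ j ∈ s, fibreComponent d (A j) l :=
  map_sum (fibreComponentₗ d Q l) A s

theorem fibreComponent_of_isHomogeneousOfDegree {r : ℕ} {A : CliffordAlgebra Q}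
    (hA : IsHomogeneousOfDegree r A) {l : List ι'} (hl : l.length ≠ r) :
    fibreComponent d A l = 0 := by
  induction l generalizing r A with
  | nil =>
    obtain _ | r := r
    · simp at hl
    · exact scalarPart_of_isHomogeneousOfDegree_succ hA
  | cons α l ih =>
    rw [fibreComponent_cons]
    obtain _ | r := r
    · rw [contractLeft_of_isHomogeneousOfDegree_zero hA, fibreComponent_zero]
    · exact ih (hA.contractLeft _) (by simpa using hl)

/-- Reading the first index applies `contractLeft (d (a 0))`, which passes θ^ρ at the cost of a sign
and a Kronecker delta; iterating produces the alternating sum. -/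
theorem fibreComponent_extMul [DecidableEq ι'] {θ : ι' → V}
    (hdθ : ∀ α β, d α (θ β) = if α = β then 1 else 0) (ρ : ι') (A : CliffordAlgebra Q) {r : ℕ}
    (a : Fin r → ι') :
    fibreComponent d (extMul Q (θ ρ) A) (List.ofFn a) =
      ∑ p : Fin r, (-1 : ℝ) ^ (p : ℕ) * (if a p = ρ then 1 else 0) *
        fibreComponent d A ((List.ofFn a).eraseIdx p) := by
  induction r generalizing A with
  | zero => simpa [fibreComponent_nil] using scalarPart_extMul _ _
  | succ r ih =>
    rw [List.ofFn_succ, fibreComponent_cons, contractLeft_extMul, fibreComponent_sub,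
      fibreComponent_smul, ih, Fin.sum_univ_succ, sub_eq_add_neg, ← Finset.sum_neg_distrib, hdθ]
    congr 1
    · simp
    · refine Finset.sum_congr rfl fun p _ ↦ ?_
      rw [Fin.val_succ, List.eraseIdx_cons_succ, fibreComponent_cons]
      ring

theorem fibreComponent_derivation [Fintype ι'] [DecidableEq ι'] {θ : ι' → V}
    (hdθ : ∀ α β, d α (θ β) = if α = β then 1 else 0) (m : ι' → ι' → ℝ)
    (A : CliffordAlgebra Q) (l : List ι') :
    fibreComponent d (∑ ρ, ∑ σ, m σ ρ • extMul Q (θ ρ) (contractLeft (d σ) A)) l =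
      ∑ i : Fin l.length, ∑ σ, m σ (l.get i) * fibreComponent d A (l.set i σ) := by
  induction l generalizing A with
  | nil =>
    simp only [fibreComponent_sum, fibreComponent_smul]
    simp [fibreComponent_nil, scalarPart_extMul]
  | cons α l ih =>
    -- The commutator of e_α⌟ with the derivation is m^σ_α e_σ⌟: either the first index is replaced
    -- by σ, or it is kept and the derivation acts on the remaining indices.
    have key : contractLeft (d α) (∑ ρ, ∑ σ, m σ ρ • extMul Q (θ ρ) (contractLeft (d σ) A)) =
        (∑ σ, m σ α • contractLeft (d σ) A) +
          ∑ ρ, ∑ σ, m σ ρ • extMul Q (θ ρ) (contractLeft (d σ) (contractLeft (d α) A)) := by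
      simp only [map_sum, map_smul, contractLeft_extMul, hdθ]
      simp only [contractLeft_comm (d := d α) (d' := d _), map_neg, sub_neg_eq_add, smul_add,
        Finset.sum_add_distrib, ite_smul, one_smul, zero_smul, smul_ite, smul_zero]
      congr 1
      rw [Finset.sum_comm]
      simp
    rw [fibreComponent_cons, key, fibreComponent_add, ih]
    refine Eq.trans ?_ (Fin.sum_univ_succ
      (fun i : Fin (l.length + 1) ↦ ∑ σ, m σ ((α :: l).get i) *
        fibreComponent d A ((α :: l).set i σ))).symm
    simp [fibreComponent_sum, fibreComponent_smul, fibreComponent_cons]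

/-! ### Expansion of a multivector in a basis -/

variable [Fintype ι'] {θ : ι' → V}

/-- Euler's identity: Σ θ^α∧ e_α⌟ is the number operator. Its commutator with b∧ is b∧, so each
factor contributes one. -/
theorem sum_extMul_contractLeft (hθ : ∀ v, v = ∑ α, d α v • θ α) (l : List V) :
    ∑ α, extMul Q (θ α) (contractLeft (d α) (wedgeList Q l)) = (l.length : ℝ) • wedgeList Q l := by
  induction l with
  | nil => simp [wedgeList_nil]
  | cons b l ih =>
    have h1 : ∑ α, d α b • extMul Q (θ α) (wedgeList Q l) = wedgeList Q (b :: l) := by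
      rw [wedgeList_cons, ← extMul_apply]
      conv_rhs => rw [hθ b]
      simp [map_sum]
    have h2 : ∀ α, extMul Q (θ α) (extMul Q b (contractLeft (d α) (wedgeList Q l))) =
        -extMul Q b (extMul Q (θ α) (contractLeft (d α) (wedgeList Q l))) := fun α ↦
      LinearMap.congr_fun (extMul_mul_extMul (Q := Q) (θ α) b) _
    rw [wedgeList_cons, ← extMul_apply]
    simp only [contractLeft_extMul, map_sub, h2, map_smul, sub_neg_eq_add, Finset.sum_add_distrib]
    rw [h1, ← map_sum, ih, map_smul, wedgeList_cons, ← extMul_apply, List.length_cons]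
    push_cast
    module

theorem IsHomogeneousOfDegree.sum_extMul_contractLeft (hθ : ∀ v, v = ∑ α, d α v • θ α) {r : ℕ}
    {A : CliffordAlgebra Q} (hA : IsHomogeneousOfDegree r A) :
    ∑ α, extMul Q (θ α) (CliffordAlgebra.contractLeft (d α) A) = (r : ℝ) • A := by
  refine hA.induction (p := fun A ↦
    ∑ α, extMul Q (θ α) (CliffordAlgebra.contractLeft (d α) A) = (r : ℝ) • A) ?_
    (fun A B hA hB ↦ ?_) (fun c A hA ↦ ?_) fun v ↦ ?_
  · simp
  · simp only [map_add, Finset.sum_add_distrib, hA, hB, smul_add]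
  · simp only [map_smul, ← Finset.smul_sum, hA]; exact smul_comm _ _ _
  · simpa using _root_.sum_extMul_contractLeft (Q := Q) d hθ (List.ofFn v)

/-- Euler's identity gives A = (r+1)⁻¹ Σ θ^α∧(e_α⌟A) in degree `r + 1`; expanding e_α⌟A by induction
accumulates the factorial. -/
theorem IsHomogeneousOfDegree.expansion (hθ : ∀ v, v = ∑ α, d α v • θ α) {r : ℕ}
    {A : CliffordAlgebra Q} (hA : IsHomogeneousOfDegree r A) :
    A = (r.factorial : ℝ)⁻¹ • ∑ a : Fin r → ι', fibreComponent d A (List.ofFn a) •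
      wedgeList Q ((List.ofFn a).map θ) := by
  induction r generalizing A with
  | zero =>
    simpa [wedgeList_nil, fibreComponent_nil] using eq_scalarPart_smul_one hA
  | succ r ih =>
    have h1 := hA.sum_extMul_contractLeft d hθ
    have h2 : A = ((r + 1 : ℕ) : ℝ)⁻¹ •
        ∑ α, extMul Q (θ α) (CliffordAlgebra.contractLeft (d α) A) := by
      rw [h1, smul_smul, inv_mul_cancel₀ (by positivity), one_smul]
    conv_lhs => rw [h2]
    rw [Nat.factorial_succ, Nat.cast_mul, mul_inv, mul_smul]
    congr 1
    rw [← (Fin.consEquiv fun _ : Fin (r + 1) ↦ ι').sum_comp, Fintype.sum_prod_type,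
      Finset.smul_sum]
    refine Finset.sum_congr rfl fun α _ ↦ ?_
    conv_lhs => rw [ih (hA.contractLeft (d α))]
    simp [Fin.consEquiv, List.ofFn_succ, fibreComponent_cons, wedgeList_cons, extMul_apply]

theorem exists_eq_sum_isHomogeneousOfDegree (A : CliffordAlgebra Q) :
    ∃ s : Finset ℕ, ∃ C : ℕ → CliffordAlgebra Q,
      (∀ r, IsHomogeneousOfDegree r (C r)) ∧ A = ∑ r ∈ s, C r := by
  classical
  let Y := equivExterior Q A
  refine ⟨DFinsupp.support (DirectSum.decompose (fun i : ℕ ↦ ⋀[ℝ]^i V) Y),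
    fun r ↦ (equivExterior Q).symm (DirectSum.decompose (fun i : ℕ ↦ ⋀[ℝ]^i V) Y r), ?_, ?_⟩
  · intro r
    rw [IsHomogeneousOfDegree, LinearEquiv.apply_symm_apply]
    exact SetLike.coe_mem _
  · rw [← map_sum, DirectSum.sum_support_decompose]
    exact ((equivExterior Q).symm_apply_apply A).symm

theorem wedgeList_map_of_card_lt {r : ℕ} (hr : Fintype.card ι' < r) (a : Fin r → ι') :
    wedgeList Q ((List.ofFn a).map θ) = 0 := by
  rw [List.map_ofFn, wedgeList_ofFn, ExteriorAlgebra.ιMulti_eq_zero_of_not_inj, map_zero]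
  intro h
  have := Fintype.card_le_of_injective a h.of_comp
  simp at this
  omega

/-- Split into homogeneous parts and expand each; degrees above the rank vanish because some θ^α is
repeated. For rank 4 the range is the `Finset.range 5` in the definition of `covMultiform`. -/
theorem fibreComponent_expansion (hθ : ∀ v, v = ∑ α, d α v • θ α) (A : CliffordAlgebra Q) :
    A = ∑ r ∈ Finset.range (Fintype.card ι' + 1), (r.factorial : ℝ)⁻¹ • ∑ a : Fin r → ι',
      fibreComponent d A (List.ofFn a) • wedgeList Q ((List.ofFn a).map θ) := by
  obtain ⟨s, C, hC, rfl⟩ := exists_eq_sum_isHomogeneousOfDegree A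
  simp only [fibreComponent_sum, Finset.sum_smul]
  have : ∀ r, (r.factorial : ℝ)⁻¹ • ∑ a : Fin r → ι', ∑ j ∈ s,
      fibreComponent d (C j) (List.ofFn a) • wedgeList Q ((List.ofFn a).map θ) =
      ∑ j ∈ s, if j = r then C j else 0 := by
    intro r
    rw [Finset.sum_comm, Finset.smul_sum]
    refine Finset.sum_congr rfl fun j _ ↦ ?_
    split_ifs with h
    · subst h
      exact ((hC j).expansion d hθ).symm
    · simp [fibreComponent_of_isHomogeneousOfDegree d (hC j) (l := List.ofFn _)
        (by simpa using Ne.symm h)]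
  simp only [this]
  rw [Finset.sum_comm]
  refine Finset.sum_congr rfl fun j _ ↦ ?_
  rw [Finset.sum_ite_eq]
  split_ifs with h
  · rfl
  · rw [(hC j).expansion d hθ]
    simp only [Finset.mem_range, not_lt] at h
    symm
    rw [Finset.sum_eq_zero fun a _ ↦ ?_, smul_zero]
    rw [wedgeList_map_of_card_lt (by omega), smul_zero]

/-- The extensionality principle by which identities between multiforms are reduced to identities
between functions. -/
theorem eq_of_fibreComponent_eq (hθ : ∀ v, v = ∑ α, d α v • θ α) {A B : CliffordAlgebra Q}
    (h : ∀ l, fibreComponent d A l = fibreComponent d B l) : A = B := by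
  rw [fibreComponent_expansion d hθ A, fibreComponent_expansion d hθ B]
  simp only [h]

theorem isHomogeneousOfDegree_of_fibreComponent (hθ : ∀ v, v = ∑ α, d α v • θ α) {r : ℕ}
    {A : CliffordAlgebra Q} (h : ∀ l : List ι', l.length ≠ r → fibreComponent d A l = 0) :
    IsHomogeneousOfDegree r A := by
  rw [fibreComponent_expansion d hθ A]
  refine .sum fun k _ ↦ ?_
  by_cases hk : k = r
  · subst hk
    refine .smul (.sum fun a _ ↦ .smul ?_ _) _
    simpa using isHomogeneousOfDegree_wedgeList (Q := Q) ((List.ofFn a).map θ)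
  · simpa [h (List.ofFn _) (by simpa using hk)] using .zero r

end Fibre

/-! ### Smooth functions, vector fields, covariant derivatives and brackets on an open set -/

section Calculus

variable {M : Type*} [TopologicalSpace M] [ChartedSpace R4 M] [IsManifold (𝓡 4) ∞ M]

/-- `f` is smooth on `U`. -/
abbrev SmoothOn (U : Set M) (f : M → ℝ) : Prop := ContMDiffOn (𝓡 4) 𝓘(ℝ, ℝ) ∞ f U

/-- `X` is a smooth vector field on `U`. -/
abbrev SmoothFieldOn (U : Set M) (X : ∀ x : M, TangentSpace (𝓡 4) x) : Prop :=
  ContMDiffOn (𝓡 4) ((𝓡 4).prod 𝓘(ℝ, R4)) ∞ (fun y ↦ (⟨y, X y⟩ : TangentBundle (𝓡 4) M)) U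

variable {U : Set M} {e : Fin 4 → ∀ x : M, TangentSpace (𝓡 4) x}

theorem SmoothOn.mdifferentiableAt (hU : IsOpen U) {f : M → ℝ} (hf : SmoothOn U f) {x : M}
    (hx : x ∈ U) : MDifferentiableAt (𝓡 4) 𝓘(ℝ, ℝ) f x :=
  (hf.contMDiffAt (hU.mem_nhds hx)).mdifferentiableAt (by simp)

theorem SmoothFieldOn.mdifferentiableAt (hU : IsOpen U) {X : ∀ x : M, TangentSpace (𝓡 4) x}
    (hX : SmoothFieldOn U X) {x : M} (hx : x ∈ U) :
    MDifferentiableAt (𝓡 4) ((𝓡 4).prod 𝓘(ℝ, R4))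
      (fun y ↦ (⟨y, X y⟩ : TangentBundle (𝓡 4) M)) x :=
  (hX.contMDiffAt (hU.mem_nhds hx)).mdifferentiableAt (by simp)

/-- The derivative `X f` of a function along a vector field. -/
def dirDeriv (X : ∀ x : M, TangentSpace (𝓡 4) x) (f : M → ℝ) (x : M) : ℝ :=
  mvfderiv (𝓡 4) f x (X x)

theorem dirDeriv_congr (hU : IsOpen U) {f f' : M → ℝ} (h : ∀ y ∈ U, f y = f' y)
    (X : ∀ x : M, TangentSpace (𝓡 4) x) {x : M} (hx : x ∈ U) :
    dirDeriv X f x = dirDeriv X f' x := by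
  have h' : f =ᶠ[nhds x] f' := Filter.eventually_of_mem (hU.mem_nhds hx) h
  unfold dirDeriv mvfderiv
  rw [h'.mfderiv_eq, h x hx]

theorem dirDeriv_const (X : ∀ x : M, TangentSpace (𝓡 4) x) (c : ℝ) (x : M) :
    dirDeriv X (fun _ ↦ c) x = 0 := by
  unfold dirDeriv
  rw [mvfderiv_const]; rfl

theorem dirDeriv_add (hU : IsOpen U) {f f' : M → ℝ} (hf : SmoothOn U f) (hf' : SmoothOn U f')
    (X : ∀ x : M, TangentSpace (𝓡 4) x) {x : M} (hx : x ∈ U) :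
    dirDeriv X (fun y ↦ f y + f' y) x = dirDeriv X f x + dirDeriv X f' x := by
  unfold dirDeriv
  rw [mvfderiv_fun_add (hf.mdifferentiableAt hU hx) (hf'.mdifferentiableAt hU hx)]; rfl

theorem dirDeriv_mul (hU : IsOpen U) {f f' : M → ℝ} (hf : SmoothOn U f) (hf' : SmoothOn U f')
    (X : ∀ x : M, TangentSpace (𝓡 4) x) {x : M} (hx : x ∈ U) :
    dirDeriv X (fun y ↦ f y * f' y) x = dirDeriv X f x * f' x + f x * dirDeriv X f' x := by
  unfold dirDeriv
  rw [mvfderiv_fun_mul (hf.mdifferentiableAt hU hx) (hf'.mdifferentiableAt hU hx)]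
  simp only [_root_.add_apply, _root_.smul_apply, smul_eq_mul]
  ring

theorem dirDeriv_sub (hU : IsOpen U) {f f' : M → ℝ} (hf : SmoothOn U f) (hf' : SmoothOn U f')
    (X : ∀ x : M, TangentSpace (𝓡 4) x) {x : M} (hx : x ∈ U) :
    dirDeriv X (fun y ↦ f y - f' y) x = dirDeriv X f x - dirDeriv X f' x := by
  unfold dirDeriv
  rw [mvfderiv_fun_sub (hf.mdifferentiableAt hU hx) (hf'.mdifferentiableAt hU hx)]; rfl

theorem SmoothOn.sum {J : Type*} {s : Finset J} {f : J → M → ℝ}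
    (hf : ∀ j ∈ s, SmoothOn U (f j)) : SmoothOn U (fun y ↦ ∑ j ∈ s, f j y) :=
  contMDiffOn_finsetSum hf

theorem SmoothOn.mul {f f' : M → ℝ} (hf : SmoothOn U f) (hf' : SmoothOn U f') :
    SmoothOn U (fun y ↦ f y * f' y) :=
  ContMDiffOn.mul (I := 𝓘(ℝ, ℝ)) hf hf'

theorem SmoothOn.sub {f f' : M → ℝ} (hf : SmoothOn U f) (hf' : SmoothOn U f') :
    SmoothOn U (fun y ↦ f y - f' y) :=
  ContMDiffOn.sub hf hf'

theorem dirDeriv_sum (hU : IsOpen U) {J : Type*} {s : Finset J} {f : J → M → ℝ}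
    (hf : ∀ j ∈ s, SmoothOn U (f j)) (X : ∀ x : M, TangentSpace (𝓡 4) x) {x : M} (hx : x ∈ U) :
    dirDeriv X (fun y ↦ ∑ j ∈ s, f j y) x = ∑ j ∈ s, dirDeriv X (f j) x := by
  classical
  induction s using Finset.induction_on with
  | empty => simpa using dirDeriv_const X 0 x
  | insert a s ha ih =>
    simp only [Finset.sum_insert ha]
    have h1 := fun j hj ↦ hf j (Finset.mem_insert_of_mem hj)
    rw [dirDeriv_add hU (hf a (Finset.mem_insert_self a s)) (.sum h1) X hx, ih h1]

theorem dirDeriv_const_mul (hU : IsOpen U) {f : M → ℝ} (hf : SmoothOn U f) (c : ℝ)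
    (X : ∀ x : M, TangentSpace (𝓡 4) x) {x : M} (hx : x ∈ U) :
    dirDeriv X (fun y ↦ c * f y) x = c * dirDeriv X f x := by
  rw [dirDeriv_mul hU (f := fun _ ↦ c) contMDiffOn_const hf X hx, dirDeriv_const]
  ring

/-- X f is the fibre coordinate of the tangent map of f composed with the section X; openness of U
lets the derivative within U stand for the full one. -/
theorem SmoothOn.dirDeriv (hU : IsOpen U) {f : M → ℝ} (hf : SmoothOn U f)
    {X : ∀ x : M, TangentSpace (𝓡 4) x} (hX : SmoothFieldOn U X) :
    SmoothOn U (_root_.dirDeriv X f) := by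
  have h1 := hf.contMDiffOn_tangentMapWithin (m := ∞) (by simp) hU.uniqueMDiffOn
  have h2 := h1.comp (t := Bundle.TotalSpace.proj ⁻¹' U) hX (fun x hx ↦ hx)
  have h3 := (contMDiff_snd_tangentBundle_modelSpace (n := ∞) ℝ 𝓘(ℝ, ℝ)).comp_contMDiffOn h2
  refine h3.congr fun x hx ↦ ?_
  change _ = mfderivWithin (𝓡 4) 𝓘(ℝ, ℝ) f U x (X x)
  rw [mfderivWithin_of_isOpen hU hx]
  rfl

theorem SmoothFieldOn.smul {f : M → ℝ} (hf : SmoothOn U f) {X : ∀ x : M, TangentSpace (𝓡 4) x}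
    (hX : SmoothFieldOn U X) : SmoothFieldOn U (fun y ↦ f y • X y) :=
  ContMDiffOn.smul_section hf hX

theorem SmoothFieldOn.sub {X Y : ∀ x : M, TangentSpace (𝓡 4) x}
    (hX : SmoothFieldOn U X) (hY : SmoothFieldOn U Y) : SmoothFieldOn U (fun y ↦ X y - Y y) :=
  ContMDiffOn.sub_section hX hY

theorem SmoothFieldOn.sum {J : Type*} {s : Finset J} {X : J → ∀ x : M, TangentSpace (𝓡 4) x}
    (hX : ∀ j ∈ s, SmoothFieldOn U (X j)) : SmoothFieldOn U (fun y ↦ ∑ j ∈ s, X j y) :=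
  ContMDiffOn.sum_section hX

theorem SmoothOn.metric (g : LorentzMetric M) {X Y : ∀ x : M, TangentSpace (𝓡 4) x}
    (hX : SmoothFieldOn U X) (hY : SmoothFieldOn U Y) :
    SmoothOn U (fun y ↦ g.toFun y (X y) (Y y)) := by
  have h := ContMDiffOn.clm_bundle_apply₂ (n := ∞) (IM := 𝓡 4) (IB := 𝓡 4) (F₁ := R4) (F₂ := R4)
    (F₃ := ℝ) (E₁ := fun x : M ↦ TangentSpace (𝓡 4) x) (E₂ := fun x : M ↦ TangentSpace (𝓡 4) x)
    (E₃ := Bundle.Trivial M ℝ) (b := id) (g.contMDiff.contMDiffOn (s := U)) hX hY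
  intro x hx
  exact ((Bundle.contMDiffWithinAt_totalSpace).1 (h x hx)).2

variable (cov : CovariantDerivative (𝓡 4) R4 (TangentSpace (𝓡 4) : M → Type _))

theorem cov_congr (hU : IsOpen U) {X Y : ∀ x : M, TangentSpace (𝓡 4) x} (hX : SmoothFieldOn U X)
    (hY : SmoothFieldOn U Y) (h : ∀ y ∈ U, X y = Y y) {x : M} (hx : x ∈ U) : cov X x = cov Y x :=
  (cov.isCovariantDerivativeOn (s := U)).congr_of_eqOn (hX.mdifferentiableAt hU hx)
    (hY.mdifferentiableAt hU hx) (hU.mem_nhds hx) h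

/-- Smoothness of the connection is given for global fields only. A bump function supported in U
extends X by zero, and locality of the connection shows that nothing changes near the point. -/
theorem SmoothFieldOn.covDeriv [T2Space M] [CovariantDerivative.ContMDiffCovariantDerivative cov ∞]
    (hU : IsOpen U) {X Y : ∀ x : M, TangentSpace (𝓡 4) x} (hX : SmoothFieldOn U X)
    (hY : SmoothFieldOn U Y) : SmoothFieldOn U (fun y ↦ cov X y (Y y)) := by
  intro x hx
  obtain ⟨χ, -, hχ⟩ := (SmoothBumpFunction.nhds_basis_tsupport (I := 𝓡 4) x).mem_iff.1
    (hU.mem_nhds hx)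
  have h1 : SmoothFieldOn Set.univ (fun y ↦ χ y • X y) := by
    have := ContMDiffOn.smul_section_of_tsupport (n := ∞) (ψ := χ) (s := X) (u := U)
      χ.contMDiff.contMDiffOn hU hχ hX
    exact this.contMDiffOn
  have h2 := (CovariantDerivative.ContMDiffCovariantDerivative.contMDiff
    (cov := cov) (k := ∞)).contMDiff (σ := fun y ↦ χ y • X y) (by simpa using h1)
  have h3 := ContMDiffOn.clm_bundle_apply (n := ∞) (IM := 𝓡 4) (IB := 𝓡 4) (F₁ := R4) (F₂ := R4)
    (E₁ := fun x : M ↦ TangentSpace (𝓡 4) x) (E₂ := fun x : M ↦ TangentSpace (𝓡 4) x)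
    (b := id) (h2.mono (Set.subset_univ U)) hY
  have h4 := (h3 x hx).contMDiffAt (hU.mem_nhds hx)
  refine (h4.congr_of_eventuallyEq ?_).contMDiffWithinAt
  -- Locality must be applied at every y near x, so the bump function has to equal 1 on a
  -- neighbourhood of each such y, not merely at y.
  have h5 : ∀ᶠ y in nhds x, ∀ᶠ z in nhds y, χ z = 1 :=
      eventually_eventually_nhds.2 χ.eventuallyEq_one
  filter_upwards [h5, hU.mem_nhds hx] with y hy hyU
  have : cov X y = cov (fun y ↦ χ y • X y) y := by
    refine (cov.isCovariantDerivativeOn (s := Set.univ)).congr_of_eventuallyEq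
      (hX.mdifferentiableAt hU hyU) (h1.mdifferentiableAt isOpen_univ trivial) Filter.univ_mem ?_
    filter_upwards [hy] with z hz
    rw [hz, one_smul]
  simp only [this, id]

theorem cov_smul (hU : IsOpen U) {f : M → ℝ} (hf : SmoothOn U f)
    {X : ∀ x : M, TangentSpace (𝓡 4) x} (hX : SmoothFieldOn U X) {x : M} (hx : x ∈ U)
    (v : TangentSpace (𝓡 4) x) :
    cov (fun y ↦ f y • X y) x v = f x • cov X x v + mvfderiv (𝓡 4) f x v • X x := by
  have h := (cov.isCovariantDerivativeOn (s := U)).leibniz (hX.mdifferentiableAt hU hx)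
    (hf.mdifferentiableAt hU hx) hx
  exact congrArg (fun L ↦ L v) h

theorem cov_add (hU : IsOpen U) {X Y : ∀ x : M, TangentSpace (𝓡 4) x}
    (hX : SmoothFieldOn U X) (hY : SmoothFieldOn U Y) {x : M} (hx : x ∈ U)
    (v : TangentSpace (𝓡 4) x) :
    cov (fun y ↦ X y + Y y) x v = cov X x v + cov Y x v := by
  have h := (cov.isCovariantDerivativeOn (s := U)).add (hX.mdifferentiableAt hU hx)
    (hY.mdifferentiableAt hU hx) hx
  exact congrArg (fun L ↦ L v) h

theorem cov_sub (hU : IsOpen U) {X Y : ∀ x : M, TangentSpace (𝓡 4) x}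
    (hX : SmoothFieldOn U X) (hY : SmoothFieldOn U Y) {x : M} (hx : x ∈ U)
    (v : TangentSpace (𝓡 4) x) :
    cov (fun y ↦ X y - Y y) x v = cov X x v - cov Y x v := by
  have h := cov_add cov hU (hX.sub hY) hY hx v
  simp only [sub_add_cancel] at h
  rw [h, add_sub_cancel_right]

theorem cov_sum (hU : IsOpen U) {J : Type*} {s : Finset J}
    {X : J → ∀ x : M, TangentSpace (𝓡 4) x} (hX : ∀ j ∈ s, SmoothFieldOn U (X j)) {x : M}
    (hx : x ∈ U) (v : TangentSpace (𝓡 4) x) :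
    cov (fun y ↦ ∑ j ∈ s, X j y) x v = ∑ j ∈ s, cov (X j) x v := by
  classical
  induction s using Finset.induction_on with
  | empty =>
    have h := (cov.isCovariantDerivativeOn (s := U)).zero hx
    exact congrArg (fun L ↦ L v) h
  | insert a s ha ih =>
    simp only [Finset.sum_insert ha]
    have h1 := fun j hj ↦ hX j (Finset.mem_insert_of_mem hj)
    rw [cov_add cov hU (hX a (Finset.mem_insert_self a s)) (.sum h1) hx, ih h1]

/-! ### Brackets -/

theorem mlieBracket_congr (hU : IsOpen U) {X X' Y Y' : ∀ x : M, TangentSpace (𝓡 4) x}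
    (hX : ∀ y ∈ U, X y = X' y) (hY : ∀ y ∈ U, Y y = Y' y) {x : M} (hx : x ∈ U) :
    VectorField.mlieBracket (𝓡 4) X Y x = VectorField.mlieBracket (𝓡 4) X' Y' x :=
  Filter.EventuallyEq.mlieBracket_vectorField_eq
    (Filter.eventually_of_mem (hU.mem_nhds hx) hX) (Filter.eventually_of_mem (hU.mem_nhds hx) hY)

variable {cov}

theorem mlieBracket_eq_cov (htor : cov.torsion = 0) (hU : IsOpen U)
    {X Y : ∀ x : M, TangentSpace (𝓡 4) x} (hX : SmoothFieldOn U X) (hY : SmoothFieldOn U Y) {x : M}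
    (hx : x ∈ U) :
    VectorField.mlieBracket (𝓡 4) X Y x = cov Y x (X x) - cov X x (Y x) :=
  (cov.torsion_eq_zero_iff.1 htor (hX.mdifferentiableAt hU hx) (hY.mdifferentiableAt hU hx)).symm

theorem jacobi (hU : IsOpen U) {X Y Z : ∀ x : M, TangentSpace (𝓡 4) x}
    (hX : SmoothFieldOn U X) (hY : SmoothFieldOn U Y) (hZ : SmoothFieldOn U Z) {x : M}
    (hx : x ∈ U) :
    VectorField.mlieBracket (𝓡 4) X (VectorField.mlieBracket (𝓡 4) Y Z) x =
      VectorField.mlieBracket (𝓡 4) (VectorField.mlieBracket (𝓡 4) X Y) Z x +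
        VectorField.mlieBracket (𝓡 4) Y (VectorField.mlieBracket (𝓡 4) X Z) x := by
  have : IsManifold (𝓡 4) (minSmoothness ℝ 3) M := by
    simp only [minSmoothness_of_isRCLikeNormedField]
    exact IsManifold.of_le (n := ∞) (WithTop.coe_le_coe.2 le_top)
  have h2 : minSmoothness ℝ 2 ≤ ∞ := by
    simp only [minSmoothness_of_isRCLikeNormedField]; exact WithTop.coe_le_coe.2 le_top
  exact VectorField.leibniz_identity_mlieBracket_apply
    ((hX.contMDiffAt (hU.mem_nhds hx)).of_le h2)
    ((hY.contMDiffAt (hU.mem_nhds hx)).of_le h2) ((hZ.contMDiffAt (hU.mem_nhds hx)).of_le h2)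

theorem mlieBracket_smul (hU : IsOpen U) {f : M → ℝ} (hf : SmoothOn U f)
    (X : ∀ x : M, TangentSpace (𝓡 4) x) {Y : ∀ x : M, TangentSpace (𝓡 4) x}
    (hY : SmoothFieldOn U Y) {x : M} (hx : x ∈ U) :
    VectorField.mlieBracket (𝓡 4) X (fun y ↦ f y • Y y) x =
      dirDeriv X f x • Y x + f x • VectorField.mlieBracket (𝓡 4) X Y x :=
  VectorField.mlieBracket_smul_right (hf.mdifferentiableAt hU hx) (hY.mdifferentiableAt hU hx)

variable [T2Space M] [CovariantDerivative.ContMDiffCovariantDerivative cov ∞]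

theorem SmoothFieldOn.mlieBracket (htor : cov.torsion = 0) (hU : IsOpen U)
    {X Y : ∀ x : M, TangentSpace (𝓡 4) x} (hX : SmoothFieldOn U X) (hY : SmoothFieldOn U Y) :
    SmoothFieldOn U (VectorField.mlieBracket (𝓡 4) X Y) :=
  ((hY.covDeriv cov hU hX).sub (hX.covDeriv cov hU hY)).congr fun x hx ↦ by
    rw [mlieBracket_eq_cov htor hU hX hY hx]

/-- Expand the Jacobi identity for X, Y and fZ by the Leibniz rule of the bracket and compare the
coefficients of Z, which does not vanish at x. The auxiliary field Z is there only for this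
comparison. -/
theorem dirDeriv_mlieBracket (htor : cov.torsion = 0) (hU : IsOpen U)
    {X Y Z : ∀ x : M, TangentSpace (𝓡 4) x} (hX : SmoothFieldOn U X) (hY : SmoothFieldOn U Y)
    (hZ : SmoothFieldOn U Z) {f : M → ℝ} (hf : SmoothOn U f) {x : M} (hx : x ∈ U)
    (hZ0 : Z x ≠ 0) :
    dirDeriv (VectorField.mlieBracket (𝓡 4) X Y) f x =
      dirDeriv X (dirDeriv Y f) x - dirDeriv Y (dirDeriv X f) x := by
  have key : ∀ {X Y : ∀ x : M, TangentSpace (𝓡 4) x}, SmoothFieldOn U X → SmoothFieldOn U Y →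
      VectorField.mlieBracket (𝓡 4) X
          (VectorField.mlieBracket (𝓡 4) Y (fun y ↦ f y • Z y)) x =
        dirDeriv X (dirDeriv Y f) x • Z x +
          dirDeriv Y f x • VectorField.mlieBracket (𝓡 4) X Z x +
          dirDeriv X f x • VectorField.mlieBracket (𝓡 4) Y Z x +
          f x • VectorField.mlieBracket (𝓡 4) X (VectorField.mlieBracket (𝓡 4) Y Z) x := by
    intro X Y hX hY
    have hYZ := SmoothFieldOn.mlieBracket htor hU hY hZ
    have h1 : SmoothFieldOn U (fun y ↦ dirDeriv Y f y • Z y) := .smul (hf.dirDeriv hU hY) hZ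
    have h2 : SmoothFieldOn U (fun y ↦ f y • VectorField.mlieBracket (𝓡 4) Y Z y) := .smul hf hYZ
    rw [mlieBracket_congr hU (X' := X) (fun _ _ ↦ rfl)
      (fun y hy ↦ mlieBracket_smul hU hf Y hZ hy) hx]
    have h3 := VectorField.mlieBracket_add_right (V := X)
      (h1.mdifferentiableAt hU hx) (h2.mdifferentiableAt hU hx)
    refine h3.trans ?_
    rw [mlieBracket_smul hU (hf.dirDeriv hU hY) X hZ hx, mlieBracket_smul hU hf X hYZ hx]
    abel
  have h1 := jacobi hU hX hY (SmoothFieldOn.smul hf hZ) hx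
  have h2 := jacobi hU hX hY hZ hx
  rw [key hX hY, key hY hX, h2, mlieBracket_smul hU hf _ hZ hx] at h1
  -- The terms with one derivative of f on [X, Z] and [Y, Z] are symmetric in X and Y and cancel;
  -- the terms without derivatives of f cancel by the Jacobi identity for Z.
  have h3 : (dirDeriv X (dirDeriv Y f) x - dirDeriv Y (dirDeriv X f) x -
      dirDeriv (VectorField.mlieBracket (𝓡 4) X Y) f x) • Z x = 0 := by
    rw [sub_smul, sub_smul]
    rw [smul_add] at h1
    rw [sub_eq_zero, sub_eq_iff_eq_add, ← add_left_inj (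
      dirDeriv Y f x • VectorField.mlieBracket (𝓡 4) X Z x +
          dirDeriv X f x • VectorField.mlieBracket (𝓡 4) Y Z x +
          (f x • VectorField.mlieBracket (𝓡 4) (VectorField.mlieBracket (𝓡 4) X Y) Z x +
            f x • VectorField.mlieBracket (𝓡 4) Y (VectorField.mlieBracket (𝓡 4) X Z) x))]
    refine Eq.trans ?_ (h1.trans ?_) <;> abel
  rcases smul_eq_zero.1 h3 with h | h
  · linarith
  · exact absurd h hZ0

end Calculus

/-! ### Frame, coframe, connection coefficients and curvature components -/

section FrameCalculus

variable {M : Type*} [TopologicalSpace M] [ChartedSpace R4 M] [IsManifold (𝓡 4) ∞ M]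
  {U : Set M} {e : Fin 4 → ∀ x : M, TangentSpace (𝓡 4) x} (he : IsLocalFrameOn (𝓡 4) R4 ∞ e U)
  (g : LorentzMetric M)

theorem smoothFieldOn_frame (he : IsLocalFrameOn (𝓡 4) R4 ∞ e U) (α : Fin 4) :
    SmoothFieldOn U (e α) := he.contMDiffOn α

theorem coframe_apply_frame {x : M} (hx : x ∈ U) (μ ν : Fin 4) :
    coframe he μ x (e ν x) = if ν = μ then 1 else 0 := by
  have h := he.coeff_apply_of_mem hx (e ν) μ
  rw [← he.toBasisAt_coe hx ν, Module.Basis.repr_self] at h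
  rw [coframe]
  rw [← he.toBasisAt_coe hx ν, h, Finsupp.single_apply]

theorem sum_coframe_smul {x : M} (hx : x ∈ U) (v : TangentSpace (𝓡 4) x) :
    ∑ μ, coframe he μ x v • e μ x = v := by
  classical
  have h := he.coeff_sum_eq (fun y ↦ if hy : y = x then hy ▸ v else 0) hx
  simpa [coframe] using h.symm

theorem eq_sum_smul_coframe {x : M} (hx : x ∈ U) (a : Module.Dual ℝ (TangentSpace (𝓡 4) x)) :
    a = ∑ α, a (e α x) • coframe he α x := by
  refine LinearMap.ext fun v ↦ ?_
  conv_lhs => rw [← sum_coframe_smul he hx v]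
  simp [map_sum, mul_comm]

theorem frame_ne_zero (he : IsLocalFrameOn (𝓡 4) R4 ∞ e U) {x : M} (hx : x ∈ U)
    (α : Fin 4) : e α x ≠ 0 := by
  intro h
  have := coframe_apply_frame he hx α α
  simp [h] at this

theorem gLower_symm (α β : Fin 4) (x : M) : gLower g e α β x = gLower g e β α x := g.symm x _ _

theorem gUpper_symm (α β : Fin 4) (x : M) : gUpper g he α β x = gUpper g he β α x :=
  g.cometric_symm x _ _

theorem coframeLower_eq {x : M} (hx : x ∈ U) (σ : Fin 4) :
    coframeLower g he σ x = g.bilin x (e σ x) := by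
  rw [eq_sum_smul_coframe he hx (g.bilin x (e σ x))]
  rfl

/-- θ_σ is the metric dual of e_σ, so pairing with it is evaluation at e_σ. Hence contraction with
θ_σ is contraction with e_σ and does not involve the metric. -/
theorem cometric_coframeLower {x : M} (hx : x ∈ U) (σ : Fin 4)
    (a : Module.Dual ℝ (TangentSpace (𝓡 4) x)) :
    g.cometric x (coframeLower g he σ x) a = a (e σ x) := by
  rw [coframeLower_eq he g hx]
  have h1 : ((g.bilin x).toDual (g.bilin_nondegenerate x)).symm (g.bilin x (e σ x)) = e σ x :=
    LinearEquiv.symm_apply_apply ((g.bilin x).toDual (g.bilin_nondegenerate x)) (e σ x)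
  have h2 := LinearMap.BilinForm.apply_toDual_symm_apply (hB := g.bilin_nondegenerate x) a (e σ x)
  rw [LorentzMetric.cometric, LinearMap.compl₁₂_apply]
  simp only [LinearEquiv.coe_coe, h1]
  rw [← h2]
  exact g.symm x _ _

theorem cometric_coframeLower_eq_eval {x : M} (hx : x ∈ U) (σ : Fin 4) :
    g.cometric x (coframeLower g he σ x) = Module.Dual.eval ℝ _ (e σ x) :=
  LinearMap.ext fun a ↦ cometric_coframeLower he g hx σ a

/-- Compute θ_γ · θ^α twice: by expanding θ_γ in the coframe, and as θ^α(e_γ). -/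
theorem sum_gUpper_mul_gLower {x : M} (hx : x ∈ U) (α γ : Fin 4) :
    ∑ β, gUpper g he α β x * gLower g e β γ x = if α = γ then 1 else 0 := by
  have h := cometric_coframeLower he g hx γ (coframe he α x)
  rw [coframe_apply_frame he hx, g.cometric_symm, coframeLower] at h
  simp only [map_sum, map_smul, smul_eq_mul] at h
  simp only [eq_comm (a := α)]
  rw [← h]
  exact Finset.sum_congr rfl fun β _ ↦ by rw [gLower_symm g β γ, mul_comm]; rfl

theorem sum_gLower_mul_gUpper {x : M} (hx : x ∈ U) (α γ : Fin 4) :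
    ∑ β, gLower g e α β x * gUpper g he β γ x = if α = γ then 1 else 0 := by
  have h := sum_gUpper_mul_gLower he g hx γ α
  simp only [eq_comm (a := α)]
  rw [← h]
  exact Finset.sum_congr rfl fun β _ ↦ by rw [gLower_symm g β α, gUpper_symm he g γ, mul_comm]

/-- Writes frame coordinates through inner products with the frame, so that their smoothness follows
from that of the metric and of g^{μν}. -/
theorem coframe_apply_eq {x : M} (hx : x ∈ U) (μ : Fin 4) (v : TangentSpace (𝓡 4) x) :
    coframe he μ x v = ∑ ν, gUpper g he μ ν x * g.toFun x v (e ν x) := by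
  have h : ∀ ν, g.toFun x v (e ν x) = ∑ ρ, coframe he ρ x v * gLower g e ρ ν x := by
    intro ν
    conv_lhs => rw [← sum_coframe_smul he hx v]
    simp [gLower]
  simp only [h, Finset.mul_sum]
  rw [Finset.sum_comm]
  have h2 : ∀ ρ, ∑ ν, gUpper g he μ ν x * (coframe he ρ x v * gLower g e ρ ν x) =
      coframe he ρ x v * if μ = ρ then 1 else 0 := by
    intro ρ
    rw [← sum_gUpper_mul_gLower he g hx, Finset.mul_sum]
    exact Finset.sum_congr rfl fun ν _ ↦ by rw [gLower_symm g ρ ν]; ring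
  simp [h2]

theorem smoothOn_gLower (he : IsLocalFrameOn (𝓡 4) R4 ∞ e U) (α β : Fin 4) :
    SmoothOn U (gLower g e α β) :=
  .metric g (smoothFieldOn_frame he α) (smoothFieldOn_frame he β)

theorem SmoothOn.matrix_det {n : ℕ} {A : Fin n → Fin n → M → ℝ}
    (hA : ∀ i j, SmoothOn U (A i j)) : SmoothOn U (fun y ↦ (Matrix.of fun i j ↦ A i j y).det) := by
  simp only [Matrix.det_apply]
  refine .sum fun p _ ↦ ?_
  have h : SmoothOn U (fun y ↦ ∏ i, A (p i) i y) := contMDiffOn_finsetProd fun i _ ↦ hA _ _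
  have h2 : SmoothOn U (fun y ↦ ((Equiv.Perm.sign p : ℤ) : ℝ) * ∏ i, A (p i) i y) :=
    .mul contMDiffOn_const h
  refine h2.congr fun y _ ↦ ?_
  simp [Units.smul_def]

/-- Cramer's rule: (g^{αβ}) is the adjugate of (g_{αβ}) divided by its determinant, which is nonzero
on U because an inverse exists. -/
theorem smoothOn_gUpper (α β : Fin 4) : SmoothOn U (gUpper g he α β) := by
  let G : M → Matrix (Fin 4) (Fin 4) ℝ := fun y ↦ Matrix.of fun i j ↦ gLower g e i j y
  let H : M → Matrix (Fin 4) (Fin 4) ℝ := fun y ↦ Matrix.of fun i j ↦ gUpper g he i j y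
  have hGH : ∀ y ∈ U, H y * G y = 1 := by
    intro y hy
    ext i j
    rw [Matrix.mul_apply, Matrix.one_apply]
    exact sum_gUpper_mul_gLower he g hy i j
  have hdet : SmoothOn U (fun y ↦ (G y).det) := .matrix_det (smoothOn_gLower g he)
  have hdet0 : ∀ y ∈ U, (G y).det ≠ 0 := fun y hy h ↦ by
    have := congrArg Matrix.det (hGH y hy)
    rw [Matrix.det_mul, h] at this
    simp at this
  have hadj : SmoothOn U (fun y ↦ (G y).adjugate α β) := by
    simp only [Matrix.adjugate_apply]
    -- The (α, β) entry of the adjugate is the determinant of the matrix with row β replaced by the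
    -- α-th unit vector.
    have h := SmoothOn.matrix_det (U := U)
      (A := fun i j y ↦ if i = β then (Pi.single α 1 : Fin 4 → ℝ) j else gLower g e i j y) ?_
    · refine h.congr fun y _ ↦ ?_
      congr 1
      ext i j
      by_cases hi : i = β
      · subst hi; simp
      · simp [hi, G]
    · intro i j
      by_cases hi : i = β
      · simpa [hi] using! contMDiffOn_const
      · simpa [hi] using! smoothOn_gLower g he i j
  have h := SmoothOn.mul (ContMDiffOn.inv₀ hdet hdet0) hadj
  refine h.congr fun y hy ↦ ?_
  have h1 : H y = (G y)⁻¹ := (Matrix.inv_eq_left_inv (hGH y hy)).symm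
  change H y α β = _
  rw [h1, Matrix.inv_def, Matrix.smul_apply, Ring.inverse_eq_inv, smul_eq_mul]

theorem smoothOn_coframe_apply {X : ∀ x : M, TangentSpace (𝓡 4) x} (hX : SmoothFieldOn U X)
    (μ : Fin 4) (g : LorentzMetric M) : SmoothOn U (fun y ↦ coframe he μ y (X y)) := by
  have h : SmoothOn U (fun y ↦ ∑ ν, gUpper g he μ ν y * g.toFun y (X y) (e ν y)) :=
    .sum fun ν _ ↦ .mul (smoothOn_gUpper he g μ ν) (.metric g hX (smoothFieldOn_frame he ν))
  exact h.congr fun y hy ↦ coframe_apply_eq he g hy μ (X y)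

variable (cov : CovariantDerivative (𝓡 4) R4 (TangentSpace (𝓡 4) : M → Type _))

theorem sum_connCoeff_smul {x : M} (hx : x ∈ U) (α β : Fin 4) :
    ∑ μ, connCoeff cov he μ α β x • e μ x = cov (e β) x (e α x) :=
  sum_coframe_smul he hx _

variable {cov}

theorem mlieBracket_frame (htor : cov.torsion = 0) (hU : IsOpen U) {x : M} (hx : x ∈ U)
    (α β : Fin 4) :
    VectorField.mlieBracket (𝓡 4) (e α) (e β) x =
      ∑ σ, (connCoeff cov he σ α β x - connCoeff cov he σ β α x) • e σ x := by
  rw [mlieBracket_eq_cov htor hU (smoothFieldOn_frame he α) (smoothFieldOn_frame he β) hx,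
    ← sum_connCoeff_smul he cov hx, ← sum_connCoeff_smul he cov hx, ← Finset.sum_sub_distrib]
  simp only [sub_smul]

theorem dirDeriv_gLower (hcov : g.IsCompatible cov) (hU : IsOpen U) {x : M} (hx : x ∈ U)
    (α μ ν : Fin 4) :
    dirDeriv (e α) (gLower g e μ ν) x =
      ∑ σ, (connCoeff cov he σ α μ x * gLower g e σ ν x +
        connCoeff cov he σ α ν x * gLower g e μ σ x) := by
  have h := hcov x (e α x) (e μ) (e ν) ((smoothFieldOn_frame he μ).mdifferentiableAt hU hx)
    ((smoothFieldOn_frame he ν).mdifferentiableAt hU hx)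
  refine Eq.trans h ?_
  rw [← sum_connCoeff_smul he cov hx, ← sum_connCoeff_smul he cov hx, Finset.sum_add_distrib]
  simp [gLower]

/-- Differentiate g^{μβ} g_{βτ} = δ, insert the compatibility formula for the derivative of g_{βτ},
and multiply by g^{τν}. -/
theorem dirDeriv_gUpper (hcov : g.IsCompatible cov) (hU : IsOpen U) {x : M} (hx : x ∈ U)
    (α μ ν : Fin 4) :
    dirDeriv (e α) (gUpper g he μ ν) x =
      -∑ σ, (connCoeff cov he μ α σ x * gUpper g he σ ν x +
        connCoeff cov he ν α σ x * gUpper g he μ σ x) := by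
  have h1 : ∀ τ, ∑ β, (dirDeriv (e α) (gUpper g he μ β) x * gLower g e β τ x +
      gUpper g he μ β x * dirDeriv (e α) (gLower g e β τ) x) = 0 := by
    intro τ
    have h := dirDeriv_congr hU (fun y hy ↦ sum_gUpper_mul_gLower he g hy μ τ) (e α) hx
    rw [dirDeriv_const, dirDeriv_sum hU
      (fun β _ ↦ (smoothOn_gUpper he g μ β).mul (smoothOn_gLower g he β τ)) _ hx] at h
    rw [← h]
    exact Finset.sum_congr rfl fun β _ ↦
      (dirDeriv_mul hU (smoothOn_gUpper he g μ β) (smoothOn_gLower g he β τ) _ hx).symm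
  have h2 : dirDeriv (e α) (gUpper g he μ ν) x =
      ∑ τ, (∑ β, dirDeriv (e α) (gUpper g he μ β) x * gLower g e β τ x) * gUpper g he τ ν x := by
    simp only [Finset.sum_mul]
    rw [Finset.sum_comm]
    simp only [mul_assoc, ← Finset.mul_sum, sum_gLower_mul_gUpper he g hx]
    simp
  have h3 : ∀ τ, ∑ β, dirDeriv (e α) (gUpper g he μ β) x * gLower g e β τ x =
      -(connCoeff cov he μ α τ x + ∑ β, ∑ σ, gUpper g he μ β x *
        (connCoeff cov he σ α β x * gLower g e σ τ x)) := by
    intro τ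
    have h := h1 τ
    rw [Finset.sum_add_distrib] at h
    rw [eq_neg_of_add_eq_zero_left h]
    congr 1
    simp only [dirDeriv_gLower he g hcov hU hx, Finset.mul_sum, mul_add, Finset.sum_add_distrib]
    rw [add_comm]
    congr 1
    rw [Finset.sum_comm]
    have : ∀ σ, ∑ β, gUpper g he μ β x * (connCoeff cov he σ α τ x * gLower g e β σ x) =
        connCoeff cov he σ α τ x * if μ = σ then 1 else 0 := by
      intro σ
      rw [← sum_gUpper_mul_gLower he g hx, Finset.mul_sum]
      exact Finset.sum_congr rfl fun β _ ↦ by ring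
    simp [this]
  rw [h2]
  simp only [h3, neg_mul, add_mul, Finset.sum_neg_distrib, Finset.sum_add_distrib]
  congr 2
  simp only [Finset.sum_mul]
  rw [Finset.sum_comm]
  refine Finset.sum_congr rfl fun β _ ↦ ?_
  rw [Finset.sum_comm]
  have : ∀ σ, ∑ τ, gUpper g he μ β x * (connCoeff cov he σ α β x * gLower g e σ τ x) *
      gUpper g he τ ν x =
      gUpper g he μ β x * connCoeff cov he σ α β x * if σ = ν then 1 else 0 := by
    intro σ
    rw [← sum_gLower_mul_gUpper he g hx, Finset.mul_sum]
    exact Finset.sum_congr rfl fun β _ ↦ by ring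
  simp only [this]
  simp [mul_comm]

/-! ### Curvature in a frame -/

theorem curvature_antisymm (X Y Z : ∀ x : M, TangentSpace (𝓡 4) x) (x : M) :
    curvature cov X Y Z x = -curvature cov Y X Z x := by
  unfold curvature
  rw [VectorField.mlieBracket_swap_apply, map_neg]
  abel

theorem riemann_antisymm (ρ μ α β : Fin 4) (x : M) :
    riemann cov he ρ μ α β x = -riemann cov he ρ μ β α x := by
  unfold riemann
  rw [curvature_antisymm, map_neg]

variable [T2Space M] [CovariantDerivative.ContMDiffCovariantDerivative cov ∞]

theorem smoothOn_connCoeff (hU : IsOpen U) (g : LorentzMetric M) (μ α β : Fin 4) :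
    SmoothOn U (connCoeff cov he μ α β) :=
  smoothOn_coframe_apply he
    ((smoothFieldOn_frame he β).covDeriv cov hU (smoothFieldOn_frame he α)) μ g

theorem dirDeriv_frame_commutator (htor : cov.torsion = 0) (hU : IsOpen U) {f : M → ℝ}
    (hf : SmoothOn U f) {x : M} (hx : x ∈ U) (α β : Fin 4) :
    dirDeriv (e α) (dirDeriv (e β) f) x - dirDeriv (e β) (dirDeriv (e α) f) x =
      ∑ σ, (connCoeff cov he σ α β x - connCoeff cov he σ β α x) * dirDeriv (e σ) f x := by
  rw [← dirDeriv_mlieBracket htor hU (smoothFieldOn_frame he α) (smoothFieldOn_frame he β)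
    (smoothFieldOn_frame he 0) hf hx (frame_ne_zero he hx 0)]
  change mvfderiv (𝓡 4) f x _ = _
  rw [mlieBracket_frame he htor hU hx]
  simp [dirDeriv]

/-- Differentiate ∇_{e_β} e_ρ = γ^σ_{βρ} e_σ, which holds on all of U, by the Leibniz rule; zero
torsion expresses [e_α, e_β] through the γ's. -/
theorem riemann_eq (htor : cov.torsion = 0) (hU : IsOpen U) (g : LorentzMetric M) {x : M}
    (hx : x ∈ U) (ρ μ α β : Fin 4) :
    riemann cov he ρ μ α β x =
      dirDeriv (e α) (connCoeff cov he μ β ρ) x - dirDeriv (e β) (connCoeff cov he μ α ρ) x +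
      ∑ σ, (connCoeff cov he σ β ρ x * connCoeff cov he μ α σ x -
        connCoeff cov he σ α ρ x * connCoeff cov he μ β σ x -
        (connCoeff cov he σ α β x - connCoeff cov he σ β α x) * connCoeff cov he μ σ ρ x) := by
  have key : ∀ α β, coframe he μ x (cov (fun y ↦ cov (e ρ) y (e β y)) x (e α x)) =
      dirDeriv (e α) (connCoeff cov he μ β ρ) x +
        ∑ σ, connCoeff cov he σ β ρ x * connCoeff cov he μ α σ x := by
    intro α β
    have hs : ∀ σ, SmoothFieldOn U (fun y ↦ connCoeff cov he σ β ρ y • e σ y) := fun σ ↦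
      .smul (smoothOn_connCoeff he hU g σ β ρ) (smoothFieldOn_frame he σ)
    rw [cov_congr cov hU ((smoothFieldOn_frame he ρ).covDeriv cov hU (smoothFieldOn_frame he β))
      (.sum fun σ _ ↦ hs σ) (fun y hy ↦ (sum_connCoeff_smul he cov hy β ρ).symm) hx,
      cov_sum cov hU (fun σ _ ↦ hs σ) hx]
    simp only [cov_smul cov hU (smoothOn_connCoeff he hU g _ β ρ) (smoothFieldOn_frame he _) hx,
      map_sum, map_add, map_smul, coframe_apply_frame he hx, smul_eq_mul, Finset.sum_add_distrib]
    rw [add_comm]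
    congr 1
    simp [dirDeriv]
  unfold riemann curvature
  rw [map_sub, map_sub, key, key, mlieBracket_frame he htor hU hx]
  simp only [map_sum, map_smul, Finset.sum_sub_distrib]
  simp only [connCoeff, smul_eq_mul]
  ring

/-- With zero torsion, the cyclic sum regroups into terms ∇_X(∇_Y Z - ∇_Z Y) - ∇_{[Y,Z]} X = [X, [Y,
Z]], whose sum vanishes by the Jacobi identity. -/
theorem riemann_bianchi (htor : cov.torsion = 0) (hU : IsOpen U) {x : M} (hx : x ∈ U)
    (ρ μ α β : Fin 4) :
    riemann cov he ρ μ α β x + riemann cov he α μ β ρ x + riemann cov he β μ ρ α x = 0 := by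
  have hs := smoothFieldOn_frame he
  have hc : ∀ α β, SmoothFieldOn U (fun y ↦ cov (e β) y (e α y)) := fun α β ↦
    (hs β).covDeriv cov hU (hs α)
  have hb : ∀ α β, SmoothFieldOn U (VectorField.mlieBracket (𝓡 4) (e α) (e β)) := fun α β ↦
    SmoothFieldOn.mlieBracket htor hU (hs α) (hs β)
  have key : ∀ α β ρ, cov (fun y ↦ cov (e ρ) y (e β y)) x (e α x) -
      cov (fun y ↦ cov (e β) y (e ρ y)) x (e α x) -
      cov (e α) x (VectorField.mlieBracket (𝓡 4) (e β) (e ρ) x) =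
        VectorField.mlieBracket (𝓡 4) (e α) (VectorField.mlieBracket (𝓡 4) (e β) (e ρ)) x := by
    intro α β ρ
    rw [mlieBracket_eq_cov htor hU (hs α) (hb β ρ) hx, ← cov_sub cov hU (hc β ρ) (hc ρ β) hx,
      cov_congr cov hU ((hc β ρ).sub (hc ρ β)) (hb β ρ)
        (fun y hy ↦ (mlieBracket_eq_cov htor hU (hs β) (hs ρ) hy).symm) hx]
  have hj := jacobi hU (hs α) (hs β) (hs ρ) hx
  have h1 := key α β ρ
  have h2 := key β ρ α
  have h3 := key ρ α β
  -- Antisymmetry brings the Leibniz form of the Jacobi identity to its cyclic form.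
  rw [VectorField.mlieBracket_swap_apply (V := VectorField.mlieBracket (𝓡 4) (e α) (e β)),
    VectorField.mlieBracket_swap (V := e α) (W := e ρ)] at hj
  have hj' : VectorField.mlieBracket (𝓡 4) (e β)
      (-VectorField.mlieBracket (𝓡 4) (e ρ) (e α)) x =
      -VectorField.mlieBracket (𝓡 4) (e β) (VectorField.mlieBracket (𝓡 4) (e ρ) (e α)) x := by
    have := VectorField.mlieBracket_const_smul_right (V := e β) (c := (-1 : ℝ))
      ((hb ρ α).mdifferentiableAt hU hx)
    simpa using this
  rw [hj'] at hj
  unfold riemann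
  rw [← map_add, ← map_add]
  convert map_zero (coframe he μ x) using 2
  unfold curvature
  rw [← h1, ← h2, ← h3] at hj
  rw [← sub_eq_zero] at hj
  rw [← hj]
  abel

/-- Apply [e_α, e_β] to the function g(e_ρ, e_μ) in two ways. The mixed terms g(∇e_ρ, ∇e_μ) are
symmetric in α and β, so only g(R e_ρ, e_μ) + g(e_ρ, R e_μ) = 0 remains. -/
theorem sum_riemann_mul_gLower_antisymm (he : IsLocalFrameOn (𝓡 4) R4 ∞ e U)
    (hcov : g.IsCompatible cov) (htor : cov.torsion = 0)
    (hU : IsOpen U) {x : M} (hx : x ∈ U) (ρ μ α β : Fin 4) :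
    ∑ ν, gLower g e μ ν x * riemann cov he ρ ν α β x =
      -∑ ν, gLower g e ρ ν x * riemann cov he μ ν α β x := by
  have hs := smoothFieldOn_frame he
  have hc : ∀ α β, SmoothFieldOn U (fun y ↦ cov (e β) y (e α y)) := fun α β ↦
    (hs β).covDeriv cov hU (hs α)
  have low : ∀ ρ μ, ∑ ν, gLower g e μ ν x * riemann cov he ρ ν α β x =
      g.toFun x (curvature cov (e α) (e β) (e ρ) x) (e μ x) := by
    intro ρ μ
    conv_rhs => rw [← sum_coframe_smul he hx (curvature cov (e α) (e β) (e ρ) x)]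
    simp only [map_sum, map_smul, _root_.sum_apply, _root_.smul_apply, smul_eq_mul]
    exact Finset.sum_congr rfl fun ν _ ↦ by rw [gLower_symm, mul_comm]; rfl
  have hcomp : ∀ {X Y : ∀ x : M, TangentSpace (𝓡 4) x}, SmoothFieldOn U X → SmoothFieldOn U Y →
      ∀ Z : ∀ x : M, TangentSpace (𝓡 4) x, ∀ y ∈ U,
      dirDeriv Z (fun y ↦ g.toFun y (X y) (Y y)) y =
        g.toFun y (cov X y (Z y)) (Y y) + g.toFun y (X y) (cov Y y (Z y)) :=
    fun hX hY Z y hy ↦ hcov y (Z y) _ _ (hX.mdifferentiableAt hU hy) (hY.mdifferentiableAt hU hy)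
  have second : ∀ α β, dirDeriv (e α) (dirDeriv (e β) (gLower g e ρ μ)) x =
      g.toFun x (cov (fun y ↦ cov (e ρ) y (e β y)) x (e α x)) (e μ x) +
      g.toFun x (cov (e ρ) x (e β x)) (cov (e μ) x (e α x)) +
      (g.toFun x (cov (e ρ) x (e α x)) (cov (e μ) x (e β x)) +
      g.toFun x (e ρ x) (cov (fun y ↦ cov (e μ) y (e β y)) x (e α x))) := by
    intro α β
    change dirDeriv (e α) (dirDeriv (e β) fun y ↦ g.toFun y (e ρ y) (e μ y)) x = _
    rw [dirDeriv_congr hU (hcomp (hs ρ) (hs μ) (e β)) (e α) hx,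
      dirDeriv_add hU (.metric g (hc β ρ) (hs μ)) (.metric g (hs ρ) (hc β μ)) _ hx,
      hcomp (hc β ρ) (hs μ) _ x hx, hcomp (hs ρ) (hc β μ) _ x hx]
  have hbr := dirDeriv_mlieBracket htor hU (hs α) (hs β) (hs 0) (smoothOn_gLower g he ρ μ) hx
    (frame_ne_zero he hx 0)
  rw [second, second] at hbr
  have h3 := hcomp (hs ρ) (hs μ) (VectorField.mlieBracket (𝓡 4) (e α) (e β)) x hx
  have h4 := h3.symm.trans hbr
  rw [low, low, g.symm x _ (e ρ x)]
  unfold curvature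
  simp only [map_sub, _root_.sub_apply]
  linear_combination -h4

end FrameCalculus

/-! ### Algebraic identities for curvature tensors -/

section CurvatureTensor

variable {ι' : Type*} [Fintype ι'] {E : Type*} [AddCommGroup E] [Module ℝ E]

/-- The algebraic symmetries of a curvature tensor `R_{ρμαβ}`. -/
structure IsCurvatureTensor (R : ι' → ι' → ι' → ι' → ℝ) : Prop where
  antisymm_right (ρ μ α β : ι') : R ρ μ α β = -R ρ μ β α
  antisymm_left (ρ μ α β : ι') : R ρ μ α β = -R μ ρ α β
  bianchi (ρ μ α β : ι') : R ρ μ α β + R α μ β ρ + R β μ ρ α = 0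

theorem IsCurvatureTensor.pair_symm {R : ι' → ι' → ι' → ι' → ℝ} (hR : IsCurvatureTensor R)
    (ρ μ α β : ι') : R ρ μ α β = R α β ρ μ := by
  have b1 := hR.bianchi ρ μ α β
  have b2 := hR.bianchi μ α β ρ
  have b3 := hR.bianchi α β ρ μ
  have b4 := hR.bianchi β ρ μ α
  have l := hR.antisymm_left
  have r := hR.antisymm_right
  -- The classical argument: combine the four Bianchi identities and let the two antisymmetries
  -- cancel everything except the desired pair.
  linarith [l ρ μ α β, l α μ β ρ, l β μ ρ α, l μ α β ρ, l β α ρ μ, l ρ α μ β, l α β ρ μ,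
    l ρ β μ α, l μ β α ρ, l β ρ μ α, l μ ρ α β, l α ρ β μ, r ρ μ α β, r α μ β ρ, r β μ ρ α,
    r μ α β ρ, r β α ρ μ, r ρ α μ β, r α β ρ μ, r ρ β μ α, r μ β α ρ, r β ρ μ α, r μ ρ α β,
    r α ρ β μ]

/-- The total contraction `R_{ρμαβ} F^{ρμαβ}` with vector-valued coefficients. -/
def curvatureSum (R : ι' → ι' → ι' → ι' → ℝ) (F : ι' → ι' → ι' → ι' → E) : E :=
  ∑ ρ, ∑ μ, ∑ α, ∑ β, R ρ μ α β • F ρ μ α β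

variable {R : ι' → ι' → ι' → ι' → ℝ} (F G : ι' → ι' → ι' → ι' → E)

theorem curvatureSum_add :
    curvatureSum R (fun ρ μ α β ↦ F ρ μ α β + G ρ μ α β) = curvatureSum R F + curvatureSum R G := by
  simp only [curvatureSum, smul_add, Finset.sum_add_distrib]

theorem curvatureSum_neg :
    curvatureSum R (fun ρ μ α β ↦ -F ρ μ α β) = -curvatureSum R F := by
  simp only [curvatureSum, smul_neg, Finset.sum_neg_distrib]

theorem curvatureSum_sub :
    curvatureSum R (fun ρ μ α β ↦ F ρ μ α β - G ρ μ α β) = curvatureSum R F - curvatureSum R G := by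
  simp only [curvatureSum, smul_sub, Finset.sum_sub_distrib]

variable {F G} in
theorem curvatureSum_congr (h : ∀ ρ μ α β, F ρ μ α β = G ρ μ α β) :
    curvatureSum R F = curvatureSum R G := by
  simp only [curvatureSum, h]

theorem map_curvatureSum {E' : Type*} [AddCommGroup E'] [Module ℝ E'] (L : E →ₗ[ℝ] E') :
    L (curvatureSum R F) = curvatureSum R (fun ρ μ α β ↦ L (F ρ μ α β)) := by
  simp only [curvatureSum, map_sum, map_smul]

theorem curvatureSum_swap_right (hR : IsCurvatureTensor R) :
    curvatureSum R (fun ρ μ α β ↦ F ρ μ β α) = -curvatureSum R F := by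
  simp only [curvatureSum, ← Finset.sum_neg_distrib]
  refine Finset.sum_congr rfl fun ρ _ ↦ Finset.sum_congr rfl fun μ _ ↦ ?_
  rw [Finset.sum_comm]
  refine Finset.sum_congr rfl fun α _ ↦ Finset.sum_congr rfl fun β _ ↦ ?_
  rw [hR.antisymm_right, neg_smul]

theorem curvatureSum_swap_left (hR : IsCurvatureTensor R) :
    curvatureSum R (fun ρ μ α β ↦ F μ ρ α β) = -curvatureSum R F := by
  simp only [curvatureSum, ← Finset.sum_neg_distrib]
  rw [Finset.sum_comm]
  refine Finset.sum_congr rfl fun ρ _ ↦ Finset.sum_congr rfl fun μ _ ↦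
    Finset.sum_congr rfl fun α _ ↦ Finset.sum_congr rfl fun β _ ↦ ?_
  rw [hR.antisymm_left, neg_smul]

theorem curvatureSum_swap_pair (hR : IsCurvatureTensor R) :
    curvatureSum R (fun ρ μ α β ↦ F α β ρ μ) = curvatureSum R F := by
  have h : ∀ G : ι' → ι' → ι' → ι' → E, ∑ ρ, ∑ μ, ∑ α, ∑ β, G ρ μ α β =
      ∑ p : (ι' × ι') × (ι' × ι'), G p.1.1 p.1.2 p.2.1 p.2.2 := by
    intro G
    simp only [Fintype.sum_prod_type]
  simp only [curvatureSum]
  rw [h, h, ← (Equiv.prodComm (ι' × ι') (ι' × ι')).sum_comp]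
  exact Finset.sum_congr rfl fun p _ ↦ by rw [hR.pair_symm]; rfl

/-- Relabelling the summation indices moves the cyclic permutation from F to R, where the Bianchi
identity applies. -/
theorem curvatureSum_bianchi (hR : IsCurvatureTensor R) :
    curvatureSum R F + curvatureSum R (fun ρ μ α β ↦ F β μ ρ α) +
      curvatureSum R (fun ρ μ α β ↦ F α μ β ρ) = 0 := by
  have h1 : ∀ G : ι' → ι' → ι' → ι' → E, ∑ ρ, ∑ μ, ∑ α, ∑ β, G ρ μ α β =
      ∑ ρ, ∑ μ, ∑ α, ∑ β, G α μ β ρ := by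
    intro G
    rw [Finset.sum_comm]
    conv_rhs => rw [Finset.sum_comm]
    refine Finset.sum_congr rfl fun μ _ ↦ ?_
    conv_rhs => rw [Finset.sum_comm]
    exact Finset.sum_congr rfl fun ρ _ ↦ Finset.sum_comm
  have h2 : curvatureSum R (fun ρ μ α β ↦ F β μ ρ α) =
      ∑ ρ, ∑ μ, ∑ α, ∑ β, R α μ β ρ • F ρ μ α β := by
    rw [curvatureSum, h1]
  have h3 : curvatureSum R (fun ρ μ α β ↦ F α μ β ρ) =
      ∑ ρ, ∑ μ, ∑ α, ∑ β, R β μ ρ α • F ρ μ α β := by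
    rw [curvatureSum, h1, h1]
  rw [h2, h3, curvatureSum]
  simp only [← Finset.sum_add_distrib, ← add_smul, hR.bianchi]
  simp

variable {A : Type*} [Ring A] [Algebra ℝ A] {a i : ι' → A} {h : ι' → ι' → ℝ}

/-- The algebraic form of the identity expressing the Ricci operator through the curvature, for
exterior multiplications `a` and contractions `i`. -/
theorem curvatureSum_ricci_identity (hR : IsCurvatureTensor R) (hh : ∀ α β, h α β = h β α)
    (haa : ∀ α β, a α * a β = -(a β * a α)) (hii : ∀ α β, i α * i β = -(i β * i α))
    (hia : ∀ α β, i α * a β = h α β • (1 : A) - a β * i α) :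
    -((1 / 2 : ℝ) • curvatureSum R (fun ρ μ α β ↦
      ((a α + i α) * (a β + i β) - h α β • (1 : A)) * (a ρ * i μ))) =
      curvatureSum R (fun ρ μ α β ↦ h ρ α • (a β * i μ)) +
        (1 / 2 : ℝ) • curvatureSum R (fun ρ μ α β ↦ a α * a β * (i ρ * i μ)) := by
  -- A product of three anticommuting factors is invariant under cyclic permutation, so Bianchi says
  -- that three times the sum is zero. The same happens in `t2` with three contractions.
  have t1 : curvatureSum R (fun ρ μ α β ↦ a α * a β * a ρ * i μ) = 0 := by
    have b := curvatureSum_bianchi (fun ρ μ α β ↦ a α * a β * a ρ * i μ) hR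
    have e1 : ∀ α β ρ, a ρ * a α * a β = a α * a β * a ρ := by
      intro α β ρ
      rw [haa ρ α, neg_mul, mul_assoc, haa ρ β, mul_neg, neg_neg, mul_assoc]
    have e2 : ∀ α β ρ, a β * a ρ * a α = a α * a β * a ρ := by
      intro α β ρ
      rw [e1 ρ α β, e1]
    have e3 : ∀ ρ μ α β, a ρ * a α * a β * i μ = a α * a β * a ρ * i μ := by
      intro ρ μ α β; rw [e1]
    have e4 : ∀ ρ μ α β, a β * a ρ * a α * i μ = a α * a β * a ρ * i μ := by
      intro ρ μ α β; rw [e2]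
    rw [curvatureSum_congr e3, curvatureSum_congr e4] at b
    have b' : (3 : ℝ) • curvatureSum R (fun ρ μ α β ↦ a α * a β * a ρ * i μ) = 0 := by
      rw [← b]; module
    exact (smul_eq_zero.1 b').resolve_left (by norm_num)
  have t2 : curvatureSum R (fun ρ μ α β ↦ a ρ * i α * i β * i μ) = 0 := by
    have b := curvatureSum_bianchi (fun ρ μ α β ↦ a μ * i α * i β * i ρ) hR
    have e1 : ∀ μ α β ρ, a μ * i ρ * i α * i β = a μ * i α * i β * i ρ := by
      intro μ α β ρ
      rw [mul_assoc (a μ), hii ρ α, mul_neg, neg_mul, mul_assoc, mul_assoc, hii ρ β]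
      noncomm_ring
    have e2 : ∀ μ α β ρ, a μ * i β * i ρ * i α = a μ * i α * i β * i ρ := by
      intro μ α β ρ
      rw [e1 μ ρ α β, e1]
    rw [curvatureSum_congr fun ρ μ α β ↦ e1 μ α β ρ,
      curvatureSum_congr fun ρ μ α β ↦ e2 μ α β ρ] at b
    have b' : (3 : ℝ) • curvatureSum R (fun ρ μ α β ↦ a μ * i α * i β * i ρ) = 0 := by
      rw [← b]; module
    have s := curvatureSum_swap_left (fun ρ μ α β ↦ a ρ * i α * i β * i μ) hR
    rw [(smul_eq_zero.1 b').resolve_left (by norm_num)] at s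
    simpa using s.symm
  -- The trace over ρ and β is the Ricci tensor, symmetric by pair symmetry, against the
  -- antisymmetric product of two contractions.
  have t3 : curvatureSum R (fun ρ μ α β ↦ h β ρ • (i α * i μ)) = 0 := by
    have s1 := curvatureSum_swap_pair (fun ρ μ α β ↦ h β ρ • (i α * i μ)) hR
    have s2 := curvatureSum_swap_left (fun ρ μ α β ↦ h μ α • (i ρ * i β)) hR
    have s3 := curvatureSum_swap_right (fun ρ μ α β ↦ h ρ α • (i μ * i β)) hR
    have e : ∀ ρ μ α β, h ρ β • (i μ * i α) = -(h β ρ • (i α * i μ)) := by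
      intro ρ μ α β
      rw [hh ρ β, hii μ α, smul_neg]
    rw [curvatureSum_congr e, curvatureSum_neg, s2, s1, neg_neg] at s3
    have : (2 : ℝ) • curvatureSum R (fun ρ μ α β ↦ h β ρ • (i α * i μ)) = 0 := by
      rw [two_smul, ← sub_neg_eq_add, s3, sub_self]
    exact (smul_eq_zero.1 this).resolve_left (by norm_num)
  have t4 : curvatureSum R (fun ρ μ α β ↦ h α ρ • (i β * i μ)) = 0 := by
    have s := curvatureSum_swap_right (fun ρ μ α β ↦ h β ρ • (i α * i μ)) hR
    rw [t3] at s
    simpa using s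
  have t5 : curvatureSum R (fun ρ μ α β ↦ h α ρ • (a β * i μ)) =
      -curvatureSum R (fun ρ μ α β ↦ h β ρ • (a α * i μ)) :=
    curvatureSum_swap_right (fun ρ μ α β ↦ h β ρ • (a α * i μ)) hR
  have t6 : curvatureSum R (fun ρ μ α β ↦ a β * a ρ * i α * i μ) =
      -curvatureSum R (fun ρ μ α β ↦ a α * a ρ * i β * i μ) :=
    curvatureSum_swap_right (fun ρ μ α β ↦ a α * a ρ * i β * i μ) hR
  -- Bianchi makes the term whose exterior indices form one curvature pair twice the term in which
  -- the pairs are mixed; the mixed form is what the expansion produces.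
  have t7 : curvatureSum R (fun ρ μ α β ↦ a α * a β * (i ρ * i μ)) =
      (2 : ℝ) • curvatureSum R (fun ρ μ α β ↦ a α * a ρ * i β * i μ) := by
    have b := curvatureSum_bianchi (fun ρ μ α β ↦ a α * a β * (i ρ * i μ)) hR
    have e1 : ∀ ρ μ α β, a ρ * a α * (i β * i μ) = -(a α * a ρ * i β * i μ) := by
      intro ρ μ α β
      rw [haa ρ α]; noncomm_ring
    have e2 : ∀ ρ μ α β, a β * a ρ * (i α * i μ) = a β * a ρ * i α * i μ := by
      intros; noncomm_ring
    rw [curvatureSum_congr e1, curvatureSum_congr e2, curvatureSum_neg, t6] at b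
    rw [← sub_eq_zero, ← b]
    module
  -- Normal ordering: the contractions with indices α and β are moved to the right past the exterior
  -- factor with index ρ.
  have expand : ∀ ρ μ α β, ((a α + i α) * (a β + i β) - h α β • (1 : A)) * (a ρ * i μ) =
      a α * a β * a ρ * i μ + a ρ * i α * i β * i μ + h β ρ • (i α * i μ) - h α ρ • (i β * i μ) +
        (h β ρ • (a α * i μ) - h α ρ • (a β * i μ)) +
        (a β * a ρ * i α * i μ - a α * a ρ * i β * i μ) := by
    intro ρ μ α β
    have e1 : (a α + i α) * (a β + i β) - h α β • (1 : A) =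
        a α * a β + a α * i β - a β * i α + i α * i β := by
      rw [add_mul, mul_add, mul_add, hia α β]; abel
    have e2 : ∀ c β, c * i β * a ρ = h β ρ • c - c * a ρ * i β := by
      intro c β
      rw [mul_assoc, hia β ρ, mul_sub, mul_smul_comm, mul_one, mul_assoc]
    have e3 : i α * i β * a ρ = h β ρ • i α - h α ρ • i β + a ρ * i α * i β := by
      rw [e2, hia α ρ, sub_mul, smul_mul_assoc, one_mul]; abel
    rw [e1, ← mul_assoc]
    simp only [add_mul, sub_mul]
    rw [e2, e2, e3]
    simp only [add_mul, sub_mul, smul_mul_assoc]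
    abel
  simp only [expand]
  simp only [curvatureSum_add, curvatureSum_sub]
  rw [t1, t2, t3, t4, t5, t6, t7]
  have t8 : curvatureSum R (fun ρ μ α β ↦ h ρ α • (a β * i μ)) =
      -curvatureSum R (fun ρ μ α β ↦ h β ρ • (a α * i μ)) := by
    rw [← t5]
    exact curvatureSum_congr fun ρ μ α β ↦ by rw [hh ρ α]
  rw [t8]
  module

/-- The algebraic form of the identity expressing the Einstein operator on `1`-forms through the
Ricci tensor and the scalar curvature. -/
theorem curvatureSum_einstein_identity (hR : IsCurvatureTensor R) (hh : ∀ α β, h α β = h β α)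
    {a i : ι' → Module.End ℝ E} (hia : ∀ α β, i α * a β = h α β • 1 - a β * i α) {v : E}
    (hv : ∀ α, i α v = 0) (κ : ι') :
    (1 / 4 : ℝ) • curvatureSum R (fun ρ μ α β ↦ i α (i β (a ρ (a μ (a κ v))))) =
      curvatureSum R (fun ρ μ α β ↦ (h ρ α * h κ μ) • a β v) -
        (1 / 2 : ℝ) • curvatureSum R (fun ρ μ α β ↦ h ρ α * h μ β) • a κ v := by
  have hia' : ∀ α β w, i α (a β w) = h α β • w - a β (i α w) := fun α β w ↦
    LinearMap.congr_fun (hia α β) w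
  -- The contractions are moved right until they annihilate v, leaving the six full pairings of α
  -- and β with two of ρ, μ, κ.
  have expand : ∀ ρ μ α β, i α (i β (a ρ (a μ (a κ v)))) =
      (h β ρ * h α μ) • a κ v - (h α ρ * h β μ) • a κ v - (h β ρ * h α κ) • a μ v +
        (h β μ * h α κ) • a ρ v + (h α ρ * h β κ) • a μ v - (h α μ * h β κ) • a ρ v := by
    intro ρ μ α β
    simp only [hia', hv, map_sub, map_smul, map_zero]
    module
  -- The symmetries reduce the six sums to two: the scalar curvature term occurs with total
  -- coefficient -2 and the Ricci term with 4, which the factor ¼ turns into -½ and 1.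
  have s1 : curvatureSum R (fun ρ μ α β ↦ (h β ρ * h α μ) • a κ v) =
      -curvatureSum R (fun ρ μ α β ↦ (h α ρ * h β μ) • a κ v) :=
    curvatureSum_swap_right (fun ρ μ α β ↦ (h α ρ * h β μ) • a κ v) hR
  have s2 : curvatureSum R (fun ρ μ α β ↦ (h β ρ * h α κ) • a μ v) =
      -curvatureSum R (fun ρ μ α β ↦ (h α ρ * h β κ) • a μ v) :=
    curvatureSum_swap_right (fun ρ μ α β ↦ (h α ρ * h β κ) • a μ v) hR
  have s3 : curvatureSum R (fun ρ μ α β ↦ (h β μ * h α κ) • a ρ v) =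
      -curvatureSum R (fun ρ μ α β ↦ (h β ρ * h α κ) • a μ v) :=
    curvatureSum_swap_left (fun ρ μ α β ↦ (h β ρ * h α κ) • a μ v) hR
  have s4 : curvatureSum R (fun ρ μ α β ↦ (h α μ * h β κ) • a ρ v) =
      -curvatureSum R (fun ρ μ α β ↦ (h α ρ * h β κ) • a μ v) :=
    curvatureSum_swap_left (fun ρ μ α β ↦ (h α ρ * h β κ) • a μ v) hR
  have s5 : curvatureSum R (fun ρ μ α β ↦ (h α ρ * h β κ) • a μ v) =
      curvatureSum R (fun ρ μ α β ↦ (h ρ α * h κ μ) • a β v) := by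
    rw [← curvatureSum_swap_pair (fun ρ μ α β ↦ (h ρ α * h κ μ) • a β v) hR]
    congr 1
    ext ρ μ α β
    rw [hh κ β]
  have s6 : curvatureSum R (fun ρ μ α β ↦ (h α ρ * h β μ) • a κ v) =
      curvatureSum R (fun ρ μ α β ↦ h ρ α * h μ β) • a κ v := by
    simp only [curvatureSum, Finset.sum_smul, smul_smul, smul_eq_mul]
    refine Finset.sum_congr rfl fun ρ _ ↦ Finset.sum_congr rfl fun μ _ ↦
      Finset.sum_congr rfl fun α _ ↦ Finset.sum_congr rfl fun β _ ↦ ?_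
    rw [hh ρ α, hh μ β]
  simp only [expand, curvatureSum_sub, curvatureSum_add]
  rw [s1, s3, s4, s2, s5, s6]
  module

end CurvatureTensor

/-! ### Derivations of the exterior algebra induced by matrices -/

section FibreDerivation

open CliffordAlgebra

variable {V : Type*} [AddCommGroup V] [Module ℝ V] {Q : QuadraticForm ℝ V}
  {ι' : Type*} [Fintype ι'] [DecidableEq ι']

/-- The derivation `m^σ_ρ θ^ρ ∧ e_σ ⌟` of the exterior algebra. -/
def matrixDerivation (Q : QuadraticForm ℝ V) (d : ι' → Module.Dual ℝ V) (θ : ι' → V)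
    (m : ι' → ι' → ℝ) : Module.End ℝ (CliffordAlgebra Q) :=
  ∑ ρ, ∑ σ, m σ ρ • (extMul Q (θ ρ) * contractLeft (d σ))

variable {d : ι' → Module.Dual ℝ V} {θ : ι' → V}

theorem matrixDerivation_apply (m : ι' → ι' → ℝ) (A : CliffordAlgebra Q) :
    matrixDerivation Q d θ m A = ∑ ρ, ∑ σ, m σ ρ • extMul Q (θ ρ) (contractLeft (d σ) A) := by
  simp [matrixDerivation, LinearMap.sum_apply]

theorem matrixDerivation_add (m m' : ι' → ι' → ℝ) :
    matrixDerivation Q d θ (fun σ ρ ↦ m σ ρ + m' σ ρ) =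
      matrixDerivation Q d θ m + matrixDerivation Q d θ m' := by
  simp only [matrixDerivation, add_smul, Finset.sum_add_distrib]

theorem matrixDerivation_sub (m m' : ι' → ι' → ℝ) :
    matrixDerivation Q d θ (fun σ ρ ↦ m σ ρ - m' σ ρ) =
      matrixDerivation Q d θ m - matrixDerivation Q d θ m' := by
  refine eq_sub_of_add_eq ?_
  rw [← matrixDerivation_add]
  simp

theorem matrixDerivation_sum {J : Type*} (s : Finset J) (c : J → ℝ) (m : J → ι' → ι' → ℝ) :
    matrixDerivation Q d θ (fun σ ρ ↦ ∑ j ∈ s, c j * m j σ ρ) =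
      ∑ j ∈ s, c j • matrixDerivation Q d θ (m j) := by
  simp only [matrixDerivation, Finset.sum_smul, Finset.smul_sum, smul_smul]
  rw [Finset.sum_comm' (t' := Finset.univ) (s' := fun _ ↦ s) (by simp)]
  refine Finset.sum_congr rfl fun ρ _ ↦ ?_
  exact Finset.sum_comm

theorem matrixDerivation_extMul (hdθ : ∀ α β, d α (θ β) = if α = β then 1 else 0)
    (m : ι' → ι' → ℝ) (τ : ι') (A : CliffordAlgebra Q) :
    matrixDerivation Q d θ m (extMul Q (θ τ) A) =
      extMul Q (θ τ) (matrixDerivation Q d θ m A) + ∑ ρ, m τ ρ • extMul Q (θ ρ) A := by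
  simp only [matrixDerivation_apply, contractLeft_extMul, hdθ, map_sum, map_smul, map_sub,
    ← Finset.sum_add_distrib]
  have h : ∀ ρ (B : CliffordAlgebra Q), extMul Q (θ ρ) (extMul Q (θ τ) B) =
      -extMul Q (θ τ) (extMul Q (θ ρ) B) :=
    fun ρ B ↦ LinearMap.congr_fun (extMul_mul_extMul (Q := Q) (θ ρ) (θ τ)) B
  refine Finset.sum_congr rfl fun ρ _ ↦ ?_
  simp only [h, ite_smul, one_smul, zero_smul, sub_neg_eq_add]
  simp only [smul_add]
  rw [Finset.sum_add_distrib]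
  simp [add_comm]

theorem matrixDerivation_contractLeft (hdθ : ∀ α β, d α (θ β) = if α = β then 1 else 0)
    (m : ι' → ι' → ℝ) (κ : ι') (A : CliffordAlgebra Q) :
    matrixDerivation Q d θ m (contractLeft (d κ) A) =
      contractLeft (d κ) (matrixDerivation Q d θ m A) - ∑ σ, m σ κ • contractLeft (d σ) A := by
  simp only [matrixDerivation_apply, contractLeft_extMul, hdθ, map_sum, map_smul, smul_sub,
    Finset.sum_sub_distrib]
  simp only [contractLeft_comm (d := d κ) (d' := d _), map_neg, ite_smul, one_smul, zero_smul,
    smul_ite, smul_zero, smul_neg, Finset.sum_neg_distrib, sub_neg_eq_add]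
  conv_rhs => enter [1, 1]; rw [Finset.sum_comm]
  simp

/-- Commute the first derivation past θ^τ∧ and e_κ⌟ separately. The matrix commutator appears in
reversed order, m'm - mm', with these index conventions; this is why the curvature later enters with
a minus sign. -/
theorem matrixDerivation_commutator (hdθ : ∀ α β, d α (θ β) = if α = β then 1 else 0)
    (m m' : ι' → ι' → ℝ) (A : CliffordAlgebra Q) :
    matrixDerivation Q d θ m (matrixDerivation Q d θ m' A) -
      matrixDerivation Q d θ m' (matrixDerivation Q d θ m A) =
      matrixDerivation Q d θ (fun κ ρ ↦ ∑ τ, (m' κ τ * m τ ρ - m κ τ * m' τ ρ)) A := by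
  have h1 : ∀ τ κ, matrixDerivation Q d θ m (extMul Q (θ τ) (contractLeft (d κ) A)) =
      extMul Q (θ τ) (contractLeft (d κ) (matrixDerivation Q d θ m A)) -
        ∑ σ, m σ κ • extMul Q (θ τ) (contractLeft (d σ) A) +
        ∑ ρ, m τ ρ • extMul Q (θ ρ) (contractLeft (d κ) A) := by
    intro τ κ
    rw [matrixDerivation_extMul hdθ, matrixDerivation_contractLeft hdθ]
    simp only [map_sub, map_sum, map_smul]
  rw [matrixDerivation_apply m' A, matrixDerivation_apply m' (matrixDerivation Q d θ m A)]
  simp only [map_sum, map_smul, h1, smul_add, smul_sub, Finset.sum_add_distrib,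
    Finset.sum_sub_distrib, matrixDerivation_apply, Finset.smul_sum, Finset.sum_smul, sub_smul,
    smul_smul]
  have e1 : ∑ τ, ∑ κ, ∑ ρ, (m' κ τ * m τ ρ) • extMul Q (θ ρ) (contractLeft (d κ) A) =
      ∑ ρ, ∑ κ, ∑ τ, (m' κ τ * m τ ρ) • extMul Q (θ ρ) (contractLeft (d κ) A) := by
    calc _ = ∑ τ, ∑ ρ, ∑ κ, (m' κ τ * m τ ρ) • extMul Q (θ ρ) (contractLeft (d κ) A) :=
          Finset.sum_congr rfl fun _ _ ↦ Finset.sum_comm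
      _ = ∑ ρ, ∑ τ, ∑ κ, (m' κ τ * m τ ρ) • extMul Q (θ ρ) (contractLeft (d κ) A) :=
          Finset.sum_comm
      _ = _ := Finset.sum_congr rfl fun _ _ ↦ Finset.sum_comm
  have e2 : ∑ τ, ∑ κ, ∑ σ, (m' κ τ * m σ κ) • extMul Q (θ τ) (contractLeft (d σ) A) =
      ∑ ρ, ∑ κ, ∑ τ, (m κ τ * m' τ ρ) • extMul Q (θ ρ) (contractLeft (d κ) A) := by
    refine Finset.sum_congr rfl fun ρ _ ↦ ?_
    rw [Finset.sum_comm]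
    simp only [mul_comm]
  rw [e1, e2]
  abel

theorem fibreComponent_one {ι'' : Type*} (d : ι'' → Module.Dual ℝ V) (l : List ι'') :
    fibreComponent d (1 : CliffordAlgebra Q) l = if l = [] then 1 else 0 := by
  cases l with
  | nil => simpa [fibreComponent_nil] using scalarPart_one
  | cons α l => rw [fibreComponent_cons, contractLeft_one, fibreComponent_zero]; simp

end FibreDerivation

/-! ### Covariant differentiation of multiform fields -/

section MultiformCalculus

open CliffordAlgebra

variable {M : Type*} [TopologicalSpace M] [ChartedSpace R4 M] [IsManifold (𝓡 4) ∞ M]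
  {U : Set M} {e : Fin 4 → ∀ x : M, TangentSpace (𝓡 4) x}

/-- Evaluation of covectors on the vectors of the frame. -/
abbrev frameEval (e : Fin 4 → ∀ x : M, TangentSpace (𝓡 4) x) (x : M) (α : Fin 4) :
    Module.Dual ℝ (Module.Dual ℝ (TangentSpace (𝓡 4) x)) :=
  Module.Dual.eval ℝ _ (e α x)

variable (g : LorentzMetric M)

theorem component_eq (A : ∀ x, g.Cl x) (l : List (Fin 4)) (x : M) :
    component g e A l x = fibreComponent (frameEval e x) (A x) l := rfl

variable (he : IsLocalFrameOn (𝓡 4) R4 ∞ e U)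

theorem frameEval_coframe {x : M} (hx : x ∈ U) (α β : Fin 4) :
    frameEval e x α (coframe he β x) = if α = β then 1 else 0 :=
  coframe_apply_frame he hx β α

theorem eq_sum_frameEval {x : M} (hx : x ∈ U) (a : Module.Dual ℝ (TangentSpace (𝓡 4) x)) :
    a = ∑ α, frameEval e x α a • coframe he α x :=
  eq_sum_smul_coframe he hx a

theorem cometric_coframe_eq_sum {x : M} (hx : x ∈ U) (β : Fin 4) :
    g.cometric x (coframe he β x) = ∑ ρ, gUpper g he β ρ x • frameEval e x ρ := by
  refine LinearMap.ext fun a ↦ ?_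
  conv_lhs => rw [eq_sum_smul_coframe he hx a]
  simp [gUpper, mul_comm]

theorem multiform_ext (he : IsLocalFrameOn (𝓡 4) R4 ∞ e U) {x : M} (hx : x ∈ U) {A B : g.Cl x}
    (h : ∀ l, fibreComponent (frameEval e x) A l = fibreComponent (frameEval e x) B l) : A = B :=
  eq_of_fibreComponent_eq _ (eq_sum_frameEval he hx) h

variable {g}

theorem IsSmoothMultiform.congr {A B : ∀ x, g.Cl x} (hA : IsSmoothMultiform g e U A)
    (h : ∀ x ∈ U, B x = A x) : IsSmoothMultiform g e U B := fun l ↦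
  (hA l).congr fun x hx ↦ by rw [component_eq, component_eq, h x hx]

theorem IsSmoothMultiform.add {A B : ∀ x, g.Cl x} (hA : IsSmoothMultiform g e U A)
    (hB : IsSmoothMultiform g e U B) : IsSmoothMultiform g e U (fun x ↦ A x + B x) := fun l ↦
  ((hA l).add (hB l)).congr fun _ _ ↦ fibreComponent_add _ _ _ _

theorem IsSmoothMultiform.sub {A B : ∀ x, g.Cl x} (hA : IsSmoothMultiform g e U A)
    (hB : IsSmoothMultiform g e U B) : IsSmoothMultiform g e U (fun x ↦ A x - B x) := fun l ↦
  (SmoothOn.sub (hA l) (hB l)).congr fun _ _ ↦ fibreComponent_sub _ _ _ _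

theorem IsSmoothMultiform.smul {f : M → ℝ} (hf : SmoothOn U f) {A : ∀ x, g.Cl x}
    (hA : IsSmoothMultiform g e U A) : IsSmoothMultiform g e U (fun x ↦ f x • A x) := fun l ↦
  (SmoothOn.mul hf (hA l)).congr fun _ _ ↦ fibreComponent_smul _ _ _ _

theorem IsSmoothMultiform.sum {J : Type*} {s : Finset J} {A : J → ∀ x, g.Cl x}
    (hA : ∀ j ∈ s, IsSmoothMultiform g e U (A j)) :
    IsSmoothMultiform g e U (fun x ↦ ∑ j ∈ s, A j x) := fun l ↦
  (SmoothOn.sum fun j hj ↦ hA j hj l).congr fun _ _ ↦ fibreComponent_sum _ _ _ _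

theorem IsSmoothMultiform.contractLeft {A : ∀ x, g.Cl x} (hA : IsSmoothMultiform g e U A)
    (α : Fin 4) :
    IsSmoothMultiform g e U (fun x ↦ CliffordAlgebra.contractLeft (frameEval e x α) (A x)) :=
  fun l ↦ hA (α :: l)

theorem component_extMul {x : M} (hx : x ∈ U) (ρ : Fin 4) (A : g.Cl x) (l : List (Fin 4)) :
    fibreComponent (frameEval e x) (extMul _ (coframe he ρ x) A) l =
      ∑ p : Fin l.length, ((-1 : ℝ) ^ (p : ℕ) * (if l.get p = ρ then 1 else 0)) *
        fibreComponent (frameEval e x) A (l.eraseIdx p) := by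
  have h := fibreComponent_extMul _ (frameEval_coframe he hx) ρ A l.get
  simpa only [List.ofFn_get] using h

theorem IsSmoothMultiform.extMul {A : ∀ x, g.Cl x} (hA : IsSmoothMultiform g e U A)
    (ρ : Fin 4) :
    IsSmoothMultiform g e U (fun x ↦ _root_.extMul _ (coframe he ρ x) (A x)) := fun l ↦
  (SmoothOn.sum (s := Finset.univ) (f := fun (p : Fin l.length) x ↦
    ((-1 : ℝ) ^ (p : ℕ) * (if l.get p = ρ then 1 else 0)) * component g e A (l.eraseIdx p) x)
    fun _ _ ↦ .mul contMDiffOn_const (hA _)).congr fun x hx ↦ component_extMul he hx ρ (A x) l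

variable (g) in
-- Components of products of the θ^α are built from Kronecker deltas, hence constant on U:
-- differentiating the components of a multiform does not differentiate the coframe products.
theorem exists_component_wedgeList (l' l : List (Fin 4)) :
    ∃ c : ℝ, ∀ x ∈ U, fibreComponent (frameEval e x)
      (wedgeList (g.cometric x).toQuadraticMap (l'.map fun α ↦ coframe he α x)) l = c := by
  induction l' generalizing l with
  | nil =>
    refine ⟨if l = [] then 1 else 0, fun x _ ↦ ?_⟩
    rw [List.map_nil, wedgeList_nil]
    exact fibreComponent_one _ l
  | cons ρ l' ih =>
    choose c hc using ih
    refine ⟨∑ p : Fin l.length, ((-1 : ℝ) ^ (p : ℕ) * (if l.get p = ρ then 1 else 0)) *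
      c (l.eraseIdx p), fun x hx ↦ ?_⟩
    rw [List.map_cons, wedgeList_cons, ← extMul_apply, component_extMul he hx]
    exact Finset.sum_congr rfl fun p _ ↦ by rw [hc _ x hx]

variable (g) in
/-- The derivative along `e_β` of the components of a multiform field. -/
def frameDeriv (β : Fin 4) (A : ∀ x, g.Cl x) (x : M) : g.Cl x :=
  ∑ r ∈ Finset.range 5, (r.factorial : ℝ)⁻¹ • ∑ a : Fin r → Fin 4,
    dirDeriv (e β) (component g e A (List.ofFn a)) x •
      wedgeList (g.cometric x).toQuadraticMap ((List.ofFn a).map fun α ↦ coframe he α x)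

/-- Differentiate the expansion of A and take components. This is consistent for every index list
because the relations among the components of a multiform have constant coefficients. -/
theorem fibreComponent_frameDeriv (hU : IsOpen U) {A : ∀ x, g.Cl x}
    (hA : IsSmoothMultiform g e U A) (β : Fin 4) (l : List (Fin 4)) {x : M} (hx : x ∈ U) :
    fibreComponent (frameEval e x) (frameDeriv g he β A x) l =
      dirDeriv (e β) (component g e A l) x := by
  choose c hc using fun l' ↦ exists_component_wedgeList g he l' l
  have h1 : ∀ y ∈ U, component g e A l y = ∑ r ∈ Finset.range 5, ∑ a : Fin r → Fin 4,
      ((r.factorial : ℝ)⁻¹ * c (List.ofFn a)) * component g e A (List.ofFn a) y := by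
    intro y hy
    rw [component_eq, fibreComponent_expansion _ (eq_sum_frameEval he hy) (A y)]
    simp only [fibreComponent_sum, fibreComponent_smul, hc _ y hy, Finset.mul_sum, Fintype.card_fin]
    refine Finset.sum_congr rfl fun r _ ↦ Finset.sum_congr rfl fun a _ ↦ ?_
    rw [component_eq]; ring
  have h2 : ∀ r (a : Fin r → Fin 4), SmoothOn U (fun y ↦
      ((r.factorial : ℝ)⁻¹ * c (List.ofFn a)) * component g e A (List.ofFn a) y) :=
    fun r a ↦ .mul contMDiffOn_const (hA _)
  rw [dirDeriv_congr hU h1 _ hx, dirDeriv_sum hU (fun r _ ↦ .sum fun a _ ↦ h2 r a) _ hx, frameDeriv]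
  simp only [fibreComponent_sum, fibreComponent_smul, hc _ x hx, Finset.mul_sum]
  refine Finset.sum_congr rfl fun r _ ↦ ?_
  rw [dirDeriv_sum hU (fun a _ ↦ h2 r a) _ hx]
  refine Finset.sum_congr rfl fun a _ ↦ ?_
  rw [dirDeriv_const_mul hU (hA _) _ _ hx]
  ring

theorem IsSmoothMultiform.frameDeriv (hU : IsOpen U) {A : ∀ x, g.Cl x}
    (hA : IsSmoothMultiform g e U A) (β : Fin 4) :
    IsSmoothMultiform g e U (_root_.frameDeriv g he β A) := fun l ↦
  (SmoothOn.dirDeriv hU (hA l) (smoothFieldOn_frame he β)).congr fun _ hx ↦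
    fibreComponent_frameDeriv he hU hA β l hx

theorem frameDeriv_congr (hU : IsOpen U) {A B : ∀ x, g.Cl x} (h : ∀ x ∈ U, A x = B x) (β : Fin 4)
    {x : M} (hx : x ∈ U) : frameDeriv g he β A x = frameDeriv g he β B x := by
  unfold frameDeriv
  have h1 : ∀ l, dirDeriv (e β) (component g e A l) x = dirDeriv (e β) (component g e B l) x :=
    fun l ↦ dirDeriv_congr hU (fun y hy ↦ by rw [component_eq, component_eq, h y hy]) _ hx
  simp only [h1]

theorem frameDeriv_sub (hU : IsOpen U) {A B : ∀ x, g.Cl x} (hA : IsSmoothMultiform g e U A)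
    (hB : IsSmoothMultiform g e U B) (β : Fin 4) {x : M} (hx : x ∈ U) :
    frameDeriv g he β (fun y ↦ A y - B y) x = frameDeriv g he β A x - frameDeriv g he β B x := by
  refine multiform_ext g he hx fun l ↦ ?_
  rw [fibreComponent_sub, fibreComponent_frameDeriv he hU hA β l hx,
    fibreComponent_frameDeriv he hU hB β l hx, fibreComponent_frameDeriv he hU (hA.sub hB) β l hx,
    ← dirDeriv_sub hU (hA l) (hB l) _ hx]
  exact dirDeriv_congr hU (fun y _ ↦ fibreComponent_sub _ _ _ _) _ hx

theorem frameDeriv_add (hU : IsOpen U) {A B : ∀ x, g.Cl x} (hA : IsSmoothMultiform g e U A)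
    (hB : IsSmoothMultiform g e U B) (β : Fin 4) {x : M} (hx : x ∈ U) :
    frameDeriv g he β (fun y ↦ A y + B y) x = frameDeriv g he β A x + frameDeriv g he β B x := by
  refine multiform_ext g he hx fun l ↦ ?_
  rw [fibreComponent_add, fibreComponent_frameDeriv he hU hA β l hx,
    fibreComponent_frameDeriv he hU hB β l hx, fibreComponent_frameDeriv he hU (hA.add hB) β l hx,
    ← dirDeriv_add hU (hA l) (hB l) _ hx]
  exact dirDeriv_congr hU (fun y _ ↦ fibreComponent_add _ _ _ _) _ hx

theorem frameDeriv_sum (hU : IsOpen U) {J : Type*} {s : Finset J} {A : J → ∀ x, g.Cl x}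
    (hA : ∀ j ∈ s, IsSmoothMultiform g e U (A j)) (β : Fin 4) {x : M} (hx : x ∈ U) :
    frameDeriv g he β (fun y ↦ ∑ j ∈ s, A j y) x = ∑ j ∈ s, frameDeriv g he β (A j) x := by
  refine multiform_ext g he hx fun l ↦ ?_
  rw [fibreComponent_sum, fibreComponent_frameDeriv he hU (.sum hA) β l hx,
    Finset.sum_congr rfl fun j hj ↦ fibreComponent_frameDeriv he hU (hA j hj) β l hx,
    ← dirDeriv_sum hU (fun j hj ↦ hA j hj l) _ hx]
  exact dirDeriv_congr hU (fun y _ ↦ fibreComponent_sum _ _ _ _) _ hx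

theorem frameDeriv_smul (hU : IsOpen U) {f : M → ℝ} (hf : SmoothOn U f) {A : ∀ x, g.Cl x}
    (hA : IsSmoothMultiform g e U A) (β : Fin 4) {x : M} (hx : x ∈ U) :
    frameDeriv g he β (fun y ↦ f y • A y) x =
      dirDeriv (e β) f x • A x + f x • frameDeriv g he β A x := by
  refine multiform_ext g he hx fun l ↦ ?_
  rw [fibreComponent_add, fibreComponent_smul, fibreComponent_smul,
    fibreComponent_frameDeriv he hU hA β l hx, fibreComponent_frameDeriv he hU (.smul hf hA) β l hx]
  refine Eq.trans ?_ (dirDeriv_mul hU hf (hA l) _ hx)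
  exact dirDeriv_congr hU (fun y _ ↦ fibreComponent_smul _ _ _ _) _ hx

theorem frameDeriv_contractLeft (hU : IsOpen U) {A : ∀ x, g.Cl x}
    (hA : IsSmoothMultiform g e U A) (α β : Fin 4) {x : M} (hx : x ∈ U) :
    frameDeriv g he β (fun y ↦ contractLeft (frameEval e y α) (A y)) x =
      contractLeft (frameEval e x α) (frameDeriv g he β A x) := by
  refine multiform_ext g he hx fun l ↦ ?_
  rw [← fibreComponent_cons, fibreComponent_frameDeriv he hU hA β _ hx,
    fibreComponent_frameDeriv he hU (hA.contractLeft α) β l hx]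
  rfl

/-- Exterior multiplication by θ^ρ acts on components with constant coefficients, so it commutes
with differentiating them. -/
theorem frameDeriv_extMul (hU : IsOpen U) {A : ∀ x, g.Cl x}
    (hA : IsSmoothMultiform g e U A) (ρ β : Fin 4) {x : M} (hx : x ∈ U) :
    frameDeriv g he β (fun y ↦ extMul _ (coframe he ρ y) (A y)) x =
      extMul _ (coframe he ρ x) (frameDeriv g he β A x) := by
  refine multiform_ext g he hx fun l ↦ ?_
  rw [component_extMul he hx, fibreComponent_frameDeriv he hU (hA.extMul he ρ) β l hx]
  refine (dirDeriv_congr hU (fun y hy ↦ component_extMul he hy ρ (A y) l) _ hx).trans ?_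
  refine (dirDeriv_sum hU (fun p _ ↦ .mul contMDiffOn_const (hA _)) _ hx).trans ?_
  refine Finset.sum_congr rfl fun p _ ↦ ?_
  rw [fibreComponent_frameDeriv he hU hA β _ hx]
  exact dirDeriv_const_mul hU (hA _) _ _ hx

variable (cov : CovariantDerivative (𝓡 4) R4 (TangentSpace (𝓡 4) : M → Type _))

variable (g) in
/-- The algebraic part `γ^σ_{βρ} θ^ρ ∧ e_σ ⌟` of the covariant derivative. -/
def connDerivation (β : Fin 4) (x : M) : Module.End ℝ (g.Cl x) :=
  matrixDerivation _ (frameEval e x) (fun α ↦ coframe he α x) fun σ ρ ↦ connCoeff cov he σ β ρ x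

theorem fibreComponent_connDerivation {x : M} (hx : x ∈ U) (β : Fin 4) (A : g.Cl x)
    (l : List (Fin 4)) :
    fibreComponent (frameEval e x) (connDerivation g he cov β x A) l =
      ∑ i : Fin l.length, ∑ σ, connCoeff cov he σ β (l.get i) x *
        fibreComponent (frameEval e x) A (l.set i σ) := by
  rw [connDerivation, matrixDerivation_apply]
  exact fibreComponent_derivation _ (frameEval_coframe he hx) _ A l

/-- The splitting ∇_β = ∂_β - Γ_β into a derivative of components and an algebraic derivation, which
turns computations with ∇ into commutator algebra. -/
theorem covMultiform_eq {x : M} (hx : x ∈ U) (A : ∀ x, g.Cl x) (β : Fin 4) :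
    covMultiform g cov he β A x = frameDeriv g he β A x - connDerivation g he cov β x (A x) := by
  rw [fibreComponent_expansion _ (eq_sum_frameEval he hx) (connDerivation g he cov β x (A x))]
  simp only [fibreComponent_connDerivation he cov hx, Fintype.card_fin]
  simp only [frameDeriv, covMultiform, ← Finset.sum_sub_distrib, ← smul_sub, ← sub_smul]
  rfl

theorem covMultiform_congr (hU : IsOpen U) {A B : ∀ x, g.Cl x} (h : ∀ x ∈ U, A x = B x)
    (β : Fin 4) {x : M} (hx : x ∈ U) :
    covMultiform g cov he β A x = covMultiform g cov he β B x := by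
  rw [covMultiform_eq he cov hx, covMultiform_eq he cov hx, frameDeriv_congr he hU h β hx, h x hx]

theorem fibreComponent_covMultiform (hU : IsOpen U) {A : ∀ x, g.Cl x}
    (hA : IsSmoothMultiform g e U A) (β : Fin 4) (l : List (Fin 4)) {x : M} (hx : x ∈ U) :
    fibreComponent (frameEval e x) (covMultiform g cov he β A x) l =
      covComponent cov he (component g e A) β l x := by
  rw [covMultiform_eq he cov hx, fibreComponent_sub, fibreComponent_frameDeriv he hU hA β l hx,
    fibreComponent_connDerivation he cov hx]
  rfl

variable {cov} [T2Space M] [CovariantDerivative.ContMDiffCovariantDerivative cov ∞]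

theorem IsSmoothMultiform.connDerivation (hU : IsOpen U) {A : ∀ x, g.Cl x}
    (hA : IsSmoothMultiform g e U A) (β : Fin 4) :
    IsSmoothMultiform g e U (fun x ↦ _root_.connDerivation g he cov β x (A x)) := by
  simp only [_root_.connDerivation, matrixDerivation_apply]
  exact .sum fun ρ _ ↦ .sum fun σ _ ↦
    .smul (smoothOn_connCoeff he hU g σ β ρ) ((hA.contractLeft σ).extMul he ρ)

theorem IsSmoothMultiform.covMultiform (hU : IsOpen U) {A : ∀ x, g.Cl x}
    (hA : IsSmoothMultiform g e U A) (β : Fin 4) :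
    IsSmoothMultiform g e U (_root_.covMultiform g cov he β A) :=
  ((hA.frameDeriv he hU β).sub (hA.connDerivation he hU β)).congr fun _ hx ↦
    covMultiform_eq he cov hx A β

set_option maxHeartbeats 1000000 in
theorem frameDeriv_connDerivation (hU : IsOpen U) {A : ∀ x, g.Cl x}
    (hA : IsSmoothMultiform g e U A) (α β : Fin 4) {x : M} (hx : x ∈ U) :
    frameDeriv g he α (fun y ↦ connDerivation g he cov β y (A y)) x =
      matrixDerivation _ (frameEval e x) (fun α ↦ coframe he α x)
        (fun σ ρ ↦ dirDeriv (e α) (connCoeff cov he σ β ρ) x) (A x) +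
      connDerivation g he cov β x (frameDeriv g he α A x) := by
  have hs : ∀ ρ σ, IsSmoothMultiform g e U
      (fun y ↦ extMul _ (coframe he ρ y) (contractLeft (frameEval e y σ) (A y))) :=
    fun ρ σ ↦ (hA.contractLeft σ).extMul he ρ
  have hs' : ∀ ρ σ, IsSmoothMultiform g e U (fun y ↦ connCoeff cov he σ β ρ y •
      extMul _ (coframe he ρ y) (contractLeft (frameEval e y σ) (A y))) :=
    fun ρ σ ↦ .smul (smoothOn_connCoeff he hU g σ β ρ) (hs ρ σ)
  simp only [connDerivation, matrixDerivation_apply]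
  rw [frameDeriv_sum he hU (fun ρ _ ↦ .sum fun σ _ ↦ hs' ρ σ) α hx, ← Finset.sum_add_distrib]
  refine Finset.sum_congr rfl fun ρ _ ↦ ?_
  rw [frameDeriv_sum he hU (fun σ _ ↦ hs' ρ σ) α hx, ← Finset.sum_add_distrib]
  refine Finset.sum_congr rfl fun σ _ ↦ ?_
  rw [frameDeriv_smul he hU (smoothOn_connCoeff he hU g σ β ρ) (hs ρ σ) α hx,
    frameDeriv_extMul he hU (hA.contractLeft σ) ρ α hx, frameDeriv_contractLeft he hU hA σ α hx]

theorem frameDeriv_commutator (htor : cov.torsion = 0) (hU : IsOpen U) {A : ∀ x, g.Cl x}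
    (hA : IsSmoothMultiform g e U A) (α β : Fin 4) {x : M} (hx : x ∈ U) :
    frameDeriv g he α (frameDeriv g he β A) x - frameDeriv g he β (frameDeriv g he α A) x =
      ∑ σ, (connCoeff cov he σ α β x - connCoeff cov he σ β α x) • frameDeriv g he σ A x := by
  refine multiform_ext g he hx fun l ↦ ?_
  have h : ∀ α β, fibreComponent (frameEval e x) (frameDeriv g he α (frameDeriv g he β A) x) l =
      dirDeriv (e α) (dirDeriv (e β) (component g e A l)) x := fun α β ↦ by
    rw [fibreComponent_frameDeriv he hU (hA.frameDeriv he hU β) α l hx]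
    exact dirDeriv_congr hU (fun y hy ↦ fibreComponent_frameDeriv he hU hA β l hy) _ hx
  rw [fibreComponent_sub, h, h, dirDeriv_frame_commutator he htor hU (hA l) hx, fibreComponent_sum]
  simp only [fibreComponent_smul, fibreComponent_frameDeriv he hU hA _ l hx]

/-- The commutator of ∂_α - Γ_α and ∂_β - Γ_β is [∂_α, ∂_β] - (∂_αΓ_β - ∂_βΓ_α) + [Γ_α, Γ_β]. By
`riemann_eq` the algebraic part is the curvature derivation, negative because it acts on covectors,
while [∂_α, ∂_β] is accounted for by the correction terms. -/
theorem covMultiform_commutator (htor : cov.torsion = 0) (hU : IsOpen U) {A : ∀ x, g.Cl x}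
    (hA : IsSmoothMultiform g e U A) (α β : Fin 4) {x : M} (hx : x ∈ U) :
    covMultiform g cov he α (covMultiform g cov he β A) x -
        covMultiform g cov he β (covMultiform g cov he α A) x -
        ∑ σ, (connCoeff cov he σ α β x - connCoeff cov he σ β α x) • covMultiform g cov he σ A x =
      -matrixDerivation _ (frameEval e x) (fun α ↦ coframe he α x)
        (fun μ ρ ↦ riemann cov he ρ μ α β x) (A x) := by
  have h : ∀ α β, covMultiform g cov he α (covMultiform g cov he β A) x =
      frameDeriv g he α (frameDeriv g he β A) x -
      (matrixDerivation _ (frameEval e x) (fun α ↦ coframe he α x)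
        (fun σ ρ ↦ dirDeriv (e α) (connCoeff cov he σ β ρ) x) (A x) +
      connDerivation g he cov β x (frameDeriv g he α A x)) -
      connDerivation g he cov α x (frameDeriv g he β A x - connDerivation g he cov β x (A x)) := by
    intro α β
    rw [covMultiform_eq he cov hx, covMultiform_eq he cov hx,
      frameDeriv_congr he hU (fun y hy ↦ covMultiform_eq he cov hy A β) α hx,
      frameDeriv_sub he hU (hA.frameDeriv he hU β) (hA.connDerivation he hU β) α hx,
      frameDeriv_connDerivation he hU hA α β hx]
  have hcomm := frameDeriv_commutator he htor hU hA α β hx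
  have hconn := matrixDerivation_commutator (Q := (g.cometric x).toQuadraticMap)
    (frameEval_coframe he hx)
    (fun σ ρ ↦ connCoeff cov he σ α ρ x) (fun σ ρ ↦ connCoeff cov he σ β ρ x) (A x)
  have hR : matrixDerivation (g.cometric x).toQuadraticMap (frameEval e x)
      (fun α ↦ coframe he α x) (fun μ ρ ↦ riemann cov he ρ μ α β x) =
      matrixDerivation _ (frameEval e x) (fun α ↦ coframe he α x)
        (fun σ ρ ↦ dirDeriv (e α) (connCoeff cov he σ β ρ) x) -
      matrixDerivation _ (frameEval e x) (fun α ↦ coframe he α x)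
        (fun σ ρ ↦ dirDeriv (e β) (connCoeff cov he σ α ρ) x) -
      matrixDerivation _ (frameEval e x) (fun α ↦ coframe he α x)
        (fun κ ρ ↦ ∑ τ, (connCoeff cov he κ β τ x * connCoeff cov he τ α ρ x -
          connCoeff cov he κ α τ x * connCoeff cov he τ β ρ x)) -
      ∑ σ, (connCoeff cov he σ α β x - connCoeff cov he σ β α x) •
        connDerivation g he cov σ x := by
    simp only [connDerivation]
    rw [← matrixDerivation_sum, ← matrixDerivation_sub, ← matrixDerivation_sub,
      ← matrixDerivation_sub]
    congr 1
    ext μ ρ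
    rw [riemann_eq he htor hU g hx]
    simp only [Finset.sum_sub_distrib, mul_comm]
    ring
  simp only [covMultiform_eq he cov hx A, smul_sub, Finset.sum_sub_distrib]
  rw [h, h, hR, ← hcomm]
  simp only [LinearMap.sub_apply, LinearMap.sum_apply, LinearMap.smul_apply, ← hconn, map_sub]
  simp only [connDerivation]
  abel

set_option maxHeartbeats 1000000 in
-- The Leibniz rule with ∇_α θ^β = -γ^β_{αρ} θ^ρ. Clifford multiplication by θ^β is θ^β∧ + g^{βρ}
-- e_ρ⌟; metric compatibility is needed exactly to differentiate g^{βρ}.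
theorem covMultiform_oneForm_mul (hcov : g.IsCompatible cov) (hU : IsOpen U) {A : ∀ x, g.Cl x}
    (hA : IsSmoothMultiform g e U A) (α β : Fin 4) {x : M} (hx : x ∈ U) :
    covMultiform g cov he α (fun y ↦ g.oneForm y (coframe he β y) * A y) x =
      g.oneForm x (coframe he β x) * covMultiform g cov he α A x -
        ∑ ρ, connCoeff cov he β α ρ x • (g.oneForm x (coframe he ρ x) * A x) := by
  have hmul : ∀ y ∈ U, ∀ β (B : g.Cl y), g.oneForm y (coframe he β y) * B =
      extMul _ (coframe he β y) B +
        ∑ ρ, gUpper g he β ρ y • contractLeft (frameEval e y ρ) B := by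
    intro y hy β B
    rw [ι_mul_eq (g.cometric_symm y), cometric_coframe_eq_sum g he hy, map_sum, LinearMap.sum_apply]
    simp only [map_smul, LinearMap.smul_apply]
    rfl
  have hs1 := hA.extMul he β
  have hs2 : ∀ ρ, IsSmoothMultiform g e U
      (fun y ↦ gUpper g he β ρ y • contractLeft (frameEval e y ρ) (A y)) :=
    fun ρ ↦ .smul (smoothOn_gUpper he g β ρ) (hA.contractLeft ρ)
  rw [covMultiform_congr he cov hU (fun y hy ↦ hmul y hy β (A y)) α hx, covMultiform_eq he cov hx,
    covMultiform_eq he cov hx, frameDeriv_add he hU hs1 (.sum fun ρ _ ↦ hs2 ρ) α hx,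
    frameDeriv_extMul he hU hA β α hx, frameDeriv_sum he hU (fun ρ _ ↦ hs2 ρ) α hx,
    hmul x hx]
  simp only [frameDeriv_smul he hU (smoothOn_gUpper he g β _) (hA.contractLeft _) α hx,
    frameDeriv_contractLeft he hU hA _ α hx, dirDeriv_gUpper he g hcov hU hx, hmul x hx]
  simp only [connDerivation, map_add, map_sub, map_sum, map_smul,
    matrixDerivation_extMul (frameEval_coframe he hx),
    matrixDerivation_contractLeft (frameEval_coframe he hx)]
  simp only [smul_add, smul_sub, neg_smul, Finset.sum_add_distrib, Finset.sum_sub_distrib,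
    Finset.sum_neg_distrib, add_smul, Finset.sum_smul, Finset.smul_sum, smul_smul]
  have e1 : ∑ τ, ∑ σ, (connCoeff cov he β α σ x * gUpper g he σ τ x) •
      contractLeft (frameEval e x τ) (A x) =
      ∑ σ, ∑ τ, (connCoeff cov he β α σ x * gUpper g he σ τ x) •
        contractLeft (frameEval e x τ) (A x) := Finset.sum_comm
  have e2 : ∑ τ, ∑ σ, (connCoeff cov he τ α σ x * gUpper g he β σ x) •
      contractLeft (frameEval e x τ) (A x) =
      ∑ σ, ∑ τ, (gUpper g he β σ x * connCoeff cov he τ α σ x) •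
        contractLeft (frameEval e x τ) (A x) := by
    rw [Finset.sum_comm]
    simp only [mul_comm]
  rw [e1, e2]
  abel

end MultiformCalculus

/-! ### The Ricci operator in terms of curvature -/

section RicciOperator

open CliffordAlgebra

theorem sum_comm_cycle {E J : Type*} [AddCommMonoid E] [Fintype J] (f : J → J → J → E) :
    ∑ μ, ∑ α, ∑ β, f μ α β = ∑ α, ∑ β, ∑ μ, f μ α β := by
  rw [Finset.sum_comm]
  exact Finset.sum_congr rfl fun _ _ ↦ Finset.sum_comm

variable {M : Type*} [TopologicalSpace M] [ChartedSpace R4 M] [IsManifold (𝓡 4) ∞ M]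
  (g : LorentzMetric M)
  (cov : CovariantDerivative (𝓡 4) R4 (TangentSpace (𝓡 4) : M → Type _))
  {U : Set M} {e : Fin 4 → ∀ x : M, TangentSpace (𝓡 4) x}
  (he : IsLocalFrameOn (𝓡 4) R4 ∞ e U)

/-- The components `R_{ρμαβ} = g_{μν} R_ρ{}^ν{}_{αβ}` of the curvature. -/
def riemannLower (x : M) (ρ μ α β : Fin 4) : ℝ :=
  ∑ ν, gLower g e μ ν x * riemann cov he ρ ν α β x

/-- Exterior multiplication by `θ^α`. -/
abbrev coframeExt (x : M) (α : Fin 4) : Module.End ℝ (g.Cl x) := extMul _ (coframe he α x)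

/-- Contraction with `θ^α`. -/
abbrev coframeContract (x : M) (α : Fin 4) : Module.End ℝ (g.Cl x) :=
  contractLeft (g.cometric x (coframe he α x))

/-- Contraction with `e_α`. -/
abbrev frameContract (e : Fin 4 → ∀ x : M, TangentSpace (𝓡 4) x) (x : M) (α : Fin 4) :
    Module.End ℝ (g.Cl x) :=
  contractLeft (frameEval e x α)

theorem coframeContract_eq_sum {x : M} (hx : x ∈ U) (β : Fin 4) :
    coframeContract g he x β = ∑ ρ, gUpper g he β ρ x • frameContract g e x ρ := by
  rw [coframeContract, cometric_coframe_eq_sum g he hx, map_sum]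
  simp only [map_smul]

theorem sum_smul_map_frameContract {x : M} (hx : x ∈ U) {E : Type*} [AddCommGroup E] [Module ℝ E]
    (L : g.Cl x →ₗ[ℝ] E) (μ : Fin 4) (A : g.Cl x) :
    ∑ ν, gUpper g he μ ν x • L (frameContract g e x ν A) = L (coframeContract g he x μ A) := by
  rw [coframeContract_eq_sum g he hx, LinearMap.sum_apply, map_sum]
  exact Finset.sum_congr rfl fun ν _ ↦ (map_smul L _ _).symm

theorem curvatureSum_apply {ι' : Type*} [Fintype ι'] {R : ι' → ι' → ι' → ι' → ℝ} {E : Type*}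
    [AddCommGroup E] [Module ℝ E] (F : ι' → ι' → ι' → ι' → Module.End ℝ E) (v : E) :
    curvatureSum R F v = curvatureSum R (fun ρ μ α β ↦ F ρ μ α β v) :=
  map_curvatureSum F (LinearMap.applyₗ v)

theorem riemann_eq_sum_riemannLower {x : M} (hx : x ∈ U) (ρ μ α β : Fin 4) :
    riemann cov he ρ μ α β x = ∑ ν, gUpper g he μ ν x * riemannLower g cov he x ρ ν α β := by
  simp only [riemannLower, Finset.mul_sum, ← mul_assoc]
  rw [Finset.sum_comm]
  simp only [← Finset.sum_mul, sum_gUpper_mul_gLower he g hx]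
  simp

/-- Transfers the raised index of R_ρ^μ_{αβ} to the coefficient F, so that the identities for a
fully lowered curvature tensor apply. Inside F, the contraction e_ν⌟ then becomes θ^μ⌟ by
`sum_smul_map_frameContract`. -/
theorem sum_riemann_smul {E : Type*} [AddCommGroup E] [Module ℝ E] {x : M} (hx : x ∈ U)
    (F : Fin 4 → Fin 4 → Fin 4 → Fin 4 → E) :
    ∑ ρ, ∑ μ, ∑ α, ∑ β, riemann cov he ρ μ α β x • F ρ μ α β =
      curvatureSum (riemannLower g cov he x)
        (fun ρ μ α β ↦ ∑ ν, gUpper g he μ ν x • F ρ ν α β) := by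
  rw [curvatureSum]
  refine Finset.sum_congr rfl fun ρ _ ↦ ?_
  refine (sum_comm_cycle _).trans (Eq.trans ?_ (sum_comm_cycle _).symm)
  refine Finset.sum_congr rfl fun α _ ↦ Finset.sum_congr rfl fun β _ ↦ ?_
  simp only [riemann_eq_sum_riemannLower g cov he hx, Finset.sum_smul, Finset.smul_sum, smul_smul]
  rw [Finset.sum_comm]
  refine Finset.sum_congr rfl fun μ _ ↦ Finset.sum_congr rfl fun ν _ ↦ ?_
  rw [gUpper_symm he g, mul_comm]

variable {cov}

theorem isCurvatureTensor_riemannLower [T2Space M]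
    [CovariantDerivative.ContMDiffCovariantDerivative cov ∞] (hcov : g.IsCompatible cov)
    (htor : cov.torsion = 0) (hU : IsOpen U) {x : M} (hx : x ∈ U) :
    IsCurvatureTensor (riemannLower g cov he x) where
  antisymm_right ρ μ α β := by
    simp only [riemannLower, ← Finset.sum_neg_distrib]
    exact Finset.sum_congr rfl fun ν _ ↦ by rw [riemann_antisymm he, mul_neg]
  antisymm_left ρ μ α β := sum_riemann_mul_gLower_antisymm g he hcov htor hU hx ρ μ α β
  bianchi ρ μ α β := by
    simp only [riemannLower, ← Finset.sum_add_distrib, ← mul_add, riemann_bianchi he htor hU hx]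
    simp

variable (cov)

theorem wedge_curvatureForm (x : M) (ρ μ : Fin 4) (A : g.Cl x) :
    wedge (curvatureForm g cov he ρ μ x) A = (1 / 2 : ℝ) • ∑ α, ∑ β,
      riemann cov he ρ μ α β x • (coframeExt g he x α * coframeExt g he x β) A := by
  rw [← wedgeBilin_apply, curvatureForm]
  simp only [map_smul, map_sum, LinearMap.smul_apply, LinearMap.sum_apply]
  simp only [wedgeBilin_apply, coframeWedge, wedge_assoc]
  rfl

theorem contract_coframeLower {x : M} (hx : x ∈ U) (σ : Fin 4) (A : g.Cl x) :
    g.contract (coframeLower g he σ x) A = frameContract g e x σ A := by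
  rw [LorentzMetric.contract, cometric_coframeLower_eq_eval he g hx]

theorem curvatureOperator_eq {x : M} (hx : x ∈ U) (A : g.Cl x) :
    curvatureOperator g cov he x A = ((1 / 2 : ℝ) • curvatureSum (riemannLower g cov he x)
      (fun ρ μ α β ↦ coframeExt g he x α * coframeExt g he x β *
        (coframeContract g he x ρ * coframeContract g he x μ))) A := by
  have h1 : ∀ ρ σ, wedge (curvatureFormUpper g cov he ρ σ x)
      (g.contract (coframeLower g he ρ x) (g.contract (coframeLower g he σ x) A)) =
      ∑ μ, wedge (curvatureForm g cov he μ σ x)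
        (gUpper g he ρ μ x • frameContract g e x ρ (frameContract g e x σ A)) := by
    intro ρ σ
    rw [contract_coframeLower g he hx, contract_coframeLower g he hx, ← wedgeBilin_apply,
      curvatureFormUpper]
    simp only [map_smul, map_sum, LinearMap.smul_apply, LinearMap.sum_apply]
    simp only [wedgeBilin_apply, wedge_smul]
  have h2 : ∀ σ, ∑ ρ, ∑ μ, wedge (curvatureForm g cov he μ σ x)
        (gUpper g he ρ μ x • frameContract g e x ρ (frameContract g e x σ A)) =
      ∑ μ, wedge (curvatureForm g cov he μ σ x)
        (coframeContract g he x μ (frameContract g e x σ A)) := by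
    intro σ
    rw [Finset.sum_comm]
    refine Finset.sum_congr rfl fun μ _ ↦ ?_
    rw [← wedge_sum, coframeContract_eq_sum g he hx]
    simp only [LinearMap.sum_apply, LinearMap.smul_apply, gUpper_symm he g _ μ]
  rw [curvatureOperator]
  simp only [h1]
  rw [Finset.sum_comm]
  simp only [h2]
  rw [Finset.sum_comm]
  simp only [wedge_curvatureForm, ← Finset.smul_sum]
  rw [LinearMap.smul_apply, curvatureSum_apply]
  refine congrArg ((1 / 2 : ℝ) • ·) ((sum_riemann_smul g cov he hx (fun ρ μ α β ↦
    (coframeExt g he x α * coframeExt g he x β)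
      (coframeContract g he x ρ (frameContract g e x μ A)))).trans ?_)
  exact curvatureSum_congr fun ρ μ α β ↦ sum_smul_map_frameContract g he hx
    (coframeExt g he x α * coframeExt g he x β * coframeContract g he x ρ) μ A

theorem sum_wedge_ricciForm_contract {x : M} (hx : x ∈ U) (A : g.Cl x) :
    ∑ σ, wedge (ricciForm g cov he σ x) (g.contract (coframeLower g he σ x) A) =
      (curvatureSum (riemannLower g cov he x) (fun ρ μ α β ↦
        gUpper g he ρ α x • (coframeExt g he x β * coframeContract g he x μ))) A := by
  have h1 : ∀ σ, wedge (ricciForm g cov he σ x) (g.contract (coframeLower g he σ x) A) =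
      ∑ ρ, ∑ α, ∑ β, riemann cov he ρ σ α β x • gUpper g he ρ α x •
        coframeExt g he x β (frameContract g e x σ A) := by
    intro σ
    rw [contract_coframeLower g he hx, ← wedgeBilin_apply, ricciForm]
    simp only [map_smul, map_sum, LinearMap.smul_apply, LinearMap.sum_apply, ricciTensor,
      Finset.sum_smul, smul_smul]
    rw [sum_comm_cycle]
    simp only [mul_comm]
    rfl
  simp only [h1]
  rw [Finset.sum_comm, sum_riemann_smul g cov he hx (fun ρ μ α β ↦ gUpper g he ρ α x •
    coframeExt g he x β (frameContract g e x μ A)), curvatureSum_apply]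
  exact curvatureSum_congr fun ρ μ α β ↦ sum_smul_map_frameContract g he hx
    (gUpper g he ρ α x • coframeExt g he x β) μ A

/-- Since θ^α∧θ^β = θ^αθ^β - g^{αβ}, Clifford multiplication by the 2-form is a product of two
operators θ∧ + θ⌟ minus a scalar. -/
theorem coframeWedge_mul (x : M) (α β : Fin 4) (A : g.Cl x) :
    coframeWedge g he α β x * A = ((coframeExt g he x α + coframeContract g he x α) *
      (coframeExt g he x β + coframeContract g he x β) - gUpper g he α β x • 1) A := by
  have h : ∀ α (B : g.Cl x), (coframeExt g he x α + coframeContract g he x α) B =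
      g.oneForm x (coframe he α x) * B := fun α B ↦ (ι_mul_eq (g.cometric_symm x) _ B).symm
  have h2 : coframeWedge g he α β x = g.oneForm x (coframe he α x) * g.oneForm x (coframe he β x) -
      algebraMap ℝ _ (gUpper g he α β x) := by
    rw [ι_mul_eq (g.cometric_symm x), contractLeft_ι, coframeWedge, gUpper, add_sub_cancel_right]
  rw [LinearMap.sub_apply, Module.End.mul_apply, h, h, h2, sub_mul, mul_assoc,
    Algebra.algebraMap_eq_smul_one, smul_one_mul]
  rfl

theorem coframeWedge_antisymm (x : M) (α β : Fin 4) :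
    coframeWedge g he α β x = -coframeWedge g he β α x := by
  have h := LinearMap.congr_fun (extMul_mul_extMul (Q := (g.cometric x).toQuadraticMap)
    (coframe he α x) (coframe he β x)) 1
  have h1 : ∀ α β, (coframeExt g he x α * coframeExt g he x β) 1 = coframeWedge g he α β x := by
    intro α β
    rw [Module.End.mul_apply, coframeExt, coframeExt, extMul_apply, extMul_apply, coframeWedge]
    congr 1
    have := ι_mul_eq (g.cometric_symm x) (coframe he β x) 1
    rwa [mul_one, contractLeft_one, add_zero, eq_comm] at this
  rw [← h1, ← h1, h]
  rfl

variable {cov} [T2Space M] [CovariantDerivative.ContMDiffCovariantDerivative cov ∞]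

theorem ricciOperator_eq_half_sum (htor : cov.torsion = 0) (hU : IsOpen U) {A : ∀ x, g.Cl x}
    (hA : IsSmoothMultiform g e U A) {x : M} (hx : x ∈ U) :
    ricciOperator g cov he A x = -((1 / 2 : ℝ) • ∑ α, ∑ β, coframeWedge g he α β x *
      ∑ ρ, ∑ μ, riemann cov he ρ μ α β x •
        (coframeExt g he x ρ * frameContract g e x μ) (A x)) := by
  -- Pairing with the antisymmetric 2-form only sees the antisymmetric part of T, which for the
  -- second derivatives is the commutator.
  have h1 : ∀ T : Fin 4 → Fin 4 → g.Cl x, ∑ α, ∑ β, coframeWedge g he α β x * T α β =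
      (1 / 2 : ℝ) • ∑ α, ∑ β, coframeWedge g he α β x * (T α β - T β α) := by
    intro T
    have h2 : ∑ α, ∑ β, coframeWedge g he α β x * T β α =
        -∑ α, ∑ β, coframeWedge g he α β x * T α β := by
      rw [Finset.sum_comm]
      simp only [← Finset.sum_neg_distrib]
      refine Finset.sum_congr rfl fun α _ ↦ Finset.sum_congr rfl fun β _ ↦ ?_
      rw [coframeWedge_antisymm, neg_mul]
    simp only [mul_sub, Finset.sum_sub_distrib]
    rw [h2]
    module
  rw [ricciOperator, h1, ← smul_neg, ← Finset.sum_neg_distrib]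
  congr 1
  refine Finset.sum_congr rfl fun α _ ↦ ?_
  rw [← Finset.sum_neg_distrib]
  refine Finset.sum_congr rfl fun β _ ↦ ?_
  rw [← mul_neg]
  congr 1
  have h3 := covMultiform_commutator he htor hU hA α β hx
  rw [matrixDerivation_apply] at h3
  simp only [sub_smul, Finset.sum_sub_distrib] at h3
  simp only [Module.End.mul_apply]
  rw [← h3]
  abel

/-- The operators θ^α∧ and θ^α⌟ satisfy the hypotheses of `curvatureSum_ricci_identity` with h =
g^{αβ}; the rest is recognising its two sides. -/
theorem ricciOperator_eq (hcov : g.IsCompatible cov) (htor : cov.torsion = 0) (hU : IsOpen U)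
    {A : ∀ x, g.Cl x} (hA : IsSmoothMultiform g e U A) {x : M} (hx : x ∈ U) :
    ricciOperator g cov he A x =
      (∑ σ, wedge (ricciForm g cov he σ x) (g.contract (coframeLower g he σ x) (A x))) +
        curvatureOperator g cov he x (A x) := by
  have h := curvatureSum_ricci_identity (A := Module.End ℝ (g.Cl x))
    (a := coframeExt g he x) (i := coframeContract g he x)
    (h := fun α β ↦ gUpper g he α β x) (isCurvatureTensor_riemannLower g he hcov htor hU hx)
    (fun α β ↦ gUpper_symm he g α β x) (fun _ _ ↦ extMul_mul_extMul _ _)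
    (fun _ _ ↦ contractLeft_mul_contractLeft _ _) (fun _ _ ↦ contractLeft_mul_extMul _ _)
  rw [curvatureOperator_eq g cov he hx, sum_wedge_ricciForm_contract g cov he hx,
    ← LinearMap.add_apply, ← h, ricciOperator_eq_half_sum g he htor hU hA hx, LinearMap.neg_apply,
    LinearMap.smul_apply]
  congr 2
  have h1 : ∑ α, ∑ β, coframeWedge g he α β x * ∑ ρ, ∑ μ, riemann cov he ρ μ α β x •
      (coframeExt g he x ρ * frameContract g e x μ) (A x) =
      ∑ ρ, ∑ μ, ∑ α, ∑ β, riemann cov he ρ μ α β x • (coframeWedge g he α β x *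
        (coframeExt g he x ρ * frameContract g e x μ) (A x)) := by
    simp only [Finset.mul_sum, mul_smul_comm]
    calc _ = ∑ α, ∑ ρ, ∑ β, ∑ μ, riemann cov he ρ μ α β x • (coframeWedge g he α β x *
        (coframeExt g he x ρ * frameContract g e x μ) (A x)) :=
          Finset.sum_congr rfl fun _ _ ↦ Finset.sum_comm
      _ = ∑ ρ, ∑ α, ∑ β, ∑ μ, riemann cov he ρ μ α β x • (coframeWedge g he α β x *
        (coframeExt g he x ρ * frameContract g e x μ) (A x)) := Finset.sum_comm
      _ = _ := Finset.sum_congr rfl fun _ _ ↦ (sum_comm_cycle _).symm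
  rw [h1, sum_riemann_smul g cov he hx (fun ρ μ α β ↦ coframeWedge g he α β x *
        (coframeExt g he x ρ * frameContract g e x μ) (A x)), curvatureSum_apply]
  refine curvatureSum_congr fun ρ μ α β ↦ ?_
  rw [Module.End.mul_apply _ (coframeExt g he x ρ * coframeContract g he x μ), ← coframeWedge_mul]
  exact sum_smul_map_frameContract g he hx
    (LinearMap.mulLeft ℝ (coframeWedge g he α β x) ∘ₗ coframeExt g he x ρ) μ (A x)

end RicciOperator

/-! ### Multiplication by an even element that anticommutes with vectors -/

section VolumeElement

open CliffordAlgebra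

variable {V : Type*} [AddCommGroup V] [Module ℝ V] {B : LinearMap.BilinForm ℝ V}
  {τ : CliffordAlgebra B.toQuadraticMap}

/-- Twice a∧X and twice a⌟X are aX ± X̂a, with X̂ the grade involution of X. For X = Yτ, moving a
past τ flips the sign and exchanges the two operations. -/
theorem extMul_mul_volume (hB : ∀ a b, B a b = B b a) (hτ : involute τ = τ)
    (hτ' : ∀ a, ι B.toQuadraticMap a * τ = -(τ * ι B.toQuadraticMap a)) (a : V)
    (Y : CliffordAlgebra B.toQuadraticMap) :
    extMul B.toQuadraticMap a (Y * τ) = contractLeft (B a) Y * τ := by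
  apply smul_right_injective _ (two_ne_zero : (2 : ℝ) ≠ 0)
  simp only
  rw [extMul_apply, two_smul_wedge hB, ← smul_mul_assoc, two_smul_contractLeft hB, map_mul, hτ,
    mul_assoc _ τ, ← neg_neg (τ * _), ← hτ', sub_mul]
  noncomm_ring

theorem contractLeft_mul_volume (hB : ∀ a b, B a b = B b a) (hτ : involute τ = τ)
    (hτ' : ∀ a, ι B.toQuadraticMap a * τ = -(τ * ι B.toQuadraticMap a)) (a : V)
    (Y : CliffordAlgebra B.toQuadraticMap) :
    contractLeft (B a) (Y * τ) = extMul B.toQuadraticMap a Y * τ := by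
  apply smul_right_injective _ (two_ne_zero : (2 : ℝ) ≠ 0)
  simp only
  rw [extMul_apply, two_smul_contractLeft hB, ← smul_mul_assoc, two_smul_wedge hB, map_mul, hτ,
    mul_assoc _ τ, ← neg_neg (τ * _), ← hτ', add_mul]
  noncomm_ring

theorem extMul_one (hB : ∀ a b, B a b = B b a) (a : V) :
    extMul B.toQuadraticMap a 1 = ι B.toQuadraticMap a := by
  have := ι_mul_eq hB a 1
  rwa [mul_one, contractLeft_one, add_zero, ← extMul_apply, eq_comm] at this

end VolumeElement

/-! ### The Hodge star and the Einstein operator -/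

section EinsteinOperator

open CliffordAlgebra

variable {M : Type*} [TopologicalSpace M] [ChartedSpace R4 M] [IsManifold (𝓡 4) ∞ M]
  {g : LorentzMetric M}

theorem LorentzMetric.VolumeForm.involute_eq (τ : g.VolumeForm) (x : M) :
    involute (τ.toFun x) = τ.toFun x := by
  obtain ⟨c, -, hτ⟩ := τ.normalized x
  rw [hτ]
  simp only [map_mul, involute_ι]
  noncomm_ring

theorem LorentzMetric.VolumeForm.isUnit (τ : g.VolumeForm) (x : M) : IsUnit (τ.toFun x) := by
  obtain ⟨c, hc, hτ⟩ := τ.normalized x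
  have h : ∀ i, IsUnit (g.oneForm x (c i)) := by
    intro i
    refine isUnit_ι_of_isUnit _ ?_
    rw [LinearMap.BilinMap.toQuadraticMap_apply, hc, minkowski, if_pos rfl]
    split_ifs <;> simp
  rw [hτ]
  exact (((h 0).mul (h 1)).mul (h 2)).mul (h 3)

/-- It suffices to take a vector of the orthonormal basis: passing τ, it commutes with itself and
anticommutes with the other three factors, which gives an odd sign. -/
theorem LorentzMetric.VolumeForm.ι_mul (τ : g.VolumeForm) (x : M)
    (v : Module.Dual ℝ (TangentSpace (𝓡 4) x)) :
    g.oneForm x v * τ.toFun x = -(τ.toFun x * g.oneForm x v) := by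
  obtain ⟨c, hc, hτ⟩ := τ.normalized x
  have anti : ∀ i j, i ≠ j → g.oneForm x (c i) * g.oneForm x (c j)
      = -(g.oneForm x (c j) * g.oneForm x (c i)) := by
    intro i j hij
    refine ι_mul_ι_comm_of_isOrtho ?_
    rw [QuadraticMap.isOrtho_def]
    have h1 := hc i j
    have h2 := hc j i
    simp only [minkowski, if_neg hij, if_neg hij.symm] at h1 h2
    simp [h1, h2]
  have anti' : ∀ i j, i ≠ j → ∀ z, g.oneForm x (c i) * (g.oneForm x (c j) * z)
      = -(g.oneForm x (c j) * (g.oneForm x (c i) * z)) := by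
    intro i j hij z
    rw [← mul_assoc, anti i j hij, neg_mul, mul_assoc]
  have key : LinearMap.mulRight ℝ (τ.toFun x) ∘ₗ ι (g.cometric x).toQuadraticMap
      = -(LinearMap.mulLeft ℝ (τ.toFun x) ∘ₗ ι (g.cometric x).toQuadraticMap) := by
    refine c.ext fun i ↦ ?_
    have a30 := anti 3 0 (by decide)
    have a31 := anti 3 1 (by decide)
    have a32 := anti 3 2 (by decide)
    have b10 := anti' 1 0 (by decide)
    have b20 := anti' 2 0 (by decide)
    have b30 := anti' 3 0 (by decide)
    have b21 := anti' 2 1 (by decide)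
    have b31 := anti' 3 1 (by decide)
    have b32 := anti' 3 2 (by decide)
    simp only [LinearMap.coe_comp, Function.comp_apply, LinearMap.mulRight_apply,
      LinearMap.neg_apply, LinearMap.mulLeft_apply, hτ]
    fin_cases i <;>
      simp only [Fin.zero_eta, Fin.mk_one, Fin.reduceFinMk, mul_assoc, a30, a31,
        a32, b10, b20, b30, b21, b31, b32, mul_neg, neg_neg]
  exact LinearMap.congr_fun key v

/-- Reversion is an involution and τ is a unit. Consequently `Function.invFun` in the definition of
the Einstein operator is a genuine left inverse of the star. -/
theorem hodgeStar_injective (τ : g.VolumeForm) (x : M) :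
    Function.Injective (hodgeStar g τ x) := by
  intro A B h
  exact reverse_involutive.injective ((τ.isUnit x).mul_right_cancel h)

variable (g) {cov : CovariantDerivative (𝓡 4) R4 (TangentSpace (𝓡 4) : M → Type _)}
  {U : Set M} {e : Fin 4 → ∀ x : M, TangentSpace (𝓡 4) x}
  (he : IsLocalFrameOn (𝓡 4) R4 ∞ e U)

theorem sum_comm_reverse {E J : Type*} [AddCommMonoid E] [Fintype J] (f : J → J → J → J → E) :
    ∑ β, ∑ ρ, ∑ α, ∑ μ, f ρ μ α β = ∑ ρ, ∑ μ, ∑ α, ∑ β, f ρ μ α β := by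
  rw [Finset.sum_comm]
  refine Finset.sum_congr rfl fun ρ _ ↦ ?_
  rw [sum_comm_cycle, Finset.sum_comm]

theorem ricciForm_eq {x : M} (hx : x ∈ U) (κ : Fin 4) :
    ricciForm g cov he κ x = curvatureSum (riemannLower g cov he x) (fun ρ μ α β ↦
      (gUpper g he ρ α x * gUpper g he κ μ x) • g.oneForm x (coframe he β x)) := by
  simp only [ricciForm, ricciTensor, riemann_eq_sum_riemannLower g cov he hx, Finset.mul_sum,
    Finset.sum_smul]
  refine (sum_comm_reverse _).trans ?_
  simp only [curvatureSum, smul_smul]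
  refine Finset.sum_congr rfl fun ρ _ ↦ Finset.sum_congr rfl fun μ _ ↦
      Finset.sum_congr rfl fun α _ ↦ Finset.sum_congr rfl fun β _ ↦ ?_
  congr 1
  ring

theorem scalarCurvature_eq {x : M} (hx : x ∈ U) :
    scalarCurvature g cov he x = curvatureSum (riemannLower g cov he x) (fun ρ μ α β ↦
      gUpper g he ρ α x * gUpper g he μ β x) := by
  simp only [scalarCurvature, ricciTensor, riemann_eq_sum_riemannLower g cov he hx, Finset.mul_sum]
  refine (sum_comm_reverse _).trans ?_
  simp only [curvatureSum, smul_eq_mul]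
  refine Finset.sum_congr rfl fun ρ _ ↦ Finset.sum_congr rfl fun μ _ ↦
      Finset.sum_congr rfl fun α _ ↦ Finset.sum_congr rfl fun β _ ↦ ?_
  rw [gUpper_symm he g μ β]
  ring

theorem curvatureOperator_mul_volume (τ : g.VolumeForm) {x : M} (hx : x ∈ U) (A : g.Cl x) :
    curvatureOperator g cov he x (A * τ.toFun x) =
      ((1 / 2 : ℝ) • curvatureSum (riemannLower g cov he x) (fun ρ μ α β ↦
        coframeContract g he x α (coframeContract g he x β (coframeExt g he x ρ
          (coframeExt g he x μ A))))) * τ.toFun x := by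
  have h1 := extMul_mul_volume (g.cometric_symm x) (τ.involute_eq x) (τ.ι_mul x)
  have h2 := contractLeft_mul_volume (g.cometric_symm x) (τ.involute_eq x) (τ.ι_mul x)
  rw [curvatureOperator_eq g cov he hx, LinearMap.smul_apply, curvatureSum_apply, smul_mul_assoc]
  refine congrArg ((1 / 2 : ℝ) • ·) (Eq.trans ?_ (map_curvatureSum _
    (LinearMap.mulRight ℝ (τ.toFun x))).symm)
  refine curvatureSum_congr fun ρ μ α β ↦ ?_
  simp only [Module.End.mul_apply, LinearMap.mulRight_apply, coframeExt, coframeContract, h1, h2]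

theorem einsteinOperator_oneForm [T2Space M]
    [CovariantDerivative.ContMDiffCovariantDerivative cov ∞]
    (hcov : g.IsCompatible cov) (htor : cov.torsion = 0) (hU : IsOpen U) (τ : g.VolumeForm) {x : M}
    (hx : x ∈ U) (κ : Fin 4) :
    einsteinOperator g cov he τ x (g.oneForm x (coframe he κ x)) =
      ricciForm g cov he κ x
        - (1 / 2 : ℝ) • scalarCurvature g cov he x • g.oneForm x (coframe he κ x) := by
  -- The vector v is the unit 1, which every contraction annihilates; θ^κ is then θ^κ∧ applied to 1.
  have h := curvatureSum_einstein_identity (isCurvatureTensor_riemannLower g he hcov htor hU hx)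
    (a := coframeExt g he x) (i := coframeContract g he x) (h := fun α β ↦ gUpper g he α β x)
    (fun α β ↦ gUpper_symm he g α β x) (fun _ _ ↦ contractLeft_mul_extMul _ _) (v := 1)
    (fun _ ↦ contractLeft_one _ _) κ
  have h1 : ∀ β, coframeExt g he x β 1 = g.oneForm x (coframe he β x) :=
    fun β ↦ extMul_one (g.cometric_symm x) _
  simp only [h1] at h
  rw [← ricciForm_eq g he hx, ← scalarCurvature_eq g he hx] at h
  -- Reversion fixes 1-forms, so on them the star is right multiplication by τ.
  have hrev : ∀ c : ℝ, reverse (c • (ricciForm g cov he κ x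
      - (1 / 2 : ℝ) • scalarCurvature g cov he x • g.oneForm x (coframe he κ x))) =
      c • (ricciForm g cov he κ x
        - (1 / 2 : ℝ) • scalarCurvature g cov he x • g.oneForm x (coframe he κ x)) := by
    intro c
    simp only [ricciForm, map_smul, map_sub, map_sum, reverse_ι]
  -- The curvature operator carries ½ and the algebraic identity ¼, hence the factor 2, cancelled by
  -- the ½ of the Einstein operator.
  have hstar : curvatureOperator g cov he x (hodgeStar g τ x (g.oneForm x (coframe he κ x))) =
      hodgeStar g τ x ((2 : ℝ) • (ricciForm g cov he κ x
        - (1 / 2 : ℝ) • scalarCurvature g cov he x • g.oneForm x (coframe he κ x))) := by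
    rw [hodgeStar, hodgeStar, reverse_ι, hrev, curvatureOperator_mul_volume g he τ hx, ← h,
      smul_smul]
    norm_num
  rw [einsteinOperator, hstar, Function.leftInverse_invFun (hodgeStar_injective τ x), smul_smul]
  norm_num

end EinsteinOperator

/-! ### Components of products with 1-forms and 2-forms -/

section FibreComponents

open CliffordAlgebra

variable {V : Type*} [AddCommGroup V] [Module ℝ V] {Q : QuadraticForm ℝ V}
  {ι' : Type*} [Fintype ι'] [DecidableEq ι'] {d : ι' → Module.Dual ℝ V} {θ : ι' → V}

theorem fibreComponent_sum_extMul (hdθ : ∀ α β, d α (θ β) = if α = β then 1 else 0)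
    (c : ι' → ℝ) (B : CliffordAlgebra Q) {r : ℕ} (a : Fin r → ι') :
    fibreComponent d (∑ β, c β • extMul Q (θ β) B) (List.ofFn a) =
      ∑ p : Fin r, (-1 : ℝ) ^ (p : ℕ) * c (a p) *
        fibreComponent d B ((List.ofFn a).eraseIdx p) := by
  simp only [fibreComponent_sum, fibreComponent_smul, fibreComponent_extMul d hdθ, Finset.mul_sum]
  rw [Finset.sum_comm]
  refine Finset.sum_congr rfl fun p _ ↦ ?_
  rw [Finset.sum_eq_single (a p) (fun β _ hβ ↦ by rw [if_neg hβ.symm]; ring) (by simp)]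
  rw [if_pos rfl]
  ring

theorem sum_filter_lt_succ {r : ℕ} (q : Fin r) (f : Fin (r + 1) → ℝ) :
    ∑ p with p < q.succ, f p = f 0 + ∑ p with p < q, f p.succ := by
  rw [Finset.sum_filter, Finset.sum_filter, Fin.sum_univ_succ]
  simp only [Fin.succ_lt_succ_iff, Fin.succ_pos, if_true]

/-- Peeling off the first index either hits one of the two exterior factors, giving equal
contributions by antisymmetry of K, or falls on B. The first case supplies the pairs with p = 0, the
second the remaining ones by induction. -/
theorem fibreComponent_sum_extMul_extMul (hdθ : ∀ α β, d α (θ β) = if α = β then 1 else 0)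
    {K : ι' → ι' → ℝ} (hK : ∀ α β, K α β = -K β α) (B : CliffordAlgebra Q) {r : ℕ}
    (a : Fin r → ι') :
    fibreComponent d (∑ α, ∑ β, K α β • extMul Q (θ α) (extMul Q (θ β) B)) (List.ofFn a) =
      2 * ∑ q : Fin r, ∑ p with p < q, (-1 : ℝ) ^ ((p : ℕ) + q + 1) * K (a p) (a q) *
        fibreComponent d B (((List.ofFn a).eraseIdx q).eraseIdx p) := by
  induction r generalizing B with
  | zero =>
    simp only [fibreComponent_sum, fibreComponent_smul]
    simp [fibreComponent_nil, scalarPart_extMul]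
  | succ r ih =>
    have key : contractLeft (d (a 0)) (∑ α, ∑ β, K α β • extMul Q (θ α) (extMul Q (θ β) B)) =
        (2 : ℝ) • ∑ β, K (a 0) β • extMul Q (θ β) B +
          ∑ α, ∑ β, K α β • extMul Q (θ α) (extMul Q (θ β) (contractLeft (d (a 0)) B)) := by
      have h1 : ∑ α, ∑ β, K α β • ((if a 0 = α then (1 : ℝ) else 0) • extMul Q (θ β) B) =
          ∑ β, K (a 0) β • extMul Q (θ β) B := by
        rw [Finset.sum_eq_single (a 0) (fun α _ hα ↦ by simp [if_neg hα.symm]) (by simp)]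
        simp
      have h2 : ∑ α, ∑ β, K α β • extMul Q (θ α) ((if a 0 = β then (1 : ℝ) else 0) • B) =
          -∑ β, K (a 0) β • extMul Q (θ β) B := by
        rw [← Finset.sum_neg_distrib]
        refine Finset.sum_congr rfl fun α _ ↦ ?_
        rw [Finset.sum_eq_single (a 0) (fun α _ hα ↦ by simp [if_neg hα.symm]) (by simp),
          hK (a 0) α]
        simp
      have h3 : ∀ α β, contractLeft (d (a 0)) (K α β • extMul Q (θ α) (extMul Q (θ β) B)) =
          K α β • ((if a 0 = α then (1 : ℝ) else 0) • extMul Q (θ β) B) -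
          K α β • extMul Q (θ α) ((if a 0 = β then (1 : ℝ) else 0) • B) +
          K α β • extMul Q (θ α) (extMul Q (θ β) (contractLeft (d (a 0)) B)) := by
        intro α β
        rw [map_smul, contractLeft_extMul, contractLeft_extMul, hdθ, hdθ, map_sub]
        module
      simp only [map_sum, h3, Finset.sum_add_distrib, Finset.sum_sub_distrib]
      rw [h1, h2]
      module
    rw [List.ofFn_succ, fibreComponent_cons, key, fibreComponent_add, fibreComponent_smul,
      fibreComponent_sum_extMul hdθ, ih, Fin.sum_univ_succ, ← mul_add]
    congr 1
    have h0 : ∀ f : Fin (r + 1) → ℝ, ∑ p with p < (0 : Fin (r + 1)), f p = 0 := by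
      intro f; simp
    rw [h0, zero_add, ← Finset.sum_add_distrib]
    refine Finset.sum_congr rfl fun q _ ↦ ?_
    rw [sum_filter_lt_succ]
    congr 1
    · simp [pow_succ]
    · refine Finset.sum_congr rfl fun p _ ↦ ?_
      simp only [Fin.val_succ, List.eraseIdx_cons_succ, fibreComponent_cons]
      ring

theorem fibreComponent_swap (B : CliffordAlgebra Q) (ρ σ : ι') (l : List ι') :
    fibreComponent d B (ρ :: σ :: l) = -fibreComponent d B (σ :: ρ :: l) := by
  simp only [fibreComponent_cons]
  rw [contractLeft_comm, fibreComponent_neg]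

theorem sum_comm_last {E J K : Type*} [AddCommMonoid E] [Fintype J] (s : Finset K)
    (f : J → J → K → E) :
    ∑ ρ, ∑ σ, ∑ q ∈ s, f ρ σ q = ∑ q ∈ s, ∑ ρ, ∑ σ, f ρ σ q :=
  (Finset.sum_congr rfl fun _ _ ↦ Finset.sum_comm).trans Finset.sum_comm

/-- By pair symmetry and Bianchi, R_{αβlκ} is a sum of two terms that are exchanged, up to sign,
when α and β are swapped; against an antisymmetric W they contribute equally. -/
theorem IsCurvatureTensor.two_mul_sum {R : ι' → ι' → ι' → ι' → ℝ} (hR : IsCurvatureTensor R)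
    {W : ι' → ι' → ℝ} (hW : ∀ α β, W α β = -W β α) (κ l : ι') :
    2 * ∑ α, ∑ β, R α κ β l * W α β = -∑ α, ∑ β, R α β l κ * W α β := by
  have h1 : ∀ α β, R α β l κ * W α β = -(R α κ β l * W α β) - R β κ α l * W β α := by
    intro α β
    rw [hR.pair_symm α β, hW β α]
    linear_combination W α β * hR.bianchi l κ α β - W α β * hR.antisymm_right β κ α l
  simp only [h1, Finset.sum_sub_distrib, Finset.sum_neg_distrib]
  rw [Finset.sum_comm (f := fun α β ↦ R β κ α l * W β α)]
  ring

end FibreComponents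

/-! ### The square of the Dirac operator -/

section HodgeLaplacian

open CliffordAlgebra

variable {M : Type*} [TopologicalSpace M] [ChartedSpace R4 M] [IsManifold (𝓡 4) ∞ M]
  {g : LorentzMetric M}
  {cov : CovariantDerivative (𝓡 4) R4 (TangentSpace (𝓡 4) : M → Type _)}
  {U : Set M} {e : Fin 4 → ∀ x : M, TangentSpace (𝓡 4) x}
  (he : IsLocalFrameOn (𝓡 4) R4 ∞ e U)

theorem IsSmoothMultiform.oneForm_mul {A : ∀ x, g.Cl x} (hA : IsSmoothMultiform g e U A)
    (β : Fin 4) :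
    IsSmoothMultiform g e U (fun x ↦ g.oneForm x (coframe he β x) * A x) := by
  refine ((hA.extMul he β).add (.sum (s := Finset.univ) fun ρ _ ↦
    .smul (smoothOn_gUpper he g β ρ) (hA.contractLeft ρ))).congr fun x hx ↦ ?_
  rw [ι_mul_eq (g.cometric_symm x), extMul_apply]
  congr 1
  exact (sum_smul_map_frameContract g he hx LinearMap.id β (A x)).symm

theorem covMultiform_sum (hU : IsOpen U) {J : Type*} {s : Finset J} {A : J → ∀ x, g.Cl x}
    (hA : ∀ j ∈ s, IsSmoothMultiform g e U (A j)) (β : Fin 4) {x : M} (hx : x ∈ U) :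
    covMultiform g cov he β (fun y ↦ ∑ j ∈ s, A j y) x =
      ∑ j ∈ s, covMultiform g cov he β (A j) x := by
  simp only [covMultiform_eq he cov hx, frameDeriv_sum he hU hA β hx, map_sum,
    Finset.sum_sub_distrib]

theorem covComponent_congr (hU : IsOpen U) {T T' : List (Fin 4) → M → ℝ}
    (h : ∀ l, ∀ x ∈ U, T l x = T' l x) (β : Fin 4) (l : List (Fin 4)) {x : M} (hx : x ∈ U) :
    covComponent cov he T β l x = covComponent cov he T' β l x := by
  rw [covComponent, covComponent]
  simp only [fun l ↦ h l x hx]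
  congr 1
  exact dirDeriv_congr hU (h l) _ hx

/-- The additional slot β of ∇T contributes -γ^σ_{αβ} ∇_σ T, which is precisely the correction in
the definition of ∂∧∂. -/
theorem secondCovComponent_eq (T : List (Fin 4) → M → ℝ) (α β : Fin 4) (l : List (Fin 4))
    (x : M) :
    secondCovComponent cov he T α β l x =
      covComponent cov he (fun l ↦ covComponent cov he T β l) α l x -
        ∑ σ, connCoeff cov he σ α β x * covComponent cov he T σ l x := by
  have h : ∑ i : Fin (β :: l).length, ∑ σ, connCoeff cov he σ α ((β :: l).get i) x *
      covTensor cov he T ((β :: l).set i σ) x =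
      (∑ σ, connCoeff cov he σ α β x * covComponent cov he T σ l x) +
        ∑ i : Fin l.length, ∑ σ, connCoeff cov he σ α (l.get i) x *
          covComponent cov he T β (l.set i σ) x := by
    refine (Fin.sum_univ_succ (fun i : Fin (l.length + 1) ↦
      ∑ σ, connCoeff cov he σ α ((β :: l).get i) x *
        covTensor cov he T ((β :: l).set i σ) x)).trans ?_
    simp [covTensor]
  rw [secondCovComponent, covComponent, h, covComponent]
  simp only [covTensor]
  ring

variable [T2Space M] [CovariantDerivative.ContMDiffCovariantDerivative cov ∞]

set_option maxHeartbeats 1000000 in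
-- The outer ∇_α acts on θ^β ∇_β A by the Leibniz rule; relabelling the term from ∇_α θ^β turns it
-- into the correction -γ^ρ_{αβ} ∇_ρ A.
theorem hodgeLaplacian_eq_sum (hcov : g.IsCompatible cov) (hU : IsOpen U) {A : ∀ x, g.Cl x}
    (hA : IsSmoothMultiform g e U A) {x : M} (hx : x ∈ U) :
    hodgeLaplacian g cov he A x = ∑ α, ∑ β,
      g.oneForm x (coframe he α x) * (g.oneForm x (coframe he β x) *
        (covMultiform g cov he α (covMultiform g cov he β A) x -
          ∑ ρ, connCoeff cov he ρ α β x • covMultiform g cov he ρ A x)) := by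
  have hD := fun β ↦ hA.covMultiform (cov := cov) he hU β
  rw [hodgeLaplacian, dirac]
  refine Finset.sum_congr rfl fun α _ ↦ ?_
  rw [← Finset.mul_sum]
  congr 1
  have h1 : covMultiform g cov he α (dirac g cov he A) x =
      ∑ β, covMultiform g cov he α
        (fun y ↦ g.oneForm y (coframe he β y) * covMultiform g cov he β A y) x :=
    covMultiform_sum he hU (fun β _ ↦ (hD β).oneForm_mul he β) α hx
  rw [h1]
  simp only [covMultiform_oneForm_mul he hcov hU (hD _) α _ hx, mul_sub, Finset.sum_sub_distrib,
    Finset.mul_sum, mul_smul_comm]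
  congr 1
  exact Finset.sum_comm

/-- Split θ^αθ^β into θ^α∧θ^β, which gives the Ricci operator, and g^{αβ}, which gives the trace of
the second covariant derivative. -/
theorem hodgeLaplacian_eq (hcov : g.IsCompatible cov) (hU : IsOpen U) {A : ∀ x, g.Cl x}
    (hA : IsSmoothMultiform g e U A) {x : M} (hx : x ∈ U) :
    hodgeLaplacian g cov he A x = ricciOperator g cov he A x +
      ∑ α, ∑ β, gUpper g he α β x •
        (covMultiform g cov he α (covMultiform g cov he β A) x -
          ∑ ρ, connCoeff cov he ρ α β x • covMultiform g cov he ρ A x) := by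
  rw [hodgeLaplacian_eq_sum he hcov hU hA hx, ricciOperator, ← Finset.sum_add_distrib]
  refine Finset.sum_congr rfl fun α _ ↦ ?_
  rw [← Finset.sum_add_distrib]
  refine Finset.sum_congr rfl fun β _ ↦ ?_
  rw [← mul_assoc, ι_mul_eq (g.cometric_symm x), contractLeft_ι, add_mul,
    Algebra.algebraMap_eq_smul_one, smul_one_mul]
  rfl

theorem fibreComponent_secondCovariant (hU : IsOpen U) {A : ∀ x, g.Cl x}
    (hA : IsSmoothMultiform g e U A) (α β : Fin 4) (l : List (Fin 4)) {x : M} (hx : x ∈ U) :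
    fibreComponent (frameEval e x) (covMultiform g cov he α (covMultiform g cov he β A) x -
      ∑ ρ, connCoeff cov he ρ α β x • covMultiform g cov he ρ A x) l =
      secondCovComponent cov he (component g e A) α β l x := by
  rw [secondCovComponent_eq, fibreComponent_sub, fibreComponent_sum,
    fibreComponent_covMultiform he cov hU (hA.covMultiform he hU β) α l hx]
  simp only [fibreComponent_smul, fibreComponent_covMultiform he cov hU hA _ l hx]
  congr 1
  exact covComponent_congr he hU
    (fun l y hy ↦ fibreComponent_covMultiform he cov hU hA β l hy) α l hx

theorem isHomogeneousOfDegree_covMultiform (hU : IsOpen U) {A : ∀ x, g.Cl x}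
    (hA : IsSmoothMultiform g e U A) {r : ℕ} (hr : ∀ x ∈ U, IsHomogeneousOfDegree r (A x))
    (β : Fin 4) {x : M} (hx : x ∈ U) :
    IsHomogeneousOfDegree r (covMultiform g cov he β A x) := by
  refine isHomogeneousOfDegree_of_fibreComponent _ (eq_sum_frameEval he hx) fun l hl ↦ ?_
  have h0 : ∀ l : List (Fin 4), l.length ≠ r → ∀ y ∈ U, component g e A l y = 0 :=
    fun l hl y hy ↦ fibreComponent_of_isHomogeneousOfDegree _ (hr y hy) hl
  rw [fibreComponent_covMultiform he cov hU hA β l hx, covComponent]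
  have h1 : mvfderiv (𝓡 4) (component g e A l) x (e β x) = 0 :=
    (dirDeriv_congr hU (h0 l hl) (e β) hx).trans (dirDeriv_const _ _ _)
  rw [h1, zero_sub, neg_eq_zero]
  refine Finset.sum_eq_zero fun i _ ↦ Finset.sum_eq_zero fun σ _ ↦ ?_
  rw [h0 _ (by simpa using hl) x hx, mul_zero]

variable (g cov)

/-- Positions are counted from 0, whereas the sign is written for positions counted from 1; this
accounts for the exponent p + 1 and the leading minus sign. -/
theorem fibreComponent_sum_wedge_ricciForm {x : M} (hx : x ∈ U) (A : g.Cl x) {r : ℕ}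
    (a : Fin r → Fin 4) :
    fibreComponent (frameEval e x)
      (∑ σ, wedge (ricciForm g cov he σ x) (g.contract (coframeLower g he σ x) A)) (List.ofFn a) =
      -∑ p : Fin r, (-1 : ℝ) ^ ((p : ℕ) + 1) * ∑ σ, ricciTensor g cov he σ (a p) x *
        fibreComponent (frameEval e x) A (σ :: (List.ofFn a).eraseIdx p) := by
  have h1 : ∀ σ, wedge (ricciForm g cov he σ x) (g.contract (coframeLower g he σ x) A) =
      ∑ β, ricciTensor g cov he σ β x • extMul _ (coframe he β x) (frameContract g e x σ A) := by
    intro σ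
    rw [contract_coframeLower g he hx, ← wedgeBilin_apply, ricciForm]
    simp only [map_smul, map_sum, LinearMap.smul_apply, LinearMap.sum_apply]
    rfl
  rw [fibreComponent_sum]
  simp only [h1, fibreComponent_sum_extMul (frameEval_coframe he hx), ← fibreComponent_cons]
  rw [Finset.sum_comm, ← Finset.sum_neg_distrib]
  refine Finset.sum_congr rfl fun p _ ↦ ?_
  rw [pow_succ, mul_neg_one, neg_mul, neg_neg, Finset.mul_sum]
  exact Finset.sum_congr rfl fun σ _ ↦ mul_assoc _ _ _

/-- Move the factors g^{ρα} g^{σβ} onto A, which stays antisymmetric as W, and apply the Bianchi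
consequence `IsCurvatureTensor.two_mul_sum` to the lowered tensor. -/
theorem sum_riemannUpDownUpDown {x : M} (hx : x ∈ U)
    (hR : IsCurvatureTensor (riemannLower g cov he x))
    {A : Fin 4 → Fin 4 → ℝ} (hA : ∀ ρ σ, A ρ σ = -A σ ρ) (κ l : Fin 4) :
    2 * ∑ ρ, ∑ σ, riemannUpDownUpDown g cov he ρ κ σ l x * A ρ σ =
      ∑ ρ, ∑ σ, (∑ μ, gUpper g he ρ μ x * riemann cov he μ σ l κ x) * A σ ρ := by
  let W : Fin 4 → Fin 4 → ℝ := fun α β ↦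
    ∑ ρ, ∑ σ, gUpper g he ρ α x * gUpper g he σ β x * A ρ σ
  have hW : ∀ α β, W α β = -W β α := by
    intro α β
    simp only [W]
    rw [Finset.sum_comm]
    simp only [← Finset.sum_neg_distrib]
    refine Finset.sum_congr rfl fun ρ _ ↦ Finset.sum_congr rfl fun σ _ ↦ ?_
    rw [hA]
    ring
  have hs : ∀ F : Fin 4 → Fin 4 → ℝ, ∑ ρ, ∑ σ, (∑ α, ∑ β, gUpper g he ρ α x * gUpper g he σ β x *
      F α β) * A ρ σ = ∑ α, ∑ β, F α β * W α β := by
    intro F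
    simp only [W, Finset.sum_mul, Finset.mul_sum]
    calc _ = ∑ ρ, ∑ α, ∑ β, ∑ σ, gUpper g he ρ α x * gUpper g he σ β x * F α β * A ρ σ :=
          Finset.sum_congr rfl fun _ _ ↦ sum_comm_cycle _
      _ = ∑ α, ∑ β, ∑ ρ, ∑ σ, gUpper g he ρ α x * gUpper g he σ β x * F α β * A ρ σ :=
          sum_comm_cycle _
      _ = _ := by
        refine Finset.sum_congr rfl fun _ _ ↦ Finset.sum_congr rfl fun _ _ ↦
          Finset.sum_congr rfl fun _ _ ↦ Finset.sum_congr rfl fun _ _ ↦ ?_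
        ring
  have h1 : ∀ ρ σ, riemannUpDownUpDown g cov he ρ κ σ l x =
      ∑ α, ∑ β, gUpper g he ρ α x * gUpper g he σ β x * riemannLower g cov he x α κ β l := by
    intro ρ σ
    simp only [riemannUpDownUpDown, riemannLower, Finset.mul_sum, mul_assoc]
  have h2 : ∀ ρ σ, (∑ μ, gUpper g he ρ μ x * riemann cov he μ σ l κ x) =
      ∑ α, ∑ β, gUpper g he ρ α x * gUpper g he σ β x * riemannLower g cov he x α β l κ := by
    intro ρ σ
    simp only [riemann_eq_sum_riemannLower g cov he hx, Finset.mul_sum, mul_assoc]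
  have h3 : ∑ ρ, ∑ σ, (∑ μ, gUpper g he ρ μ x * riemann cov he μ σ l κ x) * A σ ρ =
      -∑ ρ, ∑ σ, (∑ μ, gUpper g he ρ μ x * riemann cov he μ σ l κ x) * A ρ σ := by
    simp only [← Finset.sum_neg_distrib]
    refine Finset.sum_congr rfl fun ρ _ ↦ Finset.sum_congr rfl fun σ _ ↦ ?_
    rw [hA ρ σ, mul_neg, neg_neg]
  rw [h3]
  simp only [h1, h2]
  rw [hs fun α β ↦ riemannLower g cov he x α κ β l, hs fun α β ↦ riemannLower g cov he x α β l κ]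
  exact hR.two_mul_sum hW κ l

theorem fibreComponent_curvatureOperator {x : M} (hx : x ∈ U)
    (hR : IsCurvatureTensor (riemannLower g cov he x)) (A : g.Cl x) {r : ℕ} (a : Fin r → Fin 4) :
    fibreComponent (frameEval e x) (curvatureOperator g cov he x A) (List.ofFn a) =
      -(2 * ∑ q : Fin r, ∑ p ∈ Finset.univ.filter (fun p ↦ p < q),
        (-1 : ℝ) ^ (((p : ℕ) + 1) + ((q : ℕ) + 1)) *
          ∑ ρ, ∑ σ, riemannUpDownUpDown g cov he ρ (a q) σ (a p) x *
            fibreComponent (frameEval e x) A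
              (ρ :: σ :: ((List.ofFn a).eraseIdx q).eraseIdx p)) := by
  let K : Fin 4 → Fin 4 → Fin 4 → Fin 4 → ℝ := fun ρ σ α β ↦
    ∑ μ, gUpper g he ρ μ x * riemann cov he μ σ α β x
  have hK : ∀ ρ σ α β, K ρ σ α β = -K ρ σ β α := by
    intro ρ σ α β
    simp only [K, ← Finset.sum_neg_distrib]
    exact Finset.sum_congr rfl fun μ _ ↦ by rw [riemann_antisymm he, mul_neg]
  have h1 : ∀ ρ σ, wedge (curvatureFormUpper g cov he ρ σ x)
      (g.contract (coframeLower g he ρ x) (g.contract (coframeLower g he σ x) A)) =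
      (1 / 2 : ℝ) • ∑ α, ∑ β, K ρ σ α β • extMul _ (coframe he α x) (extMul _ (coframe he β x)
        (frameContract g e x ρ (frameContract g e x σ A))) := by
    intro ρ σ
    rw [contract_coframeLower g he hx, contract_coframeLower g he hx, ← wedgeBilin_apply,
      curvatureFormUpper]
    simp only [map_smul, map_sum, LinearMap.smul_apply, LinearMap.sum_apply]
    simp only [wedgeBilin_apply, wedge_curvatureForm, K, Finset.sum_smul, Finset.smul_sum]
    refine (sum_comm_cycle _).trans ?_
    refine Finset.sum_congr rfl fun α _ ↦ Finset.sum_congr rfl fun β _ ↦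
      Finset.sum_congr rfl fun μ _ ↦ ?_
    rw [smul_comm, mul_smul]
    rfl
  have h2 : ∀ ρ σ, fibreComponent (frameEval e x) (wedge (curvatureFormUpper g cov he ρ σ x)
      (g.contract (coframeLower g he ρ x) (g.contract (coframeLower g he σ x) A))) (List.ofFn a) =
      ∑ q : Fin r, ∑ p with p < q, (-1 : ℝ) ^ ((p : ℕ) + q + 1) * K ρ σ (a p) (a q) *
        fibreComponent (frameEval e x) A (σ :: ρ :: ((List.ofFn a).eraseIdx q).eraseIdx p) := by
    intro ρ σ
    rw [h1, fibreComponent_smul,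
      fibreComponent_sum_extMul_extMul (frameEval_coframe he hx) (hK ρ σ), ← mul_assoc]
    norm_num
    rfl
  rw [curvatureOperator, fibreComponent_sum,
    Finset.sum_congr rfl fun ρ _ ↦ fibreComponent_sum _ _ _ _]
  simp only [h2]
  rw [sum_comm_last, Finset.mul_sum, ← Finset.sum_neg_distrib]
  refine Finset.sum_congr rfl fun q _ ↦ ?_
  rw [sum_comm_last, Finset.mul_sum, ← Finset.sum_neg_distrib]
  refine Finset.sum_congr rfl fun p _ ↦ ?_
  -- The outer 2 combines with the sum over ρ and σ to restore R^{ρσ}_{λκ}; reversing ρ and σ in the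
  -- component matches the order in which the two contractions act.
  rw [mul_left_comm, sum_riemannUpDownUpDown g cov he hx hR (fun ρ σ ↦ fibreComponent_swap A ρ σ _)]
  simp only [Finset.mul_sum, ← Finset.sum_neg_distrib]
  refine Finset.sum_congr rfl fun ρ _ ↦ Finset.sum_congr rfl fun σ _ ↦ ?_
  simp only [K, pow_add]
  ring

variable {g cov}

theorem component_hodgeLaplacian (hcov : g.IsCompatible cov) (htor : cov.torsion = 0)
    (hU : IsOpen U) {A : ∀ x, g.Cl x} (hA : IsSmoothMultiform g e U A) {x : M} (hx : x ∈ U) {r : ℕ}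
    (a : Fin r → Fin 4) :
    component g e (hodgeLaplacian g cov he A) (List.ofFn a) x =
      (∑ α, ∑ β, gUpper g he α β x *
          secondCovComponent cov he (component g e A) α β (List.ofFn a) x)
      - (∑ p : Fin r, (-1 : ℝ) ^ ((p : ℕ) + 1) * ∑ σ, ricciTensor g cov he σ (a p) x *
          component g e A (σ :: (List.ofFn a).eraseIdx p) x)
      - 2 * ∑ q : Fin r, ∑ p ∈ Finset.univ.filter (fun p ↦ p < q),
          (-1 : ℝ) ^ (((p : ℕ) + 1) + ((q : ℕ) + 1)) *
            ∑ ρ, ∑ σ, riemannUpDownUpDown g cov he ρ (a q) σ (a p) x *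
              component g e A (ρ :: σ :: ((List.ofFn a).eraseIdx q).eraseIdx p) x := by
  rw [component_eq, hodgeLaplacian_eq he hcov hU hA hx, ricciOperator_eq g he hcov htor hU hA hx,
    fibreComponent_add, fibreComponent_add, fibreComponent_sum_wedge_ricciForm g cov he hx,
    fibreComponent_curvatureOperator g cov he hx
      (isCurvatureTensor_riemannLower g he hcov htor hU hx), fibreComponent_sum]
  simp only [fibreComponent_sum _ _ _ (List.ofFn a), fibreComponent_smul,
    fibreComponent_secondCovariant he hU hA _ _ _ hx, component_eq]
  ring

/-- Covariant differentiation preserves degree, and each curvature term removes as many covector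
factors as it adds: its component on a list of length n uses only components of A on lists of length
n. -/
theorem isHomogeneousOfDegree_hodgeLaplacian (hcov : g.IsCompatible cov) (htor : cov.torsion = 0)
    (hU : IsOpen U) {A : ∀ x, g.Cl x} (hA : IsSmoothMultiform g e U A) {r : ℕ}
    (hr : ∀ x ∈ U, IsHomogeneousOfDegree r (A x)) {x : M} (hx : x ∈ U) :
    IsHomogeneousOfDegree r (hodgeLaplacian g cov he A x) := by
  have hD := fun β y (hy : y ∈ U) ↦
    isHomogeneousOfDegree_covMultiform (cov := cov) he hU hA hr β hy
  rw [hodgeLaplacian_eq he hcov hU hA hx, ricciOperator_eq g he hcov htor hU hA hx]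
  refine .add ?_ (.sum fun α _ ↦ .sum fun β _ ↦ .smul ?_ _)
  · refine isHomogeneousOfDegree_of_fibreComponent _ (eq_sum_frameEval he hx) fun l hl ↦ ?_
    obtain ⟨n, a, rfl⟩ : ∃ n, ∃ a : Fin n → Fin 4, l = List.ofFn a := ⟨_, l.get, by simp⟩
    rw [List.length_ofFn] at hl
    rw [fibreComponent_add, fibreComponent_sum_wedge_ricciForm g cov he hx,
      fibreComponent_curvatureOperator g cov he hx
        (isCurvatureTensor_riemannLower g he hcov htor hU hx)]
    have h0 : ∀ l : List (Fin 4), l.length = n → fibreComponent (frameEval e x) (A x) l = 0 :=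
      fun l h ↦ fibreComponent_of_isHomogeneousOfDegree _ (hr x hx) (h ▸ hl)
    have h1 : ∀ (p : Fin n) σ, fibreComponent (frameEval e x) (A x)
        (σ :: (List.ofFn a).eraseIdx p) = 0 := fun p σ ↦ h0 _ (by
      have := p.2
      rw [List.length_cons, List.length_eraseIdx_of_lt (by simp), List.length_ofFn]
      omega)
    have h2 : ∀ q : Fin n, ∀ p ∈ Finset.univ.filter (fun p : Fin n ↦ p < q), ∀ ρ σ,
        fibreComponent (frameEval e x) (A x)
          (ρ :: σ :: ((List.ofFn a).eraseIdx q).eraseIdx p) = 0 := fun q p hp ρ σ ↦ h0 _ (by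
      have hpq : (p : ℕ) < q := (Finset.mem_filter.1 hp).2
      have hq := q.2
      have hlen : ((List.ofFn a).eraseIdx q).length = n - 1 := by
        rw [List.length_eraseIdx_of_lt (by simp), List.length_ofFn]
      rw [List.length_cons, List.length_cons, List.length_eraseIdx_of_lt (by omega), hlen]
      omega)
    rw [Finset.sum_eq_zero fun q _ ↦ Finset.sum_eq_zero fun p hp ↦ by simp [h2 q p hp]]
    simp [h1]
  · rw [sub_eq_add_neg, ← neg_one_smul ℝ (∑ ρ, _)]
    exact (isHomogeneousOfDegree_covMultiform he hU (hA.covMultiform he hU β) (hD β) α hx).add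
      (.smul (.sum fun ρ _ ↦ .smul (hD ρ x hx) _) _)

end HodgeLaplacian

end

theorem mainTheorem3 {M : Type*} [TopologicalSpace M] [T2Space M] [ChartedSpace R4 M]
    [IsManifold (𝓡 4) ∞ M] (g : LorentzMetric M)
    (cov : CovariantDerivative (𝓡 4) R4 (TangentSpace (𝓡 4) : M → Type _))
    [CovariantDerivative.ContMDiffCovariantDerivative cov ∞]
    (hcov : g.IsCompatible cov) (htor : cov.torsion = 0)
    {U : Set M} (hU : IsOpen U) {e : Fin 4 → ∀ x : M, TangentSpace (𝓡 4) x}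
    (he : IsLocalFrameOn (𝓡 4) R4 ∞ e U) :
    (∀ A : ∀ x, g.Cl x, IsSmoothMultiform g e U A → ∀ x ∈ U,
      ricciOperator g cov he A x =
        (∑ σ, wedge (ricciForm g cov he σ x) (g.contract (coframeLower g he σ x) (A x)))
          + ∑ ρ, ∑ σ, wedge (curvatureFormUpper g cov he ρ σ x)
              (g.contract (coframeLower g he ρ x)
                (g.contract (coframeLower g he σ x) (A x)))) ∧
    (∀ (r : ℕ) (A : ∀ x, g.Cl x), IsSmoothMultiform g e U A →
      (∀ x ∈ U, IsHomogeneousOfDegree r (A x)) → ∀ x ∈ U,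
      IsHomogeneousOfDegree r (hodgeLaplacian g cov he A x) ∧
      ∀ a : Fin r → Fin 4,
        component g e (hodgeLaplacian g cov he A) (List.ofFn a) x =
          (∑ α, ∑ β, gUpper g he α β x *
              secondCovComponent cov he (component g e A) α β (List.ofFn a) x)
          - (∑ p : Fin r, (-1 : ℝ) ^ ((p : ℕ) + 1) * ∑ σ, ricciTensor g cov he σ (a p) x *
              component g e A (σ :: (List.ofFn a).eraseIdx p) x)
          - 2 * ∑ q : Fin r, ∑ p ∈ Finset.univ.filter (fun p ↦ p < q),
              (-1 : ℝ) ^ (((p : ℕ) + 1) + ((q : ℕ) + 1)) *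
                ∑ ρ, ∑ σ, riemannUpDownUpDown g cov he ρ (a q) σ (a p) x *
                  component g e A (ρ :: σ :: ((List.ofFn a).eraseIdx q).eraseIdx p) x) ∧
    (∀ τ : g.VolumeForm, ∀ x ∈ U, ∀ μ,
      einsteinOperator g cov he τ x (g.oneForm x (coframe he μ x)) =
        ricciForm g cov he μ x
          - (1 / 2 : ℝ) • scalarCurvature g cov he x • g.oneForm x (coframe he μ x)) := by
  refine ⟨fun A hA x hx ↦ ricciOperator_eq g he hcov htor hU hA hx, fun r A hA hr x hx ↦ ?_,
    fun τ x hx μ ↦ einsteinOperator_oneForm g he hcov htor hU τ hx μ⟩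
  refine ⟨isHomogeneousOfDegree_hodgeLaplacian he hcov htor hU hA hr hx, fun a ↦
    component_hodgeLaplacian he hcov htor hU hA hx a⟩
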